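/- Let $0<\beta\le 1$. For integers $d,M,r\ge 1$ let $\mathbf x_1,\dots,\mathbf x_r$ be independent random vectors, each with independent coordinates uniformly distributed on $[0,1)$, so that $\mathbf x_q$ is uniform on $[0,1)^d$. Let $\mathbf G_d$ be the $(2M+1)^d\times r$ matrix, with rows indexed by $\boldsymbol\ell\in\{-M,\dots,M\}^d$, whose entries are $$(\mathbf G_d)_{\boldsymbol\ell,q}=(2M+1)^{-d/2}\,e^{-2\pi i\,\mathbf x_q^{\mathsf T}\boldsymbol\ell},$$ and let $\mathbf T_d=\frac{(2M+1)^d}{r}\,\mathbf G_d\mathbf G_d^\dagger$. All limits "$M,r\to\infty$" below are taken with $(2M+1)^d/r\to\beta$. (1) For every $d\ge1$, the mean empirical eigenvalue distribution of $\mathbf T_d$ converges weakly, as $M,r\to\infty$, to a probability law on $\mathbb R$. Let $\lambda_{d,\beta}$ (the asymptotic eigenvalue of $\mathbf T_d$) be a random variable with this law. All its moments are finite, and for every $p\ge1$ $$\mathbb E[\lambda_{d,\beta}^p]=\lim_{M,r\to\infty}\frac1{(2M+1)^d}\,\mathbb E\big[\mathrm{Tr}(\mathbf T_d^p)\big].$$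 (2) For every $p\ge1$ the limit $\mathbb E[\lambda_{\infty,\beta}^p]:=\lim_{d\to\infty}\mathbb E[\lambda_{d,\beta}^p]$ exists and is the Narayana polynomial $$\mathbb E[\lambda_{\infty,\beta}^p]=\sum_{k=1}^{p}T(p,k)\,\beta^{p-k},\qquad T(p,k)=\frac1k\binom{p-1}{k-1}\binom{p}{k-1}.$$ (3) The limiting eigenvalue law is the Marčenko–Pastur distribution: the function $$f_{\infty,\beta}(x)=\frac{\sqrt{(c_1-x)(x-c_2)}}{2\pi x\beta}\quad(c_2\le x\le c_1),\qquad c_1=(1+\sqrt\beta)^2,\quad c_2=(1-\sqrt\beta)^2,$$ extended by $0$, is a probability density; the law with this density is the one and only probability law on $\mathbb R$ whose $p$-th moment is finite and equal to $\sum_{k=1}^{p}T(p,k)\beta^{p-k}$ for every $p\ge1$; and $\lambda_{d,\beta}$ converges in distribution to it as $d\to\infty$. -/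

import Mathlib

open MeasureTheory Filter Topology
open scoped BoundedContinuousFunction

/-- The harmonics `ℓ ∈ {-M, …, M}^d` of a `d`-dimensional field; there are `(2M+1)^d` of them. -/
abbrev Harmonics (d M : ℕ) : Type := Fin d → ↥(Finset.Icc (-(M : ℤ)) (M : ℤ))

/-- The `(2M+1)^d × r` matrix `G_d`, with entries `(2M+1)^{-d/2} exp(-2πi x_q · ℓ)`, for the
sampling points `x_1, …, x_r`. -/
noncomputable def samplingMatrix (d M r : ℕ) (x : Fin r → Fin d → ℝ) :
    Matrix (Harmonics d M) (Fin r) ℂ :=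
  Matrix.of fun l q =>
    (((2 * (M : ℝ) + 1) ^ (-(d : ℝ) / 2) : ℝ) : ℂ) *
      Complex.exp (-Complex.I * (2 * Real.pi * ∑ m : Fin d, x q m * ((l m : ℤ) : ℝ) : ℝ))

/-- The ratio `(2M+1)^d / r` between the number of harmonics and the number of samples. -/
noncomputable def harmonicsRatio (d M r : ℕ) : ℝ := (2 * (M : ℝ) + 1) ^ d / (r : ℝ)

/-- The matrix `T_d`, i.e. `G_d G_d^†` multiplied by the ratio `(2M+1)^d / r`. -/
noncomputable def reconstructionMatrix (d M r : ℕ) (x : Fin r → Fin d → ℝ) :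
    Matrix (Harmonics d M) (Harmonics d M) ℂ :=
  ((harmonicsRatio d M r : ℝ) : ℂ) •
    (samplingMatrix d M r x * (samplingMatrix d M r x).conjTranspose)

theorem reconstructionMatrix_isHermitian (d M r : ℕ) (x : Fin r → Fin d → ℝ) :
    (reconstructionMatrix d M r x).IsHermitian := by
  have h := Matrix.isHermitian_mul_conjTranspose_self (samplingMatrix d M r x)
  unfold Matrix.IsHermitian at *
  rw [reconstructionMatrix, Matrix.conjTranspose_smul, h]
  simp

/-- The law of the sampling points `x_1, …, x_r`: independent, with independent coordinates that
are uniform on `[0,1)`. -/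
noncomputable def samplingLaw (d r : ℕ) : Measure (Fin r → Fin d → ℝ) :=
  Measure.pi fun _ : Fin r => Measure.pi fun _ : Fin d =>
    (volume : Measure ℝ).restrict (Set.Ico 0 1)

/-- The integral of `f` against the mean empirical eigenvalue distribution of `T_d`:
`E[(2M+1)^{-d} ∑ f(λ)]`, the sum running over the eigenvalues `λ` of `T_d` with multiplicity. -/
noncomputable def meanEigenvalueIntegral (d M r : ℕ) (f : ℝ → ℝ) : ℝ :=
  ∫ x, ((2 * (M : ℝ) + 1) ^ d)⁻¹ *
    ∑ i, f ((reconstructionMatrix_isHermitian d M r x).eigenvalues i) ∂(samplingLaw d r)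

/-- The normalized mean trace `(2M+1)^{-d} E[Tr(T_d^p)]`. -/
noncomputable def meanTraceMoment (d M r p : ℕ) : ℂ :=
  ((2 * (M : ℂ) + 1) ^ d)⁻¹ *
    ∫ x, (reconstructionMatrix d M r x ^ p).trace ∂(samplingLaw d r)

/-- The regime in which the pair `(M, r)` tends to infinity in both entries, with
`(2M+1)^d / r` tending to `β`. -/
noncomputable def asymptoticRegime (d : ℕ) (β : ℝ) : Filter (ℕ × ℕ) :=
  (atTop ×ˢ atTop) ⊓ comap (fun n : ℕ × ℕ => harmonicsRatio d n.1 n.2) (𝓝 β)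

/-- The regime is not empty, so that limits along it are unique. -/
theorem asymptoticRegime_neBot {d : ℕ} (hd : 1 ≤ d) {β : ℝ} (hβ : 0 < β) :
    (asymptoticRegime d β).NeBot := by
  have hN : Tendsto (fun M : ℕ => (2 * (M : ℝ) + 1) ^ d / β) atTop atTop := by
    apply Tendsto.atTop_div_const hβ
    refine (tendsto_pow_atTop (by omega)).comp ?_
    exact tendsto_atTop_add_const_right _ _
      (tendsto_natCast_atTop_atTop.const_mul_atTop (by norm_num))
  have hr : Tendsto (fun M : ℕ => ⌈(2 * (M : ℝ) + 1) ^ d / β⌉₊) atTop atTop :=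
    tendsto_nat_ceil_atTop.comp hN
  have hlim : Tendsto (fun M : ℕ => harmonicsRatio d M ⌈(2 * (M : ℝ) + 1) ^ d / β⌉₊) atTop
      (𝓝 β) := by
    have h1 := ((tendsto_nat_ceil_div_atTop (R := ℝ)).comp hN).inv₀ one_ne_zero
    have h2 := h1.const_mul β
    simp only [inv_one, mul_one] at h2
    refine h2.congr fun M => ?_
    simp only [harmonicsRatio, Function.comp, inv_div]
    field_simp
  have ht : Tendsto (fun M : ℕ => (M, ⌈(2 * (M : ℝ) + 1) ^ d / β⌉₊)) atTop
      (asymptoticRegime d β) :=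
    tendsto_inf.2 ⟨tendsto_id.prodMk hr, tendsto_comap_iff.2 hlim⟩
  exact ht.neBot

/-- `ν` is the law of the asymptotic eigenvalue `λ_{d,β}` of `T_d`: the weak limit of the mean
empirical eigenvalue distributions of `T_d` as `M, r → ∞` with ratio `β`. -/
def IsAsymptoticEigenvalueLaw (d : ℕ) (β : ℝ) (ν : ProbabilityMeasure ℝ) : Prop :=
  ∀ f : ℝ →ᵇ ℝ, Tendsto (fun n : ℕ × ℕ => meanEigenvalueIntegral d n.1 n.2 f)
    (asymptoticRegime d β) (𝓝 (∫ y, f y ∂(ν : Measure ℝ)))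

/-- The Narayana number `T(p,k) = (1/k) C(p-1,k-1) C(p,k-1)`, for `1 ≤ k ≤ p`. -/
noncomputable def narayanaNumber (p k : ℕ) : ℝ :=
  1 / (k : ℝ) * ((p - 1).choose (k - 1) : ℝ) * (p.choose (k - 1) : ℝ)

/-- The Narayana polynomial `∑_{k=1}^p T(p,k) β^{p-k}`, for `p ≥ 1`. -/
noncomputable def narayanaPolynomial (p : ℕ) (β : ℝ) : ℝ :=
  ∑ k ∈ Finset.Icc 1 p, narayanaNumber p k * β ^ (p - k)

/-- The Marchenko–Pastur density: `√((c₁-x)(x-c₂)) / (2πxβ)` for `c₂ ≤ x ≤ c₁`, and `0` elsewhere,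
where `c₁ = (1+√β)²` and `c₂ = (1-√β)²`. -/
noncomputable def marchenkoPasturDensity (β x : ℝ) : ℝ :=
  Set.indicator (Set.Icc ((1 - √β) ^ 2) ((1 + √β) ^ 2))
    (fun y => √(((1 + √β) ^ 2 - y) * (y - (1 - √β) ^ 2)) / (2 * Real.pi * y * β)) x

/-- The measure on `ℝ` with the Marchenko–Pastur density. -/
noncomputable def marchenkoPastur (β : ℝ) : Measure ℝ :=
  (volume : Measure ℝ).withDensity fun x => ENNReal.ofReal (marchenkoPasturDensity β x)

/-! An entry of `T_d` is the average over the samples of a character at the difference of two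
harmonics. The trace of the `p`-th power is therefore a sum over closed paths of harmonics and over
labels `q : Fin p → Fin r`, and integration over the uniform samples keeps the paths whose
increments cancel at every sample. Only the partition `s` of the `p` steps by equal labels matters,
and the `d` coordinates decouple. If `s` has `k` classes, its contribution is a factor tending to
`1`, times the ratio to the power `p - k`, times the `d`-th power of the normalized number of
one-dimensional `circulations` (`meanTraceMoment_eq_sum_setoid`).

The `k` balance conditions form a unitriangular integer system, so `p - k + 1` integers are free and
the normalized number tends to the relative volume `v(s)` of a polytope inside a cube
(`tendsto_card_circulations`). The limit of the `p`-th moment is thus the sum of `β ^ (p - k) * v(s)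
^ d` over all partitions. Singleton classes and neighbours in a common class can be removed without
changing `v(s)`. A nonempty partition that admits no such removal has a crossing, and a whole box of
free values is then excluded. Hence `v(s) = 1` for noncrossing `s` and `v(s) < 1` otherwise
(`card_circulations_dichotomy`), and as `d → ∞` only the noncrossing partitions survive.

There are at most `p!` partitions and `β ≤ 1`, so all limit moments are at most `p!`. This makes the
complex moment generating function analytic on a strip, so the moments determine the law; with
tightness, convergence of moments becomes weak convergence (`exists_limit_of_moments`). It is used
twice, for `M, r → ∞` and for `d → ∞`.

Finally, the noncrossing polynomial, the Narayana polynomial and the Marchenko–Pastur moments are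
identified by embedding each into a two-parameter family that obeys one recursion, `IsPathCount`:
coefficients of powers of a generating series, coefficients of an explicit polynomial, and integrals
against `sin (h * θ)`. -/

/-! ### The method of moments -/

theorem abs_sub_clamp_le {K : ℝ} (hK : 0 < K) (z : ℝ) :
    |z - max (-K) (min z K)| ≤ z ^ 2 / K := by
  rw [le_div_iff₀ hK]
  rcases le_total z K with h | h
  · rw [min_eq_left h]
    rcases le_total (-K) z with h' | h'
    · rw [max_eq_right h']
      simp only [sub_self, abs_zero, zero_mul]
      positivity
    · rw [max_eq_left h', abs_of_nonpos (by linarith)]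
      nlinarith
  · rw [min_eq_right h, max_eq_right (by linarith), abs_of_nonneg (by linarith)]
    nlinarith

/-- Fatou's lemma for weak convergence: the truncations of `f` at height `K` are bounded and
continuous, and monotone convergence in `K` recovers `f`. -/
theorem integral_le_of_tendsto_probabilityMeasure {α : Type*} {G : Filter α} [G.NeBot]
    {ρ : α → ProbabilityMeasure ℝ} {ν : ProbabilityMeasure ℝ} (hρ : Tendsto ρ G (𝓝 ν))
    {f : ℝ → ℝ} (hf : Continuous f) (hf0 : ∀ y, 0 ≤ f y) {m : ℝ}
    (hint : ∀ᶠ n in G, Integrable f (ρ n : Measure ℝ))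
    (hm : Tendsto (fun n => ∫ y, f y ∂(ρ n : Measure ℝ)) G (𝓝 m)) :
    Integrable f (ν : Measure ℝ) ∧ ∫ y, f y ∂(ν : Measure ℝ) ≤ m := by
  have hm0 : 0 ≤ m := ge_of_tendsto' hm fun n => integral_nonneg hf0
  have key : ∀ K : ℕ, ∫ y, min (f y) K ∂(ν : Measure ℝ) ≤ m := by
    intro K
    let g : ℝ →ᵇ ℝ := BoundedContinuousFunction.ofNormedAddCommGroup (fun y => min (f y) K)
      (by fun_prop) K (fun y => by
        rw [Real.norm_of_nonneg (le_min (hf0 y) (Nat.cast_nonneg K))]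
        exact min_le_right _ _)
    have h1 := (ProbabilityMeasure.tendsto_iff_forall_integral_tendsto.1 hρ) g
    refine le_of_tendsto_of_tendsto h1 hm ?_
    filter_upwards [hint] with n hn
    exact integral_mono (g.integrable _) hn fun y => min_le_left _ _
  have hlin : ∫⁻ y, ENNReal.ofReal (f y) ∂(ν : Measure ℝ) ≤ ENNReal.ofReal m := by
    have hmono : ∀ᵐ y ∂(ν : Measure ℝ),
        Monotone fun K : ℕ => ENNReal.ofReal (min (f y) (K : ℝ)) :=
      ae_of_all _ fun y a b hab => ENNReal.ofReal_le_ofReal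
        (min_le_min le_rfl (Nat.cast_le.2 hab))
    have hlim : ∀ᵐ y ∂(ν : Measure ℝ),
        Tendsto (fun K : ℕ => ENNReal.ofReal (min (f y) (K : ℝ))) atTop
          (𝓝 (ENNReal.ofReal (f y))) := by
      refine ae_of_all _ fun y => tendsto_const_nhds.congr' ?_
      filter_upwards [eventually_ge_atTop ⌈f y⌉₊] with K hK
      rw [min_eq_left (Nat.ceil_le.1 hK)]
    refine le_of_tendsto' (lintegral_tendsto_of_tendsto_of_monotone
      (fun K => by fun_prop) hmono hlim) fun K => ?_
    rw [← ofReal_integral_eq_lintegral_ofReal]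
    · exact ENNReal.ofReal_le_ofReal (key K)
    · refine Integrable.of_bound (C := (K : ℝ)) (by fun_prop) (ae_of_all _ fun y => ?_)
      rw [Real.norm_of_nonneg (le_min (hf0 y) (Nat.cast_nonneg K))]
      exact min_le_right _ _
    · exact ae_of_all _ fun y => le_min (hf0 y) (Nat.cast_nonneg K)
  have hI : Integrable f (ν : Measure ℝ) := by
    refine ⟨by fun_prop, ?_⟩
    rw [hasFiniteIntegral_iff_ofReal (ae_of_all _ hf0)]
    exact hlin.trans_lt ENNReal.ofReal_lt_top
  refine ⟨hI, ?_⟩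
  rw [integral_eq_lintegral_of_nonneg_ae (ae_of_all _ hf0) (by fun_prop)]
  exact ENNReal.toReal_le_of_le_ofReal hm0 hlin

/-- Clamping `y ^ p` to `[-K, K]` costs at most `y ^ (2 * p) / K`. The moment of order `2 * p` thus
controls the error uniformly along the filter, and `K → ∞` removes it. -/
theorem moments_of_tendsto_probabilityMeasure {α : Type*} {G : Filter α} [G.NeBot]
    {ρ : α → ProbabilityMeasure ℝ} {ν : ProbabilityMeasure ℝ} (hρ : Tendsto ρ G (𝓝 ν))
    {m : ℕ → ℝ} (hint : ∀ p : ℕ, ∀ᶠ n in G, Integrable (fun y : ℝ => y ^ p) (ρ n : Measure ℝ))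
    (hm : ∀ p : ℕ, Tendsto (fun n => ∫ y, y ^ p ∂(ρ n : Measure ℝ)) G (𝓝 (m p))) (p : ℕ) :
    Integrable (fun y : ℝ => y ^ p) (ν : Measure ℝ) ∧ ∫ y, y ^ p ∂(ν : Measure ℝ) = m p := by
  obtain ⟨hI2, hle⟩ := integral_le_of_tendsto_probabilityMeasure hρ
    (f := fun y => y ^ (2 * p)) (by fun_prop)
    (fun y => by rw [pow_mul']; positivity) (hint (2 * p)) (hm (2 * p))
  have hI : Integrable (fun y : ℝ => y ^ p) (ν : Measure ℝ) := by
    refine ((integrable_const (1 : ℝ)).add hI2).mono' (by fun_prop) (ae_of_all _ fun y => ?_)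
    simp only [Pi.add_apply, Real.norm_eq_abs, pow_mul']
    rw [← sq_abs (y ^ p)]
    nlinarith [sq_nonneg (|y ^ p| - 1), abs_nonneg (y ^ p)]
  refine ⟨hI, ?_⟩
  have clamp : ∀ K : ℝ, 0 < K → |∫ y, y ^ p ∂(ν : Measure ℝ) - m p| ≤ 2 * m (2 * p) / K := by
    intro K hK
    let g : ℝ →ᵇ ℝ := BoundedContinuousFunction.ofNormedAddCommGroup
      (fun y => max (-K) (min (y ^ p) K)) (by fun_prop) K (fun y => by
        rw [Real.norm_eq_abs, abs_le]
        exact ⟨le_max_left _ _, max_le (by linarith) (min_le_right _ _)⟩)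
    have h1 := (ProbabilityMeasure.tendsto_iff_forall_integral_tendsto.1 hρ) g
    have dev : ∀ θ : ProbabilityMeasure ℝ, Integrable (fun y : ℝ => y ^ p) (θ : Measure ℝ) →
        Integrable (fun y : ℝ => y ^ (2 * p)) (θ : Measure ℝ) →
        |∫ y, y ^ p ∂(θ : Measure ℝ) - ∫ y, g y ∂(θ : Measure ℝ)|
          ≤ (∫ y, y ^ (2 * p) ∂(θ : Measure ℝ)) / K := by
      intro θ h h2
      rw [← integral_sub h (g.integrable _), ← integral_div]
      refine (abs_integral_le_integral_abs).trans
        (integral_mono ((h.sub (g.integrable _)).abs) (h2.div_const _) fun y => ?_)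
      have := abs_sub_clamp_le hK (y ^ p)
      rwa [← pow_mul'] at this
    have h2 : |m p - ∫ y, g y ∂(ν : Measure ℝ)| ≤ m (2 * p) / K := by
      refine le_of_tendsto_of_tendsto ((hm p).sub h1).abs ((hm (2 * p)).div_const K) ?_
      filter_upwards [hint p, hint (2 * p)] with n hn hn2 using dev _ hn hn2
    have h3 := (dev ν hI hI2).trans (div_le_div_of_nonneg_right hle hK.le)
    calc _ ≤ |∫ y, y ^ p ∂(ν : Measure ℝ) - ∫ y, g y ∂(ν : Measure ℝ)|
          + |m p - ∫ y, g y ∂(ν : Measure ℝ)| := by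
            rw [abs_sub_comm (m p)]; exact abs_sub_le _ _ _
      _ ≤ _ := by
        rw [two_mul, add_div]; exact add_le_add h3 h2
  have hlim : Tendsto (fun K : ℝ => 2 * m (2 * p) / K) atTop (𝓝 0) :=
    tendsto_const_nhds.div_atTop tendsto_id
  have h0 : |∫ y, y ^ p ∂(ν : Measure ℝ) - m p| ≤ 0 :=
    ge_of_tendsto hlim ((eventually_gt_atTop 0).mono clamp)
  exact sub_eq_zero.1 (abs_nonpos_iff.1 h0)

theorem isTightMeasureSet_of_secondMoment {S : Set (ProbabilityMeasure ℝ)} {C : ℝ}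
    (hS : ∀ μ ∈ S, Integrable (fun y : ℝ => y ^ 2) (μ : Measure ℝ) ∧
      ∫ y, y ^ 2 ∂(μ : Measure ℝ) ≤ C) :
    IsTightMeasureSet {((μ : ProbabilityMeasure ℝ) : Measure ℝ) | μ ∈ S} := by
  rw [isTightMeasureSet_iff_exists_isCompact_measure_compl_le]
  intro ε hε
  have hlim : Tendsto (fun R : ℝ => ENNReal.ofReal (C / R ^ 2)) atTop (𝓝 0) := by
    rw [← ENNReal.ofReal_zero]
    exact (ENNReal.continuous_ofReal.tendsto 0).comp
      (tendsto_const_nhds.div_atTop (tendsto_pow_atTop two_ne_zero))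
  obtain ⟨R, hR, hR0⟩ := ((hlim.eventually (gt_mem_nhds hε)).and (eventually_gt_atTop 0)).exists
  refine ⟨Set.Icc (-R) R, isCompact_Icc, ?_⟩
  rintro _ ⟨μ, hμ, rfl⟩
  obtain ⟨hi, hle⟩ := hS μ hμ
  refine le_trans ?_ hR.le
  have hsub : (Set.Icc (-R) R)ᶜ ⊆ {y : ℝ | R ^ 2 ≤ y ^ 2} := by
    intro y hy
    simp only [Set.mem_compl_iff, Set.mem_Icc, ← abs_le, not_le] at hy
    have : R ^ 2 ≤ |y| ^ 2 := by gcongr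
    simpa using this
  refine (measure_mono hsub).trans ?_
  have := mul_meas_ge_le_integral_of_nonneg (ae_of_all _ fun y : ℝ => sq_nonneg y) hi (R ^ 2)
  rw [← ofReal_measureReal]
  refine ENNReal.ofReal_le_ofReal ?_
  rw [le_div_iff₀ (by positivity), mul_comm]
  exact this.trans hle

-- Integrating the series of `cosh` term by term, the bound `(2k)!` on the even moments leaves a
-- geometric series in `t ^ 2`; the exponential is at most twice `cosh`.
open ProbabilityTheory Nat in
theorem integrable_exp_mul_of_moments {μ : Measure ℝ} [IsProbabilityMeasure μ]
    (hint : ∀ p : ℕ, Integrable (fun y : ℝ => y ^ p) μ)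
    (hb : ∀ k : ℕ, ∫ y, y ^ (2 * k) ∂μ ≤ ((2 * k)! : ℝ)) {t : ℝ} (ht : |t| < 1) :
    Integrable (fun y : ℝ => Real.exp (t * y)) μ := by
  have hi : ∀ k : ℕ, Integrable (fun y : ℝ => (t * y) ^ (2 * k) / ((2 * k)! : ℝ)) μ := fun k => by
    simp only [mul_pow]
    exact ((hint _).const_mul _).div_const _
  have hnn : ∀ (k : ℕ) (y : ℝ), 0 ≤ (t * y) ^ (2 * k) / ((2 * k)! : ℝ) := fun k y => by
    rw [pow_mul]; positivity
  have hval : ∀ k : ℕ, ∫ y, (t * y) ^ (2 * k) / ((2 * k)! : ℝ) ∂μ ≤ (t ^ 2) ^ k := fun k => by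
    rw [integral_div, div_le_iff₀ (by positivity)]
    simp only [mul_pow, integral_const_mul]
    rw [pow_mul]
    exact mul_le_mul_of_nonneg_left (hb k) (by positivity)
  have ht2 : t ^ 2 < 1 := by
    rw [← sq_abs]
    nlinarith [abs_nonneg t]
  have hcosh : Integrable (fun y : ℝ => Real.cosh (t * y)) μ := by
    refine ⟨by fun_prop, ?_⟩
    rw [hasFiniteIntegral_iff_ofReal (ae_of_all _ fun y => (Real.cosh_pos _).le)]
    have h1 : ∀ y : ℝ, ENNReal.ofReal (Real.cosh (t * y))
        = ∑' k : ℕ, ENNReal.ofReal ((t * y) ^ (2 * k) / ((2 * k)! : ℝ)) := fun y => by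
      rw [← ENNReal.ofReal_tsum_of_nonneg (fun k => hnn k y) (Real.hasSum_cosh _).summable,
        ← Real.cosh_eq_tsum]
    simp only [h1]
    rw [lintegral_tsum fun k => by fun_prop]
    have h2 : ∀ k : ℕ, ∫⁻ y, ENNReal.ofReal ((t * y) ^ (2 * k) / ((2 * k)! : ℝ)) ∂μ
        ≤ ENNReal.ofReal ((t ^ 2) ^ k) := fun k => by
      rw [← ofReal_integral_eq_lintegral_ofReal (hi k) (ae_of_all _ (hnn k))]
      exact ENNReal.ofReal_le_ofReal (hval k)
    refine (ENNReal.tsum_le_tsum h2).trans_lt ?_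
    rw [← ENNReal.ofReal_tsum_of_nonneg (fun k => by positivity)
      (summable_geometric_of_lt_one (sq_nonneg t) ht2)]
    exact ENNReal.ofReal_lt_top
  refine (hcosh.const_mul 2).mono' (by fun_prop) (ae_of_all _ fun y => ?_)
  rw [Real.norm_of_nonneg (Real.exp_pos _).le, Real.cosh_eq]
  linarith [Real.exp_pos (-(t * y))]

-- Both complex moment generating functions are analytic on the strip `|Re z| < 1`, and their
-- derivatives at `0` are the moments. They agree near `0` by Taylor expansion, on the strip by the
-- identity theorem, and on the imaginary axis they are the characteristic functions.
open ProbabilityTheory Nat in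
theorem measure_ext_of_moments {μ μ' : Measure ℝ} [IsProbabilityMeasure μ]
    [IsProbabilityMeasure μ'] (hint : ∀ p : ℕ, Integrable (fun y : ℝ => y ^ p) μ)
    (hint' : ∀ p : ℕ, Integrable (fun y : ℝ => y ^ p) μ')
    (heq : ∀ p : ℕ, ∫ y, y ^ p ∂μ = ∫ y, y ^ p ∂μ')
    (hb : ∀ k : ℕ, ∫ y, y ^ (2 * k) ∂μ ≤ ((2 * k)! : ℝ)) : μ = μ' := by
  have hsub : ∀ {θ : Measure ℝ} [IsProbabilityMeasure θ],
      (∀ p : ℕ, Integrable (fun y : ℝ => y ^ p) θ) →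
      (∀ k : ℕ, ∫ y, y ^ (2 * k) ∂θ ≤ ((2 * k)! : ℝ)) →
      Set.Ioo (-1) 1 ⊆ interior (integrableExpSet id θ) := by
    intro θ _ h h'
    refine interior_maximal (fun t ht => ?_) isOpen_Ioo
    exact integrable_exp_mul_of_moments h h' (abs_lt.2 ht)
  have hs := hsub hint hb
  have hs' := hsub hint' fun k => (heq _).symm.trans_le (hb k)
  set U : Set ℂ := {z | z.re ∈ Set.Ioo (-1 : ℝ) 1} with hU
  have hA : AnalyticOnNhd ℂ (complexMGF id μ) U :=
    analyticOnNhd_complexMGF.mono fun z hz => hs hz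
  have hA' : AnalyticOnNhd ℂ (complexMGF id μ') U :=
    analyticOnNhd_complexMGF.mono fun z hz => hs' hz
  have h0 : (0 : ℂ) ∈ U := by simp [hU]
  have hball : Metric.ball (0 : ℂ) 1 ⊆ U := by
    intro z hz
    rw [mem_ball_zero_iff] at hz
    exact abs_lt.1 ((Complex.abs_re_le_norm z).trans_lt hz)
  have hder : ∀ n : ℕ, iteratedDeriv n (complexMGF id μ) 0 = iteratedDeriv n (complexMGF id μ') 0 := by
    intro n
    rw [iteratedDeriv_complexMGF (hs h0), iteratedDeriv_complexMGF (hs' h0)]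
    simp only [id, zero_mul, Complex.exp_zero, mul_one]
    have := congrArg (fun x : ℝ => (x : ℂ)) (heq n)
    simpa only [← integral_complex_ofReal, Complex.ofReal_pow] using this
  have hev : complexMGF id μ =ᶠ[𝓝 0] complexMGF id μ' := by
    filter_upwards [Metric.ball_mem_nhds (0 : ℂ) one_pos] with z hz
    have e1 := Complex.taylorSeries_eq_on_ball' hz (hA.differentiableOn.mono hball)
    have e2 := Complex.taylorSeries_eq_on_ball' hz (hA'.differentiableOn.mono hball)
    rw [← e1, ← e2]
    simp only [hder]
  have hEq : Set.EqOn (complexMGF id μ) (complexMGF id μ') U :=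
    hA.eqOn_of_preconnected_of_eventuallyEq hA'
      ((convex_Ioo (-1 : ℝ) 1).linear_preimage Complex.reLm).isPreconnected h0 hev
  refine Measure.ext_of_charFun (funext fun t => ?_)
  have := hEq (x := (t : ℂ) * Complex.I) (by simp [hU])
  rwa [complexMGF_id_mul_I, complexMGF_id_mul_I] at this

open Nat in
/-- The method of moments, for a limit law whose even moments are at most `(2k)!`. -/
theorem exists_limit_of_moments {α : Type*} {F : Filter α} [F.NeBot]
    {ρ : α → ProbabilityMeasure ℝ} {m : ℕ → ℝ}
    (hint : ∀ p : ℕ, ∀ᶠ n in F, Integrable (fun y : ℝ => y ^ p) (ρ n : Measure ℝ))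
    (hm : ∀ p : ℕ, Tendsto (fun n => ∫ y, y ^ p ∂(ρ n : Measure ℝ)) F (𝓝 (m p)))
    (hb : ∀ k : ℕ, m (2 * k) ≤ ((2 * k)! : ℝ)) :
    ∃ ν : ProbabilityMeasure ℝ, Tendsto ρ F (𝓝 ν) ∧ ∀ p : ℕ,
      Integrable (fun y : ℝ => y ^ p) (ν : Measure ℝ) ∧ ∫ y, y ^ p ∂(ν : Measure ℝ) = m p := by
  set S : Set (ProbabilityMeasure ℝ) := {μ | Integrable (fun y : ℝ => y ^ 2) (μ : Measure ℝ) ∧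
      ∫ y, y ^ 2 ∂(μ : Measure ℝ) ≤ m 2 + 1} with hS
  have hcpt : IsCompact (closure S) :=
    isCompact_closure_of_isTightMeasureSet (isTightMeasureSet_of_secondMoment fun μ hμ => hμ)
  have hmem : ∀ᶠ n in F, ρ n ∈ closure S := by
    filter_upwards [hint 2, (hm 2).eventually (gt_mem_nhds (lt_add_one (m 2)))] with n h1 h2
    exact subset_closure ⟨h1, h2.le⟩
  -- Ultrafilters take the place of subsequences: by compactness each one has a limit, this limit
  -- has the moments `m`, and determinacy makes all these limits equal.
  have hult : ∀ U : Ultrafilter α, ↑U ≤ F → ∃ ν : ProbabilityMeasure ℝ, Tendsto ρ U (𝓝 ν) ∧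
      ∀ p : ℕ, Integrable (fun y : ℝ => y ^ p) (ν : Measure ℝ) ∧
        ∫ y, y ^ p ∂(ν : Measure ℝ) = m p := by
    intro U hU
    obtain ⟨ν, -, hν⟩ := hcpt.ultrafilter_le_nhds (U.map ρ)
      (le_principal_iff.2 (hU hmem))
    exact ⟨ν, hν, moments_of_tendsto_probabilityMeasure (G := (U : Filter α)) hν
      (fun p => hU (hint p)) fun p => (hm p).mono_left hU⟩
  obtain ⟨ν, -, hν⟩ := hult (Ultrafilter.of F) (Ultrafilter.of_le F)
  refine ⟨ν, ?_, hν⟩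
  rw [tendsto_iff_ultrafilter]
  intro U hU
  obtain ⟨ν', hlim, hν'⟩ := hult U hU
  have hmeas : (ν' : Measure ℝ) = ν := measure_ext_of_moments (fun p => (hν' p).1)
    (fun p => (hν p).1) (fun p => (hν' p).2.trans (hν p).2.symm)
    fun k => (hν' _).2.trans_le (hb k)
  have hνν : ν' = ν := Subtype.ext hmeas
  exact hνν ▸ hlim

/-! ### Traces of powers and measurability of the eigenvalues -/

theorem trace_pow_eq_sum_eigenvalues {n : Type*} [Fintype n] [DecidableEq n]
    {A : Matrix n n ℂ} (hA : A.IsHermitian) (p : ℕ) :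
    (A ^ p).trace = ((∑ i, hA.eigenvalues i ^ p : ℝ) : ℂ) := by
  conv_lhs => rw [hA.spectral_theorem, ← map_pow, Unitary.conjStarAlgAut_apply,
    Matrix.trace_mul_comm, ← mul_assoc, Unitary.coe_star_mul_self, one_mul, Matrix.diagonal_pow,
    Matrix.trace_diagonal]
  simp

section MeasurableEigenvalues

variable {Ω n : Type*} [MeasurableSpace Ω] [Fintype n] [DecidableEq n] {A : Ω → Matrix n n ℂ}

theorem measurable_trace_pow (hm : ∀ i j, Measurable fun x => A x i j) (p : ℕ) :
    Measurable fun x => (A x ^ p).trace := by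
  have h : ∀ i j, Measurable fun x => (A x ^ p) i j := by
    induction p with
    | zero => intro i j; simp only [pow_zero]; exact measurable_const
    | succ p ih =>
      intro i j
      simp only [pow_succ, Matrix.mul_apply]
      exact Finset.measurable_sum _ fun k _ => (ih i k).mul (hm k j)
  exact Finset.measurable_sum _ fun i _ => h i i

/-- For a polynomial the sum is a combination of traces of powers, hence measurable; a continuous
function is reached by Weierstrass approximation. -/
theorem measurable_sum_eigenvalues_continuous (hA : ∀ x, (A x).IsHermitian)
    (hm : ∀ i j, Measurable fun x => A x i j) {f : ℝ → ℝ} (hf : Continuous f) :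
    Measurable fun x => ∑ i, f ((hA x).eigenvalues i) := by
  have hpol : ∀ P : Polynomial ℝ, Measurable fun x => ∑ i, P.eval ((hA x).eigenvalues i) := by
    intro P
    have h : ∀ x, ∑ i, P.eval ((hA x).eigenvalues i)
        = ∑ k ∈ P.support, P.coeff k * (A x ^ k).trace.re := by
      intro x
      simp only [trace_pow_eq_sum_eigenvalues (hA x), Complex.ofReal_re, Polynomial.eval_eq_sum,
        Polynomial.sum]
      rw [Finset.sum_comm]
      exact Finset.sum_congr rfl fun k _ => (Finset.mul_sum _ _ _).symm
    simp only [h]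
    exact Finset.measurable_sum _ fun k _ =>
      (Complex.measurable_re.comp (measurable_trace_pow hm k)).const_mul _
  -- The intervals `[-k, k]` grow, so for each fixed `x` they eventually contain every eigenvalue.
  choose P hP using fun k : ℕ => exists_polynomial_near_of_continuousOn (-(k : ℝ)) k f
    hf.continuousOn (1 / ((k : ℝ) + 1)) (by positivity)
  refine measurable_of_tendsto_metrizable (fun k => hpol (P k)) (tendsto_pi_nhds.2 fun x => ?_)
  refine tendsto_finsetSum _ fun i _ => ?_
  rw [tendsto_iff_dist_tendsto_zero]
  refine squeeze_zero' (Eventually.of_forall fun k => dist_nonneg) ?_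
    tendsto_one_div_add_atTop_nhds_zero_nat
  filter_upwards [eventually_ge_atTop ⌈|(hA x).eigenvalues i|⌉₊] with k hk
  exact (hP k _ (abs_le.1 (Nat.ceil_le.1 hk))).le

theorem measurable_card_eigenvalues_gt (hA : ∀ x, (A x).IsHermitian)
    (hm : ∀ i j, Measurable fun x => A x i j) (t : ℝ) :
    Measurable fun x => ∑ i, Set.indicator (Set.Ioi t) (fun _ => (1 : ℝ)) ((hA x).eigenvalues i) := by
  refine measurable_of_tendsto_metrizable
    (f := fun (k : ℕ) x => ∑ i, min 1 ((k : ℝ) * max 0 ((hA x).eigenvalues i - t)))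
    (fun k => measurable_sum_eigenvalues_continuous hA hm
      (f := fun y => min 1 ((k : ℝ) * max 0 (y - t))) (by fun_prop))
    (tendsto_pi_nhds.2 fun x => tendsto_finsetSum _ fun i _ => ?_)
  generalize (hA x).eigenvalues i = y
  by_cases hy : t < y
  · rw [Set.indicator_of_mem (Set.mem_Ioi.2 hy)]
    refine tendsto_const_nhds.congr' ?_
    filter_upwards [eventually_ge_atTop ⌈1 / (y - t)⌉₊] with k hk
    have h := Nat.ceil_le.1 hk
    rw [div_le_iff₀ (by linarith)] at h
    rw [max_eq_right (by linarith), min_eq_left h]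
  · rw [Set.indicator_of_notMem (by simpa using hy), max_eq_left (by linarith)]
    simp

/-- The eigenvalues are listed in decreasing order, so the one at position `k` (counted from `0`)
exceeds `t` exactly when more than `k` of them do. That number is measurable. -/
theorem measurable_eigenvalues (hA : ∀ x, (A x).IsHermitian)
    (hm : ∀ i j, Measurable fun x => A x i j) (i : n) :
    Measurable fun x => (hA x).eigenvalues i := by
  set e := (Fintype.equivOfCardEq (Fintype.card_fin (Fintype.card n)) : Fin _ ≃ n)
  refine measurable_of_Ioi fun t => ?_
  have hset : (fun x => (hA x).eigenvalues i) ⁻¹' Set.Ioi t = {x | ((e.symm i : ℕ) : ℝ) <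
      ∑ i, Set.indicator (Set.Ioi t) (fun _ => (1 : ℝ)) ((hA x).eigenvalues i)} := by
    ext x
    have hsum : ∑ i, Set.indicator (Set.Ioi t) (fun _ => (1 : ℝ)) ((hA x).eigenvalues i)
        = ((Finset.univ.filter fun k => t < (hA x).eigenvalues₀ k).card : ℝ) := by
      rw [← e.sum_comp, Finset.card_filter]
      push_cast
      exact Finset.sum_congr rfl fun k _ => by
        simp [Set.indicator_apply, Matrix.IsHermitian.eigenvalues, e]
    rw [Set.mem_preimage, Set.mem_Ioi, Set.mem_ofPred_eq, hsum, Nat.cast_lt]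
    have hanti := (hA x).eigenvalues₀_antitone
    change t < (hA x).eigenvalues₀ (e.symm i) ↔ _
    constructor
    · intro h
      have hsub : Finset.Iic (e.symm i) ⊆ Finset.univ.filter fun k => t < (hA x).eigenvalues₀ k :=
        fun k hk => by
          simp only [Finset.mem_filter, Finset.mem_univ, true_and]
          exact h.trans_le (hanti (Finset.mem_Iic.1 hk))
      have := Finset.card_le_card hsub
      rw [Fin.card_Iic] at this
      omega
    · intro h
      by_contra hlt
      have hsub : (Finset.univ.filter fun k => t < (hA x).eigenvalues₀ k) ⊆
          Finset.Iio (e.symm i) := fun k hk => by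
        simp only [Finset.mem_filter, Finset.mem_univ, true_and] at hk
        rw [Finset.mem_Iio]
        by_contra hk'
        exact hlt (hk.trans_le (hanti (not_lt.1 hk')))
      have := Finset.card_le_card hsub
      rw [Fin.card_Iio] at this
      omega
  rw [hset]
  exact measurableSet_lt measurable_const (measurable_card_eigenvalues_gt hA hm t)

end MeasurableEigenvalues

/-! ### The mean eigenvalue law of the reconstruction matrix -/

instance isProbabilityMeasure_restrict_Ico :
    IsProbabilityMeasure ((volume : Measure ℝ).restrict (Set.Ico 0 1)) :=
  ⟨by simp⟩

instance isProbabilityMeasure_samplingLaw (d r : ℕ) : IsProbabilityMeasure (samplingLaw d r) := by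
  unfold samplingLaw
  infer_instance

theorem card_harmonics (d M : ℕ) : Fintype.card (Harmonics d M) = (2 * M + 1) ^ d := by
  have h : ((M : ℤ) + 1 + (M : ℤ)).toNat = 2 * M + 1 := by omega
  simp [Harmonics, h]

theorem two_mul_add_one_pow_rpow (M d : ℕ) :
    ((2 * (M : ℝ) + 1) ^ (-(d : ℝ) / 2)) * ((2 * (M : ℝ) + 1) ^ (-(d : ℝ) / 2))
      = ((2 * (M : ℝ) + 1) ^ d)⁻¹ := by
  have hN : (0 : ℝ) < 2 * (M : ℝ) + 1 := by positivity
  rw [← Real.rpow_add hN, add_halves, Real.rpow_neg hN.le, Real.rpow_natCast]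

theorem reconstructionMatrix_apply (d M r : ℕ) (x : Fin r → Fin d → ℝ) (l l' : Harmonics d M) :
    reconstructionMatrix d M r x l l' = (r : ℂ)⁻¹ * ∑ q : Fin r,
      Complex.exp (-Complex.I * (2 * Real.pi *
        ∑ m : Fin d, x q m * (((l m : ℤ) : ℝ) - ((l' m : ℤ) : ℝ)) : ℝ)) := by
  have hN : (0 : ℝ) < 2 * (M : ℝ) + 1 := by positivity
  simp only [reconstructionMatrix, Matrix.smul_apply, Matrix.mul_apply, samplingMatrix,
    Matrix.conjTranspose_apply, Matrix.of_apply, smul_eq_mul]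
  rw [Finset.mul_sum, Finset.mul_sum]
  refine Finset.sum_congr rfl fun q _ => ?_
  rw [star_mul', Complex.star_def, Complex.conj_ofReal, ← Complex.exp_conj]
  have hexp : ∀ a b : ℝ, Complex.exp (-Complex.I * a) *
      Complex.exp ((starRingEnd ℂ) (-Complex.I * b)) = Complex.exp (-Complex.I * (a - b : ℝ)) := by
    intro a b
    rw [← Complex.exp_add]
    congr 1
    simp only [map_mul, map_neg, Complex.conj_I, Complex.conj_ofReal, Complex.ofReal_sub]
    ring
  rw [mul_mul_mul_comm, hexp, ← Complex.ofReal_mul, two_mul_add_one_pow_rpow, ← mul_assoc,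
    ← Complex.ofReal_mul]
  congr 1
  · rw [harmonicsRatio, div_eq_mul_inv, mul_right_comm, mul_inv_cancel₀ (by positivity), one_mul]
    push_cast
    rfl
  · congr 3
    simp only [mul_sub, Finset.sum_sub_distrib]

theorem measurable_reconstructionMatrix_apply (d M r : ℕ) (l l' : Harmonics d M) :
    Measurable fun x => reconstructionMatrix d M r x l l' := by
  simp only [reconstructionMatrix_apply]
  fun_prop

theorem norm_reconstructionMatrix_apply_le (d M r : ℕ) (x : Fin r → Fin d → ℝ)
    (l l' : Harmonics d M) : ‖reconstructionMatrix d M r x l l'‖ ≤ 1 := by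
  rw [reconstructionMatrix_apply, norm_mul, norm_inv, Complex.norm_natCast]
  have h : ‖∑ q : Fin r, Complex.exp (-Complex.I * (2 * Real.pi *
        ∑ m : Fin d, x q m * (((l m : ℤ) : ℝ) - ((l' m : ℤ) : ℝ)) : ℝ))‖ ≤ r := by
    refine (norm_sum_le _ _).trans ?_
    rw [Finset.sum_congr rfl fun q _ => show _ = (1 : ℝ) from ?_]
    · simp
    · rw [Complex.norm_exp]
      simp
  exact (mul_le_mul_of_nonneg_left h (by positivity)).trans (inv_mul_le_one)

/-- A crude bound through the trace of the square, whose entries are at most `1` in modulus before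
multiplication. It serves only to make continuous functions of the eigenvalues integrable. -/
theorem abs_eigenvalues_reconstructionMatrix_le (d M r : ℕ) (x : Fin r → Fin d → ℝ)
    (i : Harmonics d M) :
    |(reconstructionMatrix_isHermitian d M r x).eigenvalues i| ≤ Fintype.card (Harmonics d M) := by
  set hA := reconstructionMatrix_isHermitian d M r x
  have h1 : hA.eigenvalues i ^ 2 ≤ ∑ j, hA.eigenvalues j ^ 2 :=
    Finset.single_le_sum (f := fun j => hA.eigenvalues j ^ 2) (fun j _ => sq_nonneg _)
      (Finset.mem_univ i)
  have h2 : ∑ j, hA.eigenvalues j ^ 2 ≤ (Fintype.card (Harmonics d M) : ℝ) ^ 2 := by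
    have h3 := congrArg Complex.re (trace_pow_eq_sum_eigenvalues hA 2)
    rw [Complex.ofReal_re] at h3
    rw [← h3]
    refine (Complex.re_le_norm _).trans ?_
    simp only [Matrix.trace, Matrix.diag_apply, pow_two, Matrix.mul_apply]
    refine (norm_sum_le_of_le (n := fun _ => ∑ _ : Harmonics d M, (1 : ℝ)) _
      (fun j _ => (norm_sum_le_of_le _ (fun k _ => ?_)))).trans ?_
    · rw [norm_mul]
      exact mul_le_one₀ (norm_reconstructionMatrix_apply_le ..) (norm_nonneg _)
        (norm_reconstructionMatrix_apply_le ..)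
    · simp
  exact abs_le_of_sq_le_sq (h1.trans h2) (by positivity)

/-- The mean empirical eigenvalue distribution of the reconstruction matrix. -/
noncomputable def meanEigenvalueLaw (d M r : ℕ) : Measure ℝ :=
  ((Fintype.card (Harmonics d M) : ENNReal)⁻¹) • ∑ i : Harmonics d M, (samplingLaw d r).map
    fun x => (reconstructionMatrix_isHermitian d M r x).eigenvalues i

theorem measurable_eigenvalues_reconstructionMatrix (d M r : ℕ) (i : Harmonics d M) :
    Measurable fun x => (reconstructionMatrix_isHermitian d M r x).eigenvalues i :=
  measurable_eigenvalues _ (measurable_reconstructionMatrix_apply d M r) i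

instance isProbabilityMeasure_meanEigenvalueLaw (d M r : ℕ) :
    IsProbabilityMeasure (meanEigenvalueLaw d M r) := by
  constructor
  have h : ∀ i : Harmonics d M, ((samplingLaw d r).map
      fun x => (reconstructionMatrix_isHermitian d M r x).eigenvalues i) Set.univ = 1 := fun i => by
    rw [Measure.map_apply (measurable_eigenvalues_reconstructionMatrix d M r i) MeasurableSet.univ]
    simp
  rw [meanEigenvalueLaw, Measure.smul_apply, Measure.finsetSum_apply]
  simp only [h, Finset.sum_const, Finset.card_univ, smul_eq_mul, nsmul_eq_mul, mul_one]
  refine ENNReal.inv_mul_cancel ?_ (ENNReal.natCast_ne_top _)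
  rw [card_harmonics]
  positivity

theorem integrable_comp_eigenvalues (d M r : ℕ) {f : ℝ → ℝ} (hf : Continuous f)
    (i : Harmonics d M) : Integrable
      (fun x => f ((reconstructionMatrix_isHermitian d M r x).eigenvalues i)) (samplingLaw d r) := by
  obtain ⟨C, hC⟩ := (isCompact_Icc (a := -(Fintype.card (Harmonics d M) : ℝ))
    (b := Fintype.card (Harmonics d M))).exists_bound_of_continuousOn hf.continuousOn
  refine Integrable.of_bound (C := C) (hf.measurable.comp
    (measurable_eigenvalues_reconstructionMatrix d M r i)).aestronglyMeasurable
    (ae_of_all _ fun x => hC _ ?_)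
  exact abs_le.1 (abs_eigenvalues_reconstructionMatrix_le d M r x i)

theorem integrable_meanEigenvalueLaw (d M r : ℕ) {f : ℝ → ℝ} (hf : Continuous f) :
    Integrable f (meanEigenvalueLaw d M r) := by
  refine Integrable.smul_measure ?_ ?_
  · rw [integrable_finsetSum_measure]
    intro i _
    rw [integrable_map_measure hf.aestronglyMeasurable
      (measurable_eigenvalues_reconstructionMatrix d M r i).aemeasurable]
    exact integrable_comp_eigenvalues d M r hf i
  · rw [ENNReal.inv_ne_top, card_harmonics]
    positivity

theorem integral_meanEigenvalueLaw (d M r : ℕ) {f : ℝ → ℝ} (hf : Continuous f) :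
    ∫ y, f y ∂(meanEigenvalueLaw d M r) = meanEigenvalueIntegral d M r f := by
  have hi : ∀ i : Harmonics d M, Integrable f ((samplingLaw d r).map
      fun x => (reconstructionMatrix_isHermitian d M r x).eigenvalues i) := fun i => by
    rw [integrable_map_measure hf.aestronglyMeasurable
      (measurable_eigenvalues_reconstructionMatrix d M r i).aemeasurable]
    exact integrable_comp_eigenvalues d M r hf i
  rw [meanEigenvalueLaw, integral_smul_measure, integral_finsetSum_measure fun i _ => hi i,
    meanEigenvalueIntegral, integral_const_mul,
    integral_finsetSum _ fun i _ => integrable_comp_eigenvalues d M r hf i, smul_eq_mul]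
  congr 1
  · rw [card_harmonics, ENNReal.toReal_inv, ENNReal.toReal_natCast]
    push_cast
    rfl
  · refine Finset.sum_congr rfl fun i _ => ?_
    rw [integral_map (measurable_eigenvalues_reconstructionMatrix d M r i).aemeasurable
      hf.aestronglyMeasurable]

theorem meanTraceMoment_eq_integral (d M r p : ℕ) :
    meanTraceMoment d M r p = ((∫ y, y ^ p ∂(meanEigenvalueLaw d M r) : ℝ) : ℂ) := by
  rw [integral_meanEigenvalueLaw d M r (continuous_pow p), meanTraceMoment, meanEigenvalueIntegral,
    integral_const_mul, Complex.ofReal_mul, ← integral_complex_ofReal]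
  simp only [trace_pow_eq_sum_eigenvalues (reconstructionMatrix_isHermitian d M r _)]
  push_cast
  rfl

/-! ### Partitions of a finite linear order -/

noncomputable instance fintypeSetoid (α : Type*) [Fintype α] : Fintype (Setoid α) := by
  classical
  exact Fintype.ofInjective (fun (s : Setoid α) x y => s x y)
    fun s t h => Setoid.ext fun x y => by simpa using congrFun (congrFun h x) y

open Classical in
/-- The elements that are not the least of their class. -/
noncomputable def nonminima {α : Type*} [LinearOrder α] [Fintype α] (s : Setoid α) : Finset α :=
  Finset.univ.filter fun x => ∃ y < x, s y x

theorem mem_nonminima {α : Type*} [LinearOrder α] [Fintype α] {s : Setoid α} {x : α} :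
    x ∈ nonminima s ↔ ∃ y < x, s y x := by simp [nonminima]

theorem exists_minimum_rel {α : Type*} [LinearOrder α] [Fintype α] (s : Setoid α) (x : α) :
    ∃ y, y ∉ nonminima s ∧ s y x := by
  classical
  have hne : (Finset.univ.filter fun y => s y x).Nonempty := ⟨x, by simp⟩
  refine ⟨_, fun h => ?_, (Finset.mem_filter.1 (Finset.min'_mem _ hne)).2⟩
  obtain ⟨z, hz, hzs⟩ := mem_nonminima.1 h
  have := (Finset.mem_filter.1 (Finset.min'_mem _ hne)).2
  exact absurd (Finset.min'_le _ z (by simpa using s.trans hzs this)) (not_le.2 hz)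

theorem eq_of_notMem_nonminima {α : Type*} [LinearOrder α] [Fintype α] {s : Setoid α} {x y : α}
    (hx : x ∉ nonminima s) (hy : y ∉ nonminima s) (h : s x y) : x = y := by
  rcases lt_trichotomy x y with hlt | rfl | hlt
  · exact absurd (mem_nonminima.2 ⟨x, hlt, h⟩) hy
  · rfl
  · exact absurd (mem_nonminima.2 ⟨y, hlt, s.symm h⟩) hx

/-- Each class has exactly one least element, so the minima are in bijection with the classes. -/
theorem card_quotient_add_card_nonminima {α : Type*} [LinearOrder α] [Fintype α] (s : Setoid α) :
    Nat.card (Quotient s) + (nonminima s).card = Fintype.card α := by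
  classical
  have hbij : Function.Bijective
      (fun x : {x // x ∉ nonminima s} => (Quotient.mk s x.1 : Quotient s)) := by
    constructor
    · intro x y h
      exact Subtype.ext (eq_of_notMem_nonminima x.2 y.2 (Quotient.exact h))
    · intro q
      induction q using Quotient.inductionOn with
      | h x =>
        obtain ⟨y, hy, hyx⟩ := exists_minimum_rel s x
        exact ⟨⟨y, hy⟩, Quotient.sound hyx⟩
  rw [← Nat.card_congr (Equiv.ofBijective _ hbij), Nat.card_eq_fintype_card,
    Fintype.card_subtype_compl, Fintype.card_coe]
  exact Nat.sub_add_cancel (Finset.card_le_univ _)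

/-- A labelling with kernel `s` is the same as an injection of the classes into the labels. -/
theorem card_ker_eq {α : Type*} [Fintype α] (s : Setoid α) (r : ℕ) :
    Nat.card {q : α → Fin r // Setoid.ker q = s} = r.descFactorial (Nat.card (Quotient s)) := by
  classical
  let e : {q : α → Fin r // Setoid.ker q = s} ≃ (Quotient s ↪ Fin r) :=
    { toFun := fun q => ⟨Quotient.lift q.1 fun a b h => by
          have h' : Setoid.ker q.1 a b := by rw [q.2]; exact h
          exact h', by
        rintro ⟨a⟩ ⟨b⟩ h
        refine Quotient.sound ?_
        have h' : Setoid.ker q.1 a b := h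
        rwa [q.2] at h'⟩
      invFun := fun g => ⟨fun a => g (Quotient.mk s a), Setoid.ext fun a b => by
        rw [Setoid.ker_def, g.injective.eq_iff]
        exact Quotient.eq⟩
      left_inv := fun q => rfl
      right_inv := fun g => by
        ext ⟨a⟩
        rfl }
  rw [Nat.card_congr e, Nat.card_eq_fintype_card, Fintype.card_embedding_eq, Fintype.card_fin,
    Nat.card_eq_fintype_card]

/-! ### Expansion of the mean trace over paths and coincidence patterns -/

open Classical in
/-- The assignments of integers in `[-M, M]` to the edges of the path `0 → 1 → ⋯ → p` whose
increments along the steps of each class of `s` add up to `0`. -/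
noncomputable def circulations {p : ℕ} (s : Setoid (Fin p)) (M : ℕ) : Finset (Fin (p + 1) → ℤ) :=
  (Fintype.piFinset fun _ => Finset.Icc (-(M : ℤ)) M).filter fun l =>
    ∀ a, ∑ j, (if s j a then l j.castSucc - l j.succ else 0) = 0

theorem mem_circulations {p : ℕ} {s : Setoid (Fin p)} {M : ℕ} {l : Fin (p + 1) → ℤ} [DecidableRel s] :
    l ∈ circulations s M ↔ (∀ i, -(M : ℤ) ≤ l i ∧ l i ≤ M) ∧
      ∀ a, ∑ j, (if s j a then l j.castSucc - l j.succ else 0) = 0 := by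
  simp only [circulations, Finset.mem_filter, Fintype.mem_piFinset, Finset.mem_Icc]
  refine and_congr Iff.rfl (forall_congr' fun a => ?_)
  rw [iff_iff_eq]
  congr!

theorem matrix_pow_apply_eq_sum_path {n R : Type*} [Fintype n] [DecidableEq n] [CommRing R]
    (A : Matrix n n R) (p : ℕ) (a b : n) :
    (A ^ p) a b = ∑ l : Fin (p + 1) → n, if l 0 = a ∧ l (Fin.last p) = b then
      ∏ j : Fin p, A (l j.castSucc) (l j.succ) else 0 := by
  induction p generalizing a with
  | zero =>
    rw [← (Equiv.funUnique (Fin 1) n).symm.sum_comp]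
    simp only [pow_zero, Matrix.one_apply, Finset.univ_eq_empty, Finset.prod_empty]
    by_cases h : a = b
    · subst h
      simp [Fin.last]
    · rw [if_neg h, Finset.sum_eq_zero]
      intro x _
      rw [if_neg]
      rintro ⟨h1, h2⟩
      exact h (h1.symm.trans h2)
  | succ p ih =>
    rw [pow_succ', Matrix.mul_apply, ← (Fin.consEquiv fun _ => n).sum_comp,
      Fintype.sum_prod_type]
    simp only [ih, Fin.consEquiv_apply, Fin.cons_zero, Fin.prod_univ_succ, Fin.castSucc_zero,
      ← Fin.succ_last, Fin.cons_succ, ← Fin.succ_castSucc]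
    rw [Finset.sum_eq_single_of_mem a (Finset.mem_univ a)
      (fun x _ hx => Finset.sum_eq_zero fun l _ => if_neg fun h => hx h.1)]
    simp only [Finset.mul_sum]
    rw [Finset.sum_comm]
    refine Finset.sum_congr rfl fun l _ => ?_
    rw [Finset.sum_eq_single_of_mem (l 0) (Finset.mem_univ _)
      (fun x _ hx => by rw [if_neg fun h => hx h.1.symm, mul_zero])]
    simp

theorem trace_pow_eq_sum_path {n R : Type*} [Fintype n] [DecidableEq n] [CommRing R]
    (A : Matrix n n R) (p : ℕ) :
    (A ^ p).trace = ∑ l : Fin (p + 1) → n, if l 0 = l (Fin.last p) then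
      ∏ j : Fin p, A (l j.castSucc) (l j.succ) else 0 := by
  simp only [Matrix.trace, Matrix.diag_apply, matrix_pow_apply_eq_sum_path A p]
  rw [Finset.sum_comm]
  refine Finset.sum_congr rfl fun l _ => ?_
  rw [Finset.sum_eq_single_of_mem (l 0) (Finset.mem_univ _)
    (fun x _ hx => if_neg fun h => hx h.1.symm)]
  simp [eq_comm]

theorem integral_exp_int (k : ℤ) :
    ∫ x in Set.Ico (0 : ℝ) 1, Complex.exp (-Complex.I * (2 * Real.pi * (x * k) : ℝ))
      = if k = 0 then 1 else 0 := by
  by_cases hk : k = 0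
  · simp [hk]
  · rw [if_neg hk, integral_Ico_eq_integral_Ioc, ← intervalIntegral.integral_of_le zero_le_one]
    have hc : -Complex.I * (2 * Real.pi * k) ≠ 0 := by
      simp [Complex.I_ne_zero, Real.pi_ne_zero, hk]
    have h : ∀ x : ℝ, Complex.exp (-Complex.I * (2 * Real.pi * (x * k) : ℝ))
        = Complex.exp (-Complex.I * (2 * Real.pi * k) * x) := fun x => by
      congr 1
      push_cast
      ring
    simp only [h]
    rw [integral_exp_mul_complex hc]
    have h1 : -Complex.I * (2 * Real.pi * k) * (1 : ℝ) = ((-k : ℤ) : ℂ) * (2 * Real.pi * Complex.I) := by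
      push_cast
      ring
    rw [h1, Complex.exp_int_mul_two_pi_mul_I]
    simp

theorem integral_samplingLaw_exp {d r : ℕ} (D : Fin r → Fin d → ℤ) :
    ∫ x, Complex.exp (-Complex.I * (2 * Real.pi * ∑ a, ∑ m, x a m * (D a m : ℝ) : ℝ))
      ∂(samplingLaw d r) = if ∀ a m, D a m = 0 then 1 else 0 := by
  have h : ∀ x : Fin r → Fin d → ℝ,
      Complex.exp (-Complex.I * (2 * Real.pi * ∑ a, ∑ m, x a m * (D a m : ℝ) : ℝ))
      = ∏ a, ∏ m, Complex.exp (-Complex.I * (2 * Real.pi * (x a m * D a m) : ℝ)) := fun x => by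
    simp only [← Complex.exp_sum, Finset.mul_sum, Complex.ofReal_sum]
  simp only [h]
  rw [samplingLaw, integral_fintype_prod_eq_prod
    (f := fun a (y : Fin d → ℝ) => ∏ m, Complex.exp (-Complex.I * (2 * Real.pi * (y m * D a m) : ℝ)))]
  have h2 : ∀ a : Fin r, ∫ y : Fin d → ℝ,
      ∏ m, Complex.exp (-Complex.I * (2 * Real.pi * (y m * D a m) : ℝ))
        ∂(Measure.pi fun _ => (volume : Measure ℝ).restrict (Set.Ico 0 1))
      = ∏ m, if D a m = 0 then (1 : ℂ) else 0 := fun a => by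
    rw [integral_fintype_prod_eq_prod
      (f := fun m (t : ℝ) => Complex.exp (-Complex.I * (2 * Real.pi * (t * D a m) : ℝ)))]
    simp only [integral_exp_int]
  simp only [h2]
  simp only [Finset.prod_ite_zero, Finset.prod_const_one, Finset.mem_univ, true_implies]

/-- Adding the balance conditions over all labels telescopes, so a balanced path closes by itself.
This is why `circulations` carries no closing condition. -/
theorem sum_ite_eq_zero_closes {p : ℕ} {ι : Type*} [Fintype ι] [DecidableEq ι] (q : Fin p → ι)
    (l : Fin (p + 1) → ℤ)
    (h : ∀ a, ∑ j, (if q j = a then l j.castSucc - l j.succ else 0) = 0) :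
    l 0 = l (Fin.last p) := by
  have h1 : ∑ a, ∑ j, (if q j = a then l j.castSucc - l j.succ else 0) = 0 :=
    Finset.sum_eq_zero fun a _ => h a
  rw [Finset.sum_comm] at h1
  simp only [Finset.sum_ite_eq, Finset.mem_univ, if_true] at h1
  rw [Finset.sum_sub_distrib] at h1
  have h2 := Fin.sum_univ_castSucc l
  have h3 := Fin.sum_univ_succ l
  linarith

/-- The balance conditions act on each of the `d` coordinates separately, which produces the
exponent `d`. -/
theorem card_closed_paths {d M p : ℕ} {ι : Type*} [Fintype ι] [DecidableEq ι] (q : Fin p → ι) :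
    (Finset.univ.filter fun l : Fin (p + 1) → Harmonics d M => l 0 = l (Fin.last p) ∧
      ∀ a m, ∑ j, (if q j = a then ((l j.castSucc m : ℤ) - (l j.succ m : ℤ)) else 0) = 0).card
      = (circulations (Setoid.ker q) M).card ^ d := by
  classical
  rw [← Fintype.card_coe (circulations (Setoid.ker q) M), ← Fintype.card_fin d,
    ← Fintype.card_fun, Fintype.card_fin, ← Fintype.card_subtype]
  have hker : ∀ l : Fin (p + 1) → ℤ,
      (∀ a, ∑ j, (if Setoid.ker q j a then l j.castSucc - l j.succ else 0) = 0) ↔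
      ∀ a, ∑ j, (if q j = a then l j.castSucc - l j.succ else 0) = 0 := by
    intro l
    simp only [Setoid.ker_def]
    refine ⟨fun h a => ?_, fun h a => h (q a)⟩
    -- A label that is not attained imposes an empty condition.
    by_cases ha : ∃ b, q b = a
    · obtain ⟨b, rfl⟩ := ha
      exact h b
    · exact Finset.sum_eq_zero fun j _ => if_neg fun hj => ha ⟨j, hj⟩
  refine Fintype.card_congr
    { toFun := fun l m => ⟨fun i => (l.1 i m : ℤ), mem_circulations.2
        ⟨fun i => Finset.mem_Icc.1 (l.1 i m).2, (hker fun i => (l.1 i m : ℤ)).2 fun a => l.2.2 a m⟩⟩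
      invFun := fun g => ⟨fun i m => ⟨(g m).1 i, Finset.mem_Icc.2
        ((mem_circulations.1 (g m).2).1 i)⟩, ?_, fun a m =>
          (hker _).1 (mem_circulations.1 (g m).2).2 a⟩
      left_inv := fun l => rfl
      right_inv := fun g => rfl }
  funext m
  exact Subtype.ext (sum_ite_eq_zero_closes q (g m).1
    ((hker _).1 (mem_circulations.1 (g m).2).2))

/-- After expansion, the frequency attached to the sample `a` is the sum of the increments over the
steps labelled `a`. Orthogonality of the characters keeps the term exactly when all these
frequencies vanish. -/
theorem integral_trace_reconstructionMatrix_pow (d M r p : ℕ) :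
    ∫ x, (reconstructionMatrix d M r x ^ p).trace ∂(samplingLaw d r) =
      ((r : ℂ)⁻¹) ^ p * ∑ q : Fin p → Fin r, ((circulations (Setoid.ker q) M).card : ℂ) ^ d := by
  classical
  let E : (Fin p → Fin r) → (Fin (p + 1) → Harmonics d M) → (Fin r → Fin d → ℝ) → ℂ :=
    fun q l x => Complex.exp (-Complex.I * (2 * Real.pi * ∑ a, ∑ m, x a m *
      ((∑ j, (if q j = a then ((l j.castSucc m : ℤ) - (l j.succ m : ℤ)) else 0) : ℤ) : ℝ) : ℝ))
  have hprod : ∀ (l : Fin (p + 1) → Harmonics d M) (x : Fin r → Fin d → ℝ),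
      ∏ j : Fin p, reconstructionMatrix d M r x (l j.castSucc) (l j.succ)
        = ((r : ℂ)⁻¹) ^ p * ∑ q : Fin p → Fin r, E q l x := by
    intro l x
    simp only [reconstructionMatrix_apply, Finset.prod_mul_distrib, Finset.prod_const,
      Finset.card_univ, Fintype.card_fin, Finset.prod_univ_sum, Fintype.piFinset_univ]
    congr 1
    refine Finset.sum_congr rfl fun q _ => ?_
    simp only [E]
    rw [← Complex.exp_sum, ← Finset.mul_sum, ← Complex.ofReal_sum, ← Finset.mul_sum]
    congr 4
    push_cast
    simp only [Finset.mul_sum, mul_ite, mul_zero]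
    have hcomm : ∀ g : Fin r → Fin d → Fin p → ℝ,
        ∑ a, ∑ m, ∑ j, g a m j = ∑ j, ∑ m, ∑ a, g a m j := fun g => by
      rw [Finset.sum_comm, Finset.sum_congr rfl fun m _ => Finset.sum_comm, Finset.sum_comm]
    rw [hcomm]
    refine Finset.sum_congr rfl fun j _ => Finset.sum_congr rfl fun m _ => ?_
    rw [Finset.sum_ite_eq]
    simp
  have hint : ∀ q l, Integrable (E q l) (samplingLaw d r) := fun q l => by
    refine Integrable.of_bound (C := 1) (by fun_prop) (ae_of_all _ fun x => ?_)
    simp only [E]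
    rw [Complex.norm_exp]
    simp
  simp only [trace_pow_eq_sum_path, hprod]
  have hsw : ∀ x, (∑ l : Fin (p + 1) → Harmonics d M, if l 0 = l (Fin.last p) then
      ((r : ℂ)⁻¹) ^ p * ∑ q : Fin p → Fin r, E q l x else 0)
      = ((r : ℂ)⁻¹) ^ p * ∑ q : Fin p → Fin r, ∑ l : Fin (p + 1) → Harmonics d M,
        if l 0 = l (Fin.last p) then E q l x else 0 := by
    intro x
    rw [Finset.sum_comm, Finset.mul_sum]
    refine Finset.sum_congr rfl fun l _ => ?_
    split_ifs <;> simp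
  simp only [hsw]
  have hint' : ∀ q l, Integrable (fun x => if l 0 = l (Fin.last p) then E q l x else 0)
      (samplingLaw d r) := fun q l => by
    split_ifs
    · exact hint q l
    · exact integrable_zero _ _ _
  rw [integral_const_mul, integral_finsetSum _ fun q _ => integrable_finsetSum _ fun l _ => hint' q l]
  congr 1
  refine Finset.sum_congr rfl fun q _ => ?_
  rw [integral_finsetSum _ fun l _ => hint' q l, ← Nat.cast_pow, ← card_closed_paths q,
    Finset.card_filter]
  push_cast
  refine Finset.sum_congr rfl fun l _ => ?_
  by_cases hl : l 0 = l (Fin.last p)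
  · simp only [hl, if_true, true_and]
    exact integral_samplingLaw_exp _
  · simp [hl]

/-- The mean trace of a power, as a sum over the coincidence patterns of the sampling points. -/
theorem meanTraceMoment_eq_sum_setoid (d M r p : ℕ) (hr : 0 < r) :
    meanTraceMoment d M r p = ((∑ s : Setoid (Fin p),
      (r.descFactorial (Nat.card (Quotient s)) : ℝ) / (r : ℝ) ^ Nat.card (Quotient s)
        * harmonicsRatio d M r ^ (nonminima s).card
        * (((circulations s M).card : ℝ) / (2 * (M : ℝ) + 1) ^ ((nonminima s).card + 1)) ^ d : ℝ) : ℂ) := by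
  classical
  have hgroup : ∑ q : Fin p → Fin r, ((circulations (Setoid.ker q) M).card : ℂ) ^ d
      = ∑ s : Setoid (Fin p), (r.descFactorial (Nat.card (Quotient s)) : ℂ)
        * ((circulations s M).card : ℂ) ^ d := by
    rw [← Finset.sum_fiberwise (s := Finset.univ) (g := fun q : Fin p → Fin r => Setoid.ker q)]
    refine Finset.sum_congr rfl fun s _ => ?_
    rw [Finset.sum_congr rfl fun q hq => by rw [(Finset.mem_filter.1 hq).2], Finset.sum_const,
      nsmul_eq_mul, ← card_ker_eq s r, Nat.card_eq_fintype_card, Fintype.card_subtype]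
  rw [meanTraceMoment, integral_trace_reconstructionMatrix_pow, hgroup, Complex.ofReal_sum,
    Finset.mul_sum, Finset.mul_sum]
  refine Finset.sum_congr rfl fun s _ => ?_
  have hcard := card_quotient_add_card_nonminima s
  rw [Fintype.card_fin] at hcard
  have hN : (2 * (M : ℂ) + 1) ≠ 0 := by exact_mod_cast (by omega : 2 * M + 1 ≠ 0)
  have hr' : (r : ℂ) ≠ 0 := by exact_mod_cast hr.ne'
  rw [harmonicsRatio]
  -- The power of `r` splits along `p = k + (p - k)`: the first part normalizes the falling
  -- factorial, the second pairs with powers of `(2M+1)^d` to form the ratio. The extra factor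
  -- `(2M+1)^d`, from the one additional free edge, is the normalization of the trace.
  have hp : ((r : ℂ)⁻¹) ^ p
      = ((r : ℂ)⁻¹) ^ Nat.card (Quotient s) * ((r : ℂ)⁻¹) ^ (nonminima s).card := by
    rw [← pow_add, hcard]
  rw [hp, inv_pow, inv_pow]
  push_cast
  rw [div_pow, div_pow, ← pow_mul, ← pow_mul, add_mul, pow_add, one_mul, mul_comm d]
  field_simp

/-! ### Free edges of a partition and the asymptotic number of circulations -/

section FreeEdges

variable {p : ℕ} (s : Setoid (Fin p))

open Classical in
/-- The edges whose values determine a circulation: the last one, and those that enter an element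
that is not the least of its class. -/
noncomputable def freeEdges : Finset (Fin (p + 1)) :=
  Finset.univ.filter fun i => ∀ a : Fin p, a.castSucc = i → a ∈ nonminima s

theorem mem_freeEdges {s : Setoid (Fin p)} {i : Fin (p + 1)} :
    i ∈ freeEdges s ↔ ∀ a : Fin p, a.castSucc = i → a ∈ nonminima s := by
  simp [freeEdges]

theorem notMem_freeEdges {s : Setoid (Fin p)} {i : Fin (p + 1)} :
    i ∉ freeEdges s ↔ ∃ a : Fin p, a.castSucc = i ∧ a ∉ nonminima s := by
  simp [mem_freeEdges]

theorem card_freeEdges : (freeEdges s).card = (nonminima s).card + 1 := by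
  have h : freeEdges s = insert (Fin.last p) ((nonminima s).map Fin.castSuccEmb) := by
    ext i
    simp only [mem_freeEdges, Finset.mem_insert, Finset.mem_map, Fin.coe_castSuccEmb]
    induction i using Fin.lastCases with
    | last => simp [Fin.castSucc_ne_last]
    | cast i => simp [Fin.castSucc_ne_last]
  rw [h, Finset.card_insert_of_notMem, Finset.card_map]
  simp [Fin.castSucc_ne_last]

variable (R : Type*) [CommRing R]

open Classical in
/-- The matrix of the system that prescribes the values on the free edges and the sums of the
increments over the classes. -/
noncomputable def constraintMatrix : Matrix (Fin (p + 1)) (Fin (p + 1)) R :=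
  Matrix.of fun i k => if i ∈ freeEdges s then (if i = k then 1 else 0) else
    ∑ j : Fin p, if (∃ a : Fin p, a.castSucc = i ∧ s j a) then
      ((if j.castSucc = k then 1 else 0) - (if j.succ = k then 1 else 0)) else 0

variable {R}

theorem constraintMatrix_mulVec_of_mem {l : Fin (p + 1) → R} {i : Fin (p + 1)}
    (hi : i ∈ freeEdges s) : (constraintMatrix s R).mulVec l i = l i := by
  simp [constraintMatrix, Matrix.mulVec, dotProduct, hi]

theorem constraintMatrix_mulVec_castSucc [DecidableRel s] {l : Fin (p + 1) → R} {a : Fin p}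
    (ha : a ∉ nonminima s) : (constraintMatrix s R).mulVec l a.castSucc =
      ∑ j, if s j a then l j.castSucc - l j.succ else 0 := by
  have hi : a.castSucc ∉ freeEdges s := notMem_freeEdges.2 ⟨a, rfl, ha⟩
  simp only [constraintMatrix, Matrix.mulVec, dotProduct, Matrix.of_apply, hi, if_false,
    Finset.sum_mul]
  rw [Finset.sum_comm]
  refine Finset.sum_congr rfl fun j _ => ?_
  by_cases h : s j a
  · simp [h, sub_mul]
  · simp [h]

theorem sum_class_eq_zero_iff [DecidableRel s] {l : Fin (p + 1) → R} :
    (∀ a, ∑ j, (if s j a then l j.castSucc - l j.succ else 0) = 0) ↔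
      ∀ i ∉ freeEdges s, (constraintMatrix s R).mulVec l i = 0 := by
  constructor
  · intro h i hi
    obtain ⟨a, rfl, ha⟩ := notMem_freeEdges.1 hi
    rw [constraintMatrix_mulVec_castSucc s ha]
    exact h a
  · intro h a
    obtain ⟨b, hb, hba⟩ := exists_minimum_rel s a
    have := h _ (notMem_freeEdges.2 ⟨b, rfl, hb⟩)
    rw [constraintMatrix_mulVec_castSucc s hb] at this
    have hiff : ∀ j, s j a ↔ s j b :=
      fun j => ⟨fun hj => s.trans hj (s.symm hba), fun hj => s.trans hj hba⟩
    simpa only [hiff] using this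

/-- The row of a class minimum `a` only involves edges next to elements `j ≥ a`, and the edge
entering `a` occurs there once, with coefficient `1`. The matrix is therefore upper triangular with
unit diagonal. Since the determinant is `1` over any ring, integer values on the free edges extend
to integer solutions. -/
theorem det_constraintMatrix : (constraintMatrix s R).det = 1 := by
  have hle : ∀ {a j : Fin p}, a ∉ nonminima s → s j a → a ≤ j := fun {a j} ha h =>
    not_lt.1 fun hlt => ha (mem_nonminima.2 ⟨j, hlt, h⟩)
  rw [Matrix.det_of_isUpperTriangular]
  · refine Finset.prod_eq_one fun i _ => ?_
    by_cases hi : i ∈ freeEdges s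
    · simp [constraintMatrix, hi]
    · obtain ⟨a, rfl, ha⟩ := notMem_freeEdges.1 hi
      simp only [constraintMatrix, Matrix.of_apply, hi, if_false]
      rw [Finset.sum_eq_single_of_mem a (Finset.mem_univ a)]
      · rw [if_pos ⟨a, rfl, s.refl a⟩, if_pos rfl, if_neg, sub_zero]
        exact (Fin.castSucc_lt_succ (i := a)).ne'
      · intro j _ hj
        split_ifs with h1 h2 h3 h3
        · exact absurd (Fin.castSucc_injective _ h2) hj
        · exact absurd (Fin.castSucc_injective _ h2) hj
        · obtain ⟨b, hb, hjb⟩ := h1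
          obtain rfl := Fin.castSucc_injective _ hb
          have := hle ha hjb
          rw [Fin.ext_iff] at h3
          simp only [Fin.val_succ, Fin.val_castSucc] at h3
          omega
        · simp
        · rfl
  · intro i k hik
    simp only [id] at hik
    by_cases hi : i ∈ freeEdges s
    · simp [constraintMatrix, hi, hik.ne']
    · obtain ⟨a, rfl, ha⟩ := notMem_freeEdges.1 hi
      simp only [constraintMatrix, Matrix.of_apply, hi, if_false]
      refine Finset.sum_eq_zero fun j _ => ?_
      split_ifs with h1 h2 h3 h3
      all_goals first | rfl | skip
      all_goals
        first
        | (obtain ⟨b, hb, hjb⟩ := h1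
           obtain rfl := Fin.castSucc_injective _ hb
           have := hle ha hjb
           simp only [Fin.lt_def, Fin.ext_iff, Fin.val_succ, Fin.val_castSucc] at *
           omega)
        | simp

theorem eq_of_eqOn_freeEdges [DecidableRel s] {l l' : Fin (p + 1) → R}
    (h : ∀ a, ∑ j, (if s j a then l j.castSucc - l j.succ else 0) = 0)
    (h' : ∀ a, ∑ j, (if s j a then l' j.castSucc - l' j.succ else 0) = 0)
    (heq : ∀ i ∈ freeEdges s, l i = l' i) : l = l' := by
  have hA : (constraintMatrix s R).mulVec l = (constraintMatrix s R).mulVec l' := by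
    funext i
    by_cases hi : i ∈ freeEdges s
    · rw [constraintMatrix_mulVec_of_mem s hi, constraintMatrix_mulVec_of_mem s hi, heq i hi]
    · rw [(sum_class_eq_zero_iff s).1 h i hi, (sum_class_eq_zero_iff s).1 h' i hi]
  have hu : IsUnit (constraintMatrix s R) := by
    rw [Matrix.isUnit_iff_isUnit_det, det_constraintMatrix]
    exact isUnit_one
  exact Matrix.mulVec_injective_of_isUnit hu hA

theorem circulations_injOn_restrict (M : ℕ) :
    Set.InjOn (fun (l : Fin (p + 1) → ℤ) (i : freeEdges s) => l i) (circulations s M) := by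
  classical
  intro l hl l' hl' h
  exact eq_of_eqOn_freeEdges s (mem_circulations.1 hl).2 (mem_circulations.1 hl').2
    fun i hi => congrFun h ⟨i, hi⟩

theorem card_circulations_le (M : ℕ) :
    ((circulations s M).card : ℝ) ≤ (2 * (M : ℝ) + 1) ^ ((nonminima s).card + 1) := by
  classical
  have h : (circulations s M).card
      ≤ (Fintype.piFinset fun _ : freeEdges s => Finset.Icc (-(M : ℤ)) M).card := by
    refine Finset.card_le_card_of_injOn _ (fun l hl => ?_) (circulations_injOn_restrict s M)
    simp only [Finset.mem_coe, Fintype.mem_piFinset, Finset.mem_Icc]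
    exact fun i => (mem_circulations.1 hl).1 i
  have h2 : ((M : ℤ) + 1 + M).toNat = 2 * M + 1 := by omega
  rw [Fintype.card_piFinset, Finset.prod_const, Int.card_Icc, sub_neg_eq_add, h2,
    Finset.card_univ, Fintype.card_coe, card_freeEdges] at h
  exact_mod_cast h

variable (R) in
open Classical in
/-- The extension of a vector indexed by the free edges by `0`. -/
noncomputable def extendFree : (freeEdges s → R) →ₗ[R] (Fin (p + 1) → R) where
  toFun u i := if h : i ∈ freeEdges s then u ⟨i, h⟩ else 0
  map_add' u v := by
    funext i
    by_cases h : i ∈ freeEdges s <;> simp [h]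
  map_smul' c u := by
    funext i
    by_cases h : i ∈ freeEdges s <;> simp [h]

variable (R) in
/-- The solution of the constraints with given values on the free edges. -/
noncomputable def solveFree : (freeEdges s → R) →ₗ[R] (Fin (p + 1) → R) :=
  (Matrix.mulVecLin (constraintMatrix s R)⁻¹).comp (extendFree s R)

theorem constraintMatrix_mulVec_solveFree (u : freeEdges s → R) :
    (constraintMatrix s R).mulVec (solveFree s R u) = extendFree s R u := by
  have hu : IsUnit (constraintMatrix s R).det := by
    rw [det_constraintMatrix]
    exact isUnit_one
  simp [solveFree, Matrix.mulVec_mulVec, Matrix.mul_nonsing_inv _ hu]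

theorem solveFree_apply_of_mem (u : freeEdges s → R) (i : freeEdges s) :
    solveFree s R u i = u i := by
  have := congrFun (constraintMatrix_mulVec_solveFree s u) i
  rw [constraintMatrix_mulVec_of_mem s i.2] at this
  rw [this]
  simp [extendFree]

theorem sum_class_solveFree [DecidableRel s] (u : freeEdges s → R) (a : Fin p) :
    ∑ j, (if s j a then solveFree s R u j.castSucc - solveFree s R u j.succ else 0) = 0 := by
  refine (sum_class_eq_zero_iff s).2 (fun i hi => ?_) a
  rw [constraintMatrix_mulVec_solveFree]
  simp [extendFree, hi]

/-- Both sides satisfy the constraints over `ℝ` with the same free values. This ties the lattice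
points of the real polytope to integer circulations. -/
theorem solveFree_intCast (u : freeEdges s → ℤ) (i : Fin (p + 1)) :
    solveFree s ℝ (fun i => (u i : ℝ)) i = (solveFree s ℤ u i : ℝ) := by
  classical
  refine congrFun (eq_of_eqOn_freeEdges s (sum_class_solveFree s _) (l' := fun i =>
    (solveFree s ℤ u i : ℝ)) (fun a => ?_) fun i hi => ?_) i
  · have h := congrArg (fun z : ℤ => (z : ℝ)) (sum_class_solveFree s u a)
    push_cast at h
    exact h
  · have h1 := solveFree_apply_of_mem s (fun i => (u i : ℝ)) ⟨i, hi⟩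
    have h2 := solveFree_apply_of_mem s u ⟨i, hi⟩
    simp only at h1 h2
    rw [h1, h2]

-- In the free coordinates the circulations, divided by `M`, are the points of the lattice of mesh
-- `1 / M` in a polytope. It is bounded and convex, so its frontier is null and the count is
-- asymptotic to its volume.
open scoped Pointwise in
theorem tendsto_card_circulations :
    ∃ v : ℝ, Tendsto (fun M : ℕ =>
      ((circulations s M).card : ℝ) / (2 * (M : ℝ) + 1) ^ ((nonminima s).card + 1)) atTop (𝓝 v) := by
  classical
  set S : Set (freeEdges s → ℝ) := {u | ∀ i, |solveFree s ℝ u i| ≤ 1} with hS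
  have hcont : Continuous (solveFree s ℝ) := LinearMap.continuous_of_finiteDimensional _
  have hbdd : Bornology.IsBounded S := by
    refine (Metric.isBounded_closedBall (x := (0 : freeEdges s → ℝ)) (r := 1)).subset fun u hu => ?_
    rw [mem_closedBall_zero_iff, pi_norm_le_iff_of_nonneg zero_le_one]
    intro i
    rw [← solveFree_apply_of_mem s u i]
    exact hu i
  have hclosed : IsClosed S := by
    simp only [hS, Set.ofPred_forall]
    exact isClosed_iInter fun i =>
      isClosed_le ((continuous_apply i).comp hcont).abs continuous_const
  have hconv : Convex ℝ S := by
    simp only [hS, Set.ofPred_forall]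
    refine convex_iInter fun i => ?_
    have : {u : freeEdges s → ℝ | |solveFree s ℝ u i| ≤ 1}
        = ((LinearMap.proj i).comp (solveFree s ℝ)) ⁻¹' Set.Icc (-1 : ℝ) 1 := by
      ext u
      simp [abs_le]
    rw [this]
    exact (convex_Icc _ _).linear_preimage _
  have hlim := tendsto_card_div_pow_atTop_volume S hbdd hclosed.measurableSet
    (hconv.addHaar_frontier volume)
  have hcard : ∀ M : ℕ, 0 < M → Nat.card
      ↑(S ∩ (M : ℝ)⁻¹ • (Submodule.span ℤ (Set.range (Pi.basisFun ℝ (freeEdges s))) :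
        Set (freeEdges s → ℝ))) = (circulations s M).card := by
    intro M hM
    have hM' : (0 : ℝ) < M := Nat.cast_pos.2 hM
    have : NeZero M := ⟨hM.ne'⟩
    -- A circulation is recovered from its free values: it agrees with the integer solution having
    -- the same ones.
    have hscale : ∀ l ∈ circulations s M, ∀ i,
        (l i : ℝ) = M * solveFree s ℝ (fun i => (M : ℝ)⁻¹ * (l i : ℝ)) i := by
      intro l hl i
      have h1 : (fun i : freeEdges s => (M : ℝ)⁻¹ * (l i : ℝ))
          = (M : ℝ)⁻¹ • fun i : freeEdges s => (l i : ℝ) := rfl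
      rw [h1, map_smul, Pi.smul_apply, smul_eq_mul, mul_inv_cancel_left₀ hM'.ne',
        solveFree_intCast s (fun i => l i)]
      congr 1
      exact congrFun (eq_of_eqOn_freeEdges s (mem_circulations.1 hl).2
        (sum_class_solveFree s _) fun i hi =>
          (solveFree_apply_of_mem s (fun i => l i) ⟨i, hi⟩).symm) i
    rw [← Fintype.card_coe, ← Nat.card_eq_fintype_card]
    symm
    refine Nat.card_congr (Equiv.ofBijective
      (fun l => ⟨fun i => (M : ℝ)⁻¹ * (l.1 i : ℝ), fun i => ?_,
        BoxIntegral.unitPartition.mem_smul_span_iff.2 fun i => ⟨l.1 i, ?_⟩⟩)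
      ⟨fun l l' h => ?_, fun u => ?_⟩)
    · have h := hscale l.1 l.2 i
      have hb := (mem_circulations.1 l.2).1 i
      rw [← mul_le_mul_iff_right₀ hM', ← abs_of_pos hM', ← abs_mul, abs_of_pos hM', ← h, mul_one,
        abs_le]
      exact_mod_cast hb
    · rw [mul_inv_cancel_left₀ hM'.ne']
      rfl
    · refine Subtype.ext (circulations_injOn_restrict s M l.2 l'.2 (funext fun i => ?_))
      have h1 := congrFun (Subtype.ext_iff.1 h) i
      exact_mod_cast mul_left_cancel₀ (inv_ne_zero hM'.ne') h1
    · choose z hz using BoxIntegral.unitPartition.mem_smul_span_iff.1 u.2.2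
      have hu : u.1 = (M : ℝ)⁻¹ • fun i => (z i : ℝ) := by
        funext i
        have := hz i
        simp only [Pi.smul_apply, smul_eq_mul]
        rw [eq_inv_mul_iff_mul_eq₀ hM'.ne', ← this]
        rfl
      refine ⟨⟨solveFree s ℤ z, mem_circulations.2 ⟨fun i => ?_, sum_class_solveFree s z⟩⟩, ?_⟩
      · have hb := u.2.1 i
        rw [hu, map_smul, Pi.smul_apply, smul_eq_mul, solveFree_intCast, abs_mul,
          abs_of_pos (inv_pos.2 hM'), inv_mul_le_iff₀ hM', mul_one, abs_le] at hb
        exact_mod_cast hb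
      · refine Subtype.ext (funext fun i => ?_)
        simp only [solveFree_apply_of_mem]
        rw [hu]
        rfl
  -- The lattice count is normalized by powers of `M`, the statement by powers of `2M + 1`; each
  -- free edge costs a factor `1 / 2` in the limit.
  have h2 : Tendsto (fun M : ℕ => ((M : ℝ) / (2 * (M : ℝ) + 1)) ^ ((nonminima s).card + 1)) atTop
      (𝓝 ((1 / 2) ^ ((nonminima s).card + 1))) := by
    refine Tendsto.pow ?_ _
    have h := (tendsto_natCast_div_add_atTop (1 / 2 : ℝ)).const_mul (1 / 2)
    rw [mul_one] at h
    refine h.congr fun M => ?_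
    field_simp
  refine ⟨_, (hlim.mul h2).congr' ?_⟩
  filter_upwards [eventually_gt_atTop 0] with M hM
  rw [hcard M hM, Fintype.card_coe, card_freeEdges, div_pow]
  field_simp

end FreeEdges

/-- A partition of a linear order is noncrossing if there are no `h < j < i < k` with `h, i` in one
class and `j, k` in another one. -/
def IsNoncrossing {α : Type*} [LinearOrder α] (s : Setoid α) : Prop :=
  ∀ ⦃h j i k : α⦄, h < j → j < i → i < k → s h i → s j k → s h j

theorem IsNoncrossing.comap {α β : Type*} [LinearOrder α] [LinearOrder β] {s : Setoid β}
    (hs : IsNoncrossing s) {f : α → β} (hf : StrictMono f) : IsNoncrossing (s.comap f) :=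
  fun _ _ _ _ h1 h2 h3 h4 h5 => hs (hf h1) (hf h2) (hf h3) h4 h5

/-! ### Removing a singleton class or one of two neighbours in a class -/

section Removal

variable {p : ℕ} {s : Setoid (Fin (p + 1))} {m : Fin (p + 1)}

theorem succ_succAbove_self (m₀ : Fin p) : m₀.succ.succAbove m₀ = m₀.castSucc :=
  Fin.succAbove_of_castSucc_lt _ _ Fin.castSucc_lt_succ

/-- Deleting the edge that enters `m` merges the step `m` into the step just before it, whose
increment absorbs that of `m`; the other increments do not change. -/
theorem increment_comp_succAbove (l : Fin (p + 2) → ℤ) (m : Fin (p + 1)) (j : Fin p) :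
    l (m.castSucc.succAbove j.castSucc) - l (m.castSucc.succAbove j.succ)
      = l (m.succAbove j).castSucc - l (m.succAbove j).succ +
        if j.succ = m then l m.castSucc - l m.succ else 0 := by
  rw [Fin.castSucc_succAbove_castSucc]
  by_cases h : j.succ = m
  · subst h
    rw [if_pos rfl, Fin.succAbove_of_le_castSucc _ _ le_rfl, Fin.succAbove_of_castSucc_lt _ _
      Fin.castSucc_lt_succ, Fin.succ_castSucc]
    ring
  · rw [if_neg h, add_zero]
    congr 2
    rcases lt_or_ge j.castSucc m with hlt | hge
    · have h2 : j.succ < m := lt_of_le_of_ne (Fin.castSucc_lt_iff_succ_le.1 hlt) h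
      rw [Fin.succAbove_of_castSucc_lt _ _ (Fin.castSucc_lt_castSucc_iff.2 h2), Fin.succAbove_of_castSucc_lt _ _ hlt,
        Fin.succ_castSucc]
    · rw [Fin.succAbove_of_le_castSucc _ _
        (Fin.castSucc_le_castSucc_iff.2 (hge.trans Fin.castSucc_lt_succ.le)), Fin.succAbove_of_le_castSucc _ _ hge]

theorem sum_increment_comp_succAbove (l : Fin (p + 2) → ℤ) (m : Fin (p + 1))
    (P : Fin (p + 1) → Prop) [DecidablePred P] :
    (∑ j : Fin p, if P (m.succAbove j) then
        l (m.castSucc.succAbove j.castSucc) - l (m.castSucc.succAbove j.succ) else 0)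
      + (if P m then l m.castSucc - l m.succ else 0)
      = (∑ j, if P j then l j.castSucc - l j.succ else 0)
        + ∑ j : Fin p, if P (m.succAbove j) ∧ j.succ = m then l m.castSucc - l m.succ else 0 := by
  rw [Fin.sum_univ_succAbove _ m, add_right_comm, add_assoc, ← Finset.sum_add_distrib, add_comm]
  congr 1
  refine Finset.sum_congr rfl fun j _ => ?_
  rw [increment_comp_succAbove]
  by_cases h : P (m.succAbove j) <;> simp [h, add_comm]

/-- Balance at a singleton class says that the edges entering and leaving `m` carry the same value,
so one of them can be deleted without loss. -/
theorem card_circulations_of_singleton (hm : ∀ x, s m x → x = m) (M : ℕ) :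
    (circulations s M).card = (circulations (s.comap m.succAbove) M).card := by
  classical
  have key : ∀ l : Fin (p + 2) → ℤ, l m.castSucc = l m.succ → ∀ a : Fin p,
      (∑ j : Fin p, if s (m.succAbove j) (m.succAbove a) then
        l (m.castSucc.succAbove j.castSucc) - l (m.castSucc.succAbove j.succ) else 0)
      = ∑ j, if s j (m.succAbove a) then l j.castSucc - l j.succ else 0 := by
    intro l hl a
    have := sum_increment_comp_succAbove l m fun j => s j (m.succAbove a)
    simpa [hl] using this
  have hself : ∀ l : Fin (p + 2) → ℤ,
      ∑ j, (if s j m then l j.castSucc - l j.succ else 0) = l m.castSucc - l m.succ := by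
    intro l
    rw [Finset.sum_eq_single_of_mem m (Finset.mem_univ m), if_pos (s.refl m)]
    exact fun j _ hj => if_neg fun h => hj (hm j (s.symm h))
  have hsucc : m.castSucc.succAbove m = m.succ := Fin.succAbove_castSucc_self m
  refine Finset.card_nbij' (fun l j => l (m.castSucc.succAbove j))
    -- In the shortened path the index `m` is the edge that leaves `m`; its value is copied to the
    -- inserted edge.
    (fun l => Fin.insertNth m.castSucc (l m) l) ?_ ?_ ?_ ?_
  · intro l hl
    obtain ⟨h1, h2⟩ := mem_circulations.1 hl
    have h0 := h2 m
    rw [hself, sub_eq_zero] at h0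
    exact mem_circulations.2 ⟨fun i => h1 _, fun a => (key l h0 a).trans (h2 _)⟩
  · intro l' hl'
    obtain ⟨h1, h2⟩ := mem_circulations.1 hl'
    set l : Fin (p + 2) → ℤ := Fin.insertNth m.castSucc (l' m) l' with hl
    have hl0 : ∀ j, l (m.castSucc.succAbove j) = l' j := fun j => by simp [hl]
    have h0 : l m.castSucc = l m.succ := by
      rw [← hsucc, hl0]
      simp [hl]
    change l ∈ circulations s M
    refine mem_circulations.2 ⟨fun i => ?_, fun a => ?_⟩
    · refine Fin.succAboveCases m.castSucc ?_ (fun j => ?_) i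
      · rw [h0, ← hsucc, hl0]
        exact h1 _
      · rw [hl0]
        exact h1 _
    · refine Fin.succAboveCases m ?_ (fun j => ?_) a
      · rw [hself, h0, sub_self]
      · rw [← key l h0 j]
        simp only [hl0]
        exact h2 j
  · intro l hl
    have h0 := (mem_circulations.1 hl).2 m
    rw [hself, sub_eq_zero, ← hsucc] at h0
    funext i
    refine Fin.succAboveCases m.castSucc ?_ (fun j => ?_) i
    · simp [h0]
    · simp
  · intro l hl
    funext j
    simp

/-- The edge between two neighbours of the same class is a loop at that class: it cancels in the
balance and takes each of the `2 * M + 1` values freely. -/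
theorem card_circulations_of_adjacent {m₀ : Fin p} (hm : s m₀.castSucc m₀.succ) (M : ℕ) :
    (circulations s M).card
      = (2 * M + 1) * (circulations (s.comap m₀.succ.succAbove) M).card := by
  classical
  set m := m₀.succ with hmdef
  have hSA : m.succAbove m₀ = m₀.castSucc := succ_succAbove_self m₀
  have key : ∀ (l : Fin (p + 2) → ℤ) (a : Fin (p + 1)),
      (∑ j : Fin p, if s (m.succAbove j) a then
        l (m.castSucc.succAbove j.castSucc) - l (m.castSucc.succAbove j.succ) else 0)
      = ∑ j, if s j a then l j.castSucc - l j.succ else 0 := by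
    intro l a
    have h := sum_increment_comp_succAbove l m fun j => s j a
    have hiff : s m₀.castSucc a ↔ s m a :=
      ⟨fun h => s.trans (s.symm hm) h, fun h => s.trans hm h⟩
    have h2 : (∑ j : Fin p, if s (m.succAbove j) a ∧ j.succ = m then l m.castSucc - l m.succ else 0)
        = if s m a then l m.castSucc - l m.succ else 0 := by
      rw [Finset.sum_eq_single_of_mem m₀ (Finset.mem_univ _)]
      · simp only [hSA, hiff, ← hmdef, and_true]
      · intro j _ hj
        rw [if_neg]
        intro h
        exact hj (Fin.succ_injective _ h.2)
    rw [h2] at h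
    exact add_right_cancel h
  have hN : (Finset.Icc (-(M : ℤ)) M).card = 2 * M + 1 := by
    rw [Int.card_Icc]
    omega
  rw [← hN, ← Finset.card_product]
  refine Finset.card_nbij' (fun l => (l m.castSucc, fun j => l (m.castSucc.succAbove j)))
    (fun y => Fin.insertNth m.castSucc y.1 y.2) ?_ ?_ ?_ ?_
  · intro l hl
    obtain ⟨h1, h2⟩ := mem_circulations.1 hl
    exact Finset.mem_product.2 ⟨Finset.mem_Icc.2 (h1 _),
      mem_circulations.2 ⟨fun i => h1 _, fun a => (key l _).trans (h2 _)⟩⟩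
  · rintro ⟨c, l'⟩ hy
    obtain ⟨hc, hl'⟩ := Finset.mem_product.1 hy
    obtain ⟨h1, h2⟩ := mem_circulations.1 hl'
    set l : Fin (p + 2) → ℤ := Fin.insertNth m.castSucc c l' with hl
    have hl0 : ∀ j, l (m.castSucc.succAbove j) = l' j := fun j => by simp [hl]
    have hclass : ∀ a : Fin p, ∑ j, (if s j (m.succAbove a) then l j.castSucc - l j.succ else 0) = 0 := by
      intro a
      rw [← key l]
      simp only [hl0]
      exact h2 a
    change l ∈ circulations s M
    refine mem_circulations.2 ⟨fun i => ?_, fun a => ?_⟩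
    · refine Fin.succAboveCases m.castSucc ?_ (fun j => ?_) i
      · simpa [hl] using hc
      · rw [hl0]
        exact h1 _
    · refine Fin.succAboveCases m ?_ (fun j => ?_) a
      · have := hclass m₀
        rw [hSA] at this
        have hiff : ∀ j, s j m ↔ s j m₀.castSucc :=
          fun j => ⟨fun h => s.trans h (s.symm hm), fun h => s.trans h hm⟩
        simpa only [hiff] using this
      · exact hclass j
  · intro l hl
    funext i
    refine Fin.succAboveCases m.castSucc ?_ (fun j => ?_) i <;> simp
  · rintro ⟨c, l'⟩ hy
    simp

theorem card_nonminima_of_singleton (hm : ∀ x, s m x → x = m) :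
    (nonminima s).card = (nonminima (s.comap m.succAbove)).card := by
  have h : nonminima s = (nonminima (s.comap m.succAbove)).map (Fin.succAboveEmb m) := by
    ext x
    simp only [Finset.mem_map, mem_nonminima, Fin.succAboveEmb_apply]
    constructor
    · rintro ⟨y, hy, hyx⟩
      have hx : x ≠ m := by
        rintro rfl
        exact hy.ne (hm y (s.symm hyx))
      have hy' : y ≠ m := by
        rintro rfl
        exact hy.ne' (hm x hyx)
      obtain ⟨x', rfl⟩ := Fin.exists_succAbove_eq hx
      obtain ⟨y', rfl⟩ := Fin.exists_succAbove_eq hy'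
      exact ⟨x', ⟨y', (Fin.strictMono_succAbove m).lt_iff_lt.1 hy, hyx⟩, rfl⟩
    · rintro ⟨x', ⟨y', hy, hyx⟩, rfl⟩
      exact ⟨_, Fin.strictMono_succAbove m hy, hyx⟩
  rw [h, Finset.card_map]

theorem card_nonminima_of_adjacent {m₀ : Fin p} (hm : s m₀.castSucc m₀.succ) :
    (nonminima s).card = (nonminima (s.comap m₀.succ.succAbove)).card + 1 := by
  set m := m₀.succ with hmdef
  have hSA : m.succAbove m₀ = m₀.castSucc := succ_succAbove_self m₀
  have h : nonminima s = insert m ((nonminima (s.comap m.succAbove)).map (Fin.succAboveEmb m)) := by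
    ext x
    simp only [Finset.mem_insert, Finset.mem_map, mem_nonminima, Fin.succAboveEmb_apply]
    constructor
    · rintro ⟨y, hy, hyx⟩
      by_cases hx : x = m
      · exact Or.inl hx
      · obtain ⟨x', rfl⟩ := Fin.exists_succAbove_eq hx
        refine Or.inr ⟨x', ?_, rfl⟩
        by_cases hy' : y = m
        · subst hy'
          refine ⟨m₀, (Fin.strictMono_succAbove m).lt_iff_lt.1 ?_, ?_⟩
          · rw [hSA]
            exact Fin.castSucc_lt_succ.trans hy
          · change s (m.succAbove m₀) _
            rw [hSA]
            exact s.trans hm hyx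
        · obtain ⟨y', rfl⟩ := Fin.exists_succAbove_eq hy'
          exact ⟨y', (Fin.strictMono_succAbove m).lt_iff_lt.1 hy, hyx⟩
    · rintro (rfl | ⟨x', ⟨y', hy, hyx⟩, rfl⟩)
      · exact ⟨_, Fin.castSucc_lt_succ, hm⟩
      · exact ⟨_, Fin.strictMono_succAbove m hy, hyx⟩
  rw [h, Finset.card_insert_of_notMem, Finset.card_map]
  simp [Fin.succAbove_ne]

theorem isNoncrossing_iff_of_singleton (hm : ∀ x, s m x → x = m) :
    IsNoncrossing s ↔ IsNoncrossing (s.comap m.succAbove) := by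
  refine ⟨fun h => h.comap (Fin.strictMono_succAbove m), fun hs h j i k h1 h2 h3 h4 h5 => ?_⟩
  have hne : ∀ {x y : Fin (p + 1)}, x ≠ y → s x y → x ≠ m := by
    rintro x y hxy h rfl
    exact hxy (hm y h).symm
  obtain ⟨h', rfl⟩ := Fin.exists_succAbove_eq (hne (h1.trans h2).ne h4)
  obtain ⟨i', rfl⟩ := Fin.exists_succAbove_eq (hne (h1.trans h2).ne' (s.symm h4))
  obtain ⟨j', rfl⟩ := Fin.exists_succAbove_eq (hne (h2.trans h3).ne h5)
  obtain ⟨k', rfl⟩ := Fin.exists_succAbove_eq (hne (h2.trans h3).ne' (s.symm h5))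
  have hlt := fun {a b : Fin p} => (Fin.strictMono_succAbove m).lt_iff_lt (a := a) (b := b)
  exact hs (hlt.1 h1) (hlt.1 h2) (hlt.1 h3) h4 h5

/-- The monotone map `m₀.predAbove` collapses the two neighbours and preserves the relation in both
directions. In a crossing, consecutive points are unrelated, so their strict order survives the
collapse. -/
theorem isNoncrossing_iff_of_adjacent {m₀ : Fin p} (hm : s m₀.castSucc m₀.succ) :
    IsNoncrossing s ↔ IsNoncrossing (s.comap m₀.succ.succAbove) := by
  refine ⟨fun h => h.comap (Fin.strictMono_succAbove _), fun hs h j i k h1 h2 h3 h4 h5 => ?_⟩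
  have hret : ∀ x, s x (m₀.succ.succAbove (m₀.predAbove x)) := by
    intro x
    by_cases hx : x = m₀.succ
    · subst hx
      rw [Fin.predAbove_succ_self, succ_succAbove_self]
      exact s.symm hm
    · rw [Fin.succ_succAbove_predAbove hx]
  have hrel : ∀ {x y}, s.comap m₀.succ.succAbove (m₀.predAbove x) (m₀.predAbove y) ↔ s x y :=
    fun {x y} => ⟨fun h => s.trans (hret x) (s.trans h (s.symm (hret y))),
      fun h => s.trans (s.symm (hret x)) (s.trans h (hret y))⟩
  by_contra hcr
  have hlt : ∀ {x y}, x < y → ¬ s x y → m₀.predAbove x < m₀.predAbove y := fun {x y} hxy hn =>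
    lt_of_le_of_ne (Fin.predAbove_right_monotone _ hxy.le) fun he => hn (hrel.1 (by rw [he]))
  exact hcr (hrel.1 (hs (hlt h1 hcr) (hlt h2 fun h' => hcr (s.trans h4 (s.symm h')))
    (hlt h3 fun h' => hcr (s.trans (s.trans h4 h') (s.symm h5))) (hrel.2 h4) (hrel.2 h5)))

end Removal

/-! ### Partitions without singletons and without related neighbours -/

section Irreducible

variable {p : ℕ} {s : Setoid (Fin (p + 1))}

/-- Take related `a < b` at minimal distance. The successor `c` of `a` is unrelated to `a` and lies
before `b`; it has a partner, which cannot lie between `a` and `b` by minimality and hence yields a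
crossing. -/
theorem not_isNoncrossing_of_irreducible (hsing : ∀ m, ∃ x, s m x ∧ x ≠ m)
    (hadj : ∀ j : Fin p, ¬ s j.castSucc j.succ) : ¬ IsNoncrossing s := by
  classical
  intro hs
  have hex : ∃ n : ℕ, ∃ a b : Fin (p + 1), s a b ∧ a < b ∧ (b : ℕ) = a + n := by
    obtain ⟨x, hx, hne⟩ := hsing 0
    exact ⟨x, 0, x, hx, Fin.pos_of_ne_zero hne, by simp⟩
  obtain ⟨a, b, hab, hlt, hn⟩ := Nat.find_spec hex
  have hmin : ∀ {x y : Fin (p + 1)}, s x y → x < y → (b : ℕ) - a ≤ y - x := by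
    intro x y hxy hlt'
    have := Nat.find_min' hex (m := y - x) ⟨x, y, hxy, hlt', by omega⟩
    omega
  have hap : (a : ℕ) < p := by omega
  set c : Fin (p + 1) := (⟨a, hap⟩ : Fin p).succ with hc
  have hcv : (c : ℕ) = a + 1 := by simp [hc]
  have hac : ¬ s a c := hadj ⟨a, hap⟩
  have hcb : c < b := by
    rw [Fin.lt_def]
    have : (c : ℕ) ≠ b := fun h => hac (Fin.ext h ▸ hab)
    omega
  obtain ⟨c', hcc', hne⟩ := hsing c
  have hac' : ¬ s a c' := fun h => hac (s.trans h (s.symm hcc'))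
  have hc'b : c' ≠ b := fun h => hac' (h ▸ hab)
  have hc'a : c' ≠ a := fun h => hac' (h ▸ s.refl a)
  have hlt_ac : a < c := by rw [Fin.lt_def]; omega
  rcases lt_or_gt_of_ne hc'b with h | h
  · rcases lt_or_gt_of_ne hc'a with h' | h'
    · exact hac' (s.symm (hs h' hlt_ac hcb (s.symm hcc') hab))
    · have hcc : c < c' := by
        rw [Fin.lt_def]
        have : (c : ℕ) ≠ c' := fun h => hne (Fin.ext h.symm)
        omega
      have := hmin hcc' hcc
      omega
  · exact hac (hs hlt_ac hcb h hab hcc')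

/-- Let `b` be the largest class minimum. Apart from the edge entering `b`, all edges at its class
are free. Large values on the edges leaving the class and very negative ones on the other edges
entering it would force a value above `M` on the edge entering `b`. This excludes a box with a fixed
share of the cube. -/
theorem exists_card_circulations_le_of_irreducible (hsing : ∀ m, ∃ x, s m x ∧ x ≠ m)
    (hadj : ∀ j : Fin p, ¬ s j.castSucc j.succ) :
    ∃ ε : ℝ, 0 < ε ∧ ∀ M : ℕ, 1 ≤ M → ((circulations s M).card : ℝ) ≤
      (1 - ε) * (2 * (M : ℝ) + 1) ^ ((nonminima s).card + 1) := by
  classical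
  refine ⟨(1 / 6) ^ ((nonminima s).card + 1), by positivity, fun M hM => ?_⟩
  obtain ⟨b₀, hb₀, -⟩ := exists_minimum_rel s 0
  have hne : (Finset.univ.filter fun x => x ∉ nonminima s).Nonempty := ⟨b₀, by simpa using hb₀⟩
  obtain ⟨b, hb, hbmax⟩ : ∃ b, b ∉ nonminima s ∧ ∀ x, b < x → x ∈ nonminima s := by
    refine ⟨Finset.max' _ hne, (Finset.mem_filter.1 (Finset.max'_mem _ hne)).2, fun x hx => ?_⟩
    by_contra h
    exact absurd (Finset.le_max' _ x (by simpa using h)) (not_le.2 hx)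
  have hble : ∀ {j}, s j b → b ≤ j := fun {j} h =>
    not_lt.1 fun hlt => hb (mem_nonminima.2 ⟨j, hlt, h⟩)
  let large : Fin (p + 2) → Prop := fun i => ∃ j, s j b ∧ j.succ = i
  let small : Fin (p + 2) → Prop := fun i => ∃ j, s j b ∧ j ≠ b ∧ j.castSucc = i
  -- An edge that both leaves and enters the class would join two related neighbours, so the two
  -- requirements never meet on one edge.
  have hls : ∀ i, small i → ¬ large i := by
    rintro _ ⟨j, hj, -, rfl⟩ ⟨j', hj', h⟩
    have hj'p : (j' : ℕ) < p := by
      have := congrArg Fin.val h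
      simp only [Fin.val_succ, Fin.val_castSucc] at this
      omega
    refine hadj ⟨j', hj'p⟩ ?_
    have e1 : (⟨j', hj'p⟩ : Fin p).castSucc = j' := rfl
    have e2 : (⟨j', hj'p⟩ : Fin p).succ = j := by
      rw [Fin.ext_iff] at h ⊢
      simpa using h
    rw [e1, e2]
    exact s.trans hj' (s.symm hj)
  let box : freeEdges s → Finset ℤ := fun i =>
    if large i then Finset.Icc ((M : ℤ) / 2 + 1) M
    else if small i then Finset.Icc (-(M : ℤ)) (-((M : ℤ) / 2 + 1)) else Finset.Icc (-(M : ℤ)) M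
  let cube : Finset (freeEdges s → ℤ) := Fintype.piFinset fun _ => Finset.Icc (-(M : ℤ)) M
  have hboxsub : Fintype.piFinset box ⊆ cube := by
    refine Fintype.piFinset_subset _ _ fun i => ?_
    simp only [box]
    split_ifs
    · exact Finset.Icc_subset_Icc (by omega) le_rfl
    · exact Finset.Icc_subset_Icc le_rfl (by omega)
    · exact subset_rfl
  have hmap : (circulations s M).card ≤ (cube \ Fintype.piFinset box).card := by
    refine Finset.card_le_card_of_injOn _ (fun l hl => ?_) (circulations_injOn_restrict s M)
    obtain ⟨h1, h2⟩ := mem_circulations.1 hl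
    simp only [Finset.mem_coe, Finset.mem_sdiff]
    refine ⟨Fintype.mem_piFinset.2 fun i => Finset.mem_Icc.2 (h1 i), fun hbox => ?_⟩
    rw [Fintype.mem_piFinset] at hbox
    have hlarge : ∀ j, s j b → (M : ℤ) / 2 + 1 ≤ l j.succ := by
      intro j hj
      have hfree : j.succ ∈ freeEdges s := mem_freeEdges.2 fun a ha => hbmax a <|
        (hble hj).trans_lt <| by
          have := congrArg Fin.val ha
          simp only [Fin.val_succ, Fin.val_castSucc] at this
          rw [Fin.lt_def]
          omega
      have := hbox ⟨j.succ, hfree⟩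
      have hL : large j.succ := ⟨j, hj, rfl⟩
      simp only [box, hL, if_true, Finset.mem_Icc] at this
      exact this.1
    have hsmall : ∀ j, s j b → j ≠ b → l j.castSucc ≤ -((M : ℤ) / 2 + 1) := by
      intro j hj hjb
      have hfree : j.castSucc ∈ freeEdges s := mem_freeEdges.2 fun a ha => by
        rw [Fin.castSucc_injective _ ha]
        exact hbmax j (lt_of_le_of_ne (hble hj) hjb.symm)
      have := hbox ⟨j.castSucc, hfree⟩
      have hS : small j.castSucc := ⟨j, hj, hjb, rfl⟩
      simp only [box, hS, hls _ hS, if_true, if_false, Finset.mem_Icc] at this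
      exact this.2
    -- The class contains some `x ≠ b`. Balance equates the value entering `b` with the value
    -- leaving `b` plus the net outflow of the other members: the part of `x` alone suffices to
    -- exceed `M`, and the rest only helps.
    obtain ⟨x, hbx, hxb⟩ := hsing b
    have hsum := h2 b
    rw [← Finset.add_sum_erase _ _ (Finset.mem_univ b), if_pos (s.refl b),
      ← Finset.add_sum_erase _ _ (Finset.mem_erase.2 ⟨hxb, Finset.mem_univ x⟩),
      if_pos (s.symm hbx)] at hsum
    have hrest : ∑ j ∈ (Finset.univ.erase b).erase x,
        (if s j b then l j.castSucc - l j.succ else 0) ≤ 0 := by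
      refine Finset.sum_nonpos fun j hj => ?_
      split_ifs with hjb
      · have e1 := hlarge j hjb
        have e2 := hsmall j hjb (Finset.mem_erase.1 (Finset.mem_erase.1 hj).2).1
        omega
      · exact le_rfl
    have e1 := hlarge b (s.refl b)
    have e2 := hlarge x (s.symm hbx)
    have e3 := hsmall x (s.symm hbx) hxb
    have e4 := (h1 b.castSucc).2
    omega
  have hM' : (1 : ℝ) ≤ M := by exact_mod_cast hM
  have hcube : (cube.card : ℝ) = (2 * (M : ℝ) + 1) ^ ((nonminima s).card + 1) := by
    have h2 : ((M : ℤ) + 1 + M).toNat = 2 * M + 1 := by omega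
    simp only [cube]
    rw [Fintype.card_piFinset, Finset.prod_const, Int.card_Icc, sub_neg_eq_add, h2,
      Finset.card_univ, Fintype.card_coe, card_freeEdges]
    push_cast
    rfl
  have hvol : ((2 * (M : ℝ) + 1) / 6) ^ ((nonminima s).card + 1)
      ≤ ((Fintype.piFinset box).card : ℝ) := by
    rw [Fintype.card_piFinset, ← card_freeEdges, ← Fintype.card_coe, ← Finset.card_univ,
      ← Finset.prod_const]
    push_cast
    refine Finset.prod_le_prod (fun _ _ => by positivity) fun i _ => ?_
    -- Every side of the box has at least `M - M / 2` points, which is at least a sixth of `2 * M +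
    -- 1` once `M ≥ 1`.
    have hcast : ∀ k : ℕ, 2 * M + 1 ≤ 6 * k → (2 * (M : ℝ) + 1) / 6 ≤ (k : ℝ) := by
      intro k hk
      have : (2 * (M : ℝ) + 1) ≤ 6 * k := by exact_mod_cast hk
      linarith
    simp only [box]
    split_ifs
    all_goals
      rw [Int.card_Icc]
      refine hcast _ ?_
      omega
  have hle : ((circulations s M).card : ℝ) ≤ cube.card - (Fintype.piFinset box).card := by
    rw [Finset.card_sdiff_of_subset hboxsub] at hmap
    have := Finset.card_le_card hboxsub
    rw [← Nat.cast_sub this]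
    exact_mod_cast hmap
  calc _ ≤ _ := hle
    _ ≤ (2 * (M : ℝ) + 1) ^ ((nonminima s).card + 1)
        - ((2 * (M : ℝ) + 1) / 6) ^ ((nonminima s).card + 1) := by linarith
    _ = _ := by
      rw [div_pow, one_div, inv_pow]
      ring

end Irreducible

/-- The circulations of a noncrossing partition fill the cube of the values on the free edges; for
the other partitions they miss a positive fraction of it. -/
theorem card_circulations_dichotomy {p : ℕ} (s : Setoid (Fin p)) :
    (IsNoncrossing s ∧ ∀ M : ℕ,
      (circulations s M).card = (2 * M + 1) ^ ((nonminima s).card + 1)) ∨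
    (¬ IsNoncrossing s ∧ ∃ ε : ℝ, 0 < ε ∧ ∀ M : ℕ, 1 ≤ M → ((circulations s M).card : ℝ) ≤
      (1 - ε) * (2 * (M : ℝ) + 1) ^ ((nonminima s).card + 1)) := by
  classical
  induction p with
  | zero =>
    refine Or.inl ⟨fun h => h.elim0, fun M => ?_⟩
    have h1 : circulations s M = Fintype.piFinset fun _ => Finset.Icc (-(M : ℤ)) M := by
      ext l
      simp [mem_circulations]
    have h2 : nonminima s = ∅ := Finset.eq_empty_of_isEmpty _
    have h3 : (Finset.Icc (-(M : ℤ)) M).card = 2 * M + 1 := by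
      rw [Int.card_Icc]
      omega
    rw [h1, h2, Fintype.card_piFinset, Finset.prod_const, h3]
    simp
  | succ p ih =>
    -- Both removals preserve the normalized count and the noncrossing property, so the induction
    -- stops at the empty partition or at an irreducible one.
    by_cases hsing : ∃ m, ∀ x, s m x → x = m
    · obtain ⟨m, hm⟩ := hsing
      simp only [card_circulations_of_singleton hm, card_nonminima_of_singleton hm,
        isNoncrossing_iff_of_singleton hm]
      exact ih _
    by_cases hadj : ∃ m₀ : Fin p, s m₀.castSucc m₀.succ
    · obtain ⟨m₀, hm⟩ := hadj
      simp only [card_circulations_of_adjacent hm, card_nonminima_of_adjacent hm,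
        isNoncrossing_iff_of_adjacent hm]
      rcases ih (s.comap m₀.succ.succAbove) with ⟨h1, h2⟩ | ⟨h1, ε, hε, h2⟩
      · exact Or.inl ⟨h1, fun M => by rw [h2 M]; ring⟩
      · refine Or.inr ⟨h1, ε, hε, fun M hM => ?_⟩
        have := mul_le_mul_of_nonneg_left (h2 M hM) (by positivity : (0 : ℝ) ≤ 2 * M + 1)
        push_cast
        refine this.trans_eq ?_
        ring
    push Not at hsing hadj
    exact Or.inr ⟨not_isNoncrossing_of_irreducible hsing hadj,
      exists_card_circulations_le_of_irreducible hsing hadj⟩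

/-! ### Number of partitions, gluing, and the noncrossing polynomial -/

/-- A partition is determined by the map sending `x` to the least element of its class, which is at
most `x`; there are `p!` maps with this bound. -/
theorem card_setoid_fin_le_factorial (p : ℕ) : Fintype.card (Setoid (Fin p)) ≤ p.factorial := by
  classical
  choose rep hrep hrel using fun s : Setoid (Fin p) => exists_minimum_rel s
  have hle : ∀ s x, rep s x ≤ x := fun s x =>
    not_lt.1 fun hlt => hrep s x (mem_nonminima.2 ⟨x, hlt, s.symm (hrel s x)⟩)
  have hiff : ∀ s x y, s x y ↔ rep s x = rep s y := fun s x y =>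
    ⟨fun h => eq_of_notMem_nonminima (hrep s x) (hrep s y)
      (s.trans (hrel s x) (s.trans h (s.symm (hrel s y)))),
      fun h => s.trans (s.symm (hrel s x)) (h ▸ hrel s y)⟩
  have hcard : (Fintype.piFinset fun x : Fin p => Finset.Iic x).card = p.factorial := by
    rw [Fintype.card_piFinset]
    simp only [Fin.card_Iic]
    rw [Fin.prod_univ_eq_prod_range (fun i => i + 1), Finset.prod_range_add_one_eq_factorial]
  rw [← hcard, ← Finset.card_univ]
  refine Finset.card_le_card_of_injOn rep (fun s _ => ?_) fun s _ t _ h => ?_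
  · simpa using hle s
  · exact Setoid.ext fun x y => by rw [hiff, hiff, h]

/-- The setoid on a disjoint sum with the given restrictions and no relation across. -/
def sumSetoid {γ δ : Type*} (s₁ : Setoid γ) (s₂ : Setoid δ) : Setoid (γ ⊕ δ) where
  r := Sum.LiftRel s₁ s₂
  iseqv :=
    { refl := by
        rintro (x | x)
        · exact .inl (s₁.refl x)
        · exact .inr (s₂.refl x)
      symm := by
        rintro _ _ (h | h)
        · exact .inl (s₁.symm h)
        · exact .inr (s₂.symm h)
      trans := by
        rintro _ _ _ (h | h) (h' | h')
        · exact .inl (s₁.trans h h')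
        · exact .inr (s₂.trans h h') }

section SumSetoid

variable {α γ δ : Type*} {s₁ : Setoid γ} {s₂ : Setoid δ}

@[simp] theorem sumSetoid_inl_inl {x y : γ} : sumSetoid s₁ s₂ (.inl x) (.inl y) ↔ s₁ x y :=
  Sum.liftRel_inl_inl

@[simp] theorem sumSetoid_inr_inr {x y : δ} : sumSetoid s₁ s₂ (.inr x) (.inr y) ↔ s₂ x y :=
  Sum.liftRel_inr_inr

@[simp] theorem not_sumSetoid_inl_inr {x : γ} {y : δ} : ¬ sumSetoid s₁ s₂ (.inl x) (.inr y) :=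
  Sum.not_liftRel_inl_inr

@[simp] theorem not_sumSetoid_inr_inl {x : δ} {y : γ} : ¬ sumSetoid s₁ s₂ (.inr x) (.inl y) :=
  Sum.not_liftRel_inr_inl

/-- A partition with no relation across two parts is glued from its restrictions. The map `f` need
not be injective, only constant within classes, so that an element may be collapsed onto a related
one. -/
theorem comap_sumSetoid_comap {f : α → γ ⊕ δ} {g₁ : γ → α} {g₂ : δ → α}
    (h₁ : ∀ c, f (g₁ c) = .inl c) (h₂ : ∀ c, f (g₂ c) = .inr c) {s : Setoid α}
    (hs : ∀ x y, f x = f y → s x y) (hs' : ∀ c d, ¬ s (g₁ c) (g₂ d)) :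
    (sumSetoid (s.comap g₁) (s.comap g₂)).comap f = s := by
  refine Setoid.ext fun x y => ?_
  change sumSetoid _ _ (f x) (f y) ↔ _
  have hl : ∀ {x c}, f x = .inl c → s x (g₁ c) := fun h => hs _ _ (h.trans (h₁ _).symm)
  have hr : ∀ {x c}, f x = .inr c → s x (g₂ c) := fun h => hs _ _ (h.trans (h₂ _).symm)
  rcases hx : f x with c | c <;> rcases hy : f y with d | d
  · rw [sumSetoid_inl_inl]
    exact ⟨fun h => s.trans (hl hx) (s.trans h (s.symm (hl hy))),
      fun h => s.trans (s.symm (hl hx)) (s.trans h (hl hy))⟩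
  · refine iff_of_false not_sumSetoid_inl_inr fun h => hs' c d ?_
    exact s.trans (s.symm (hl hx)) (s.trans h (hr hy))
  · refine iff_of_false not_sumSetoid_inr_inl fun h => hs' d c ?_
    exact s.trans (s.symm (hl hy)) (s.trans (s.symm h) (hr hx))
  · rw [sumSetoid_inr_inr]
    exact ⟨fun h => s.trans (hr hx) (s.trans h (s.symm (hr hy))),
      fun h => s.trans (s.symm (hr hx)) (s.trans h (hr hy))⟩

theorem comap_comap_sumSetoid_left {f : α → γ ⊕ δ} {g₁ : γ → α}
    (h₁ : ∀ c, f (g₁ c) = .inl c) : ((sumSetoid s₁ s₂).comap f).comap g₁ = s₁ :=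
  Setoid.ext fun x y => by
    change sumSetoid _ _ (f (g₁ x)) (f (g₁ y)) ↔ _
    rw [h₁, h₁, sumSetoid_inl_inl]

theorem comap_comap_sumSetoid_right {f : α → γ ⊕ δ} {g₂ : δ → α}
    (h₂ : ∀ c, f (g₂ c) = .inr c) : ((sumSetoid s₁ s₂).comap f).comap g₂ = s₂ :=
  Setoid.ext fun x y => by
    change sumSetoid _ _ (f (g₂ x)) (f (g₂ y)) ↔ _
    rw [h₂, h₂, sumSetoid_inr_inr]

end SumSetoid

open Classical in
/-- The generating polynomial of the noncrossing partitions of a finite linear order, by the number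
of elements that are not the least of their class. -/
noncomputable def noncrossingSum (β : ℝ) (α : Type*) [LinearOrder α] [Fintype α] : ℝ :=
  ∑ s : Setoid α with IsNoncrossing s, β ^ (nonminima s).card

theorem noncrossingSum_congr (β : ℝ) {α γ : Type*} [LinearOrder α] [Fintype α] [LinearOrder γ]
    [Fintype γ] (e : α ≃o γ) : noncrossingSum β α = noncrossingSum β γ := by
  classical
  refine Finset.sum_nbij' (fun s => s.comap e.symm) (fun s => s.comap e) ?_ ?_ ?_ ?_ ?_
  · intro s hs
    simp only [Finset.mem_filter, Finset.mem_univ, true_and] at hs ⊢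
    exact hs.comap e.symm.strictMono
  · intro s hs
    simp only [Finset.mem_filter, Finset.mem_univ, true_and] at hs ⊢
    exact hs.comap e.strictMono
  · intro s _
    exact Setoid.ext fun x y => by simp [Setoid.comap_rel]
  · intro s _
    exact Setoid.ext fun x y => by simp [Setoid.comap_rel]
  · intro s _
    congr 1
    refine Finset.card_bij (fun x _ => e x) ?_ ?_ ?_
    · intro x hx
      obtain ⟨y, hy, hyx⟩ := mem_nonminima.1 hx
      exact mem_nonminima.2 ⟨e y, e.strictMono hy, by simpa [Setoid.comap_rel] using hyx⟩
    · intro x _ y _ h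
      exact e.injective h
    · intro x hx
      obtain ⟨y, hy, hyx⟩ := mem_nonminima.1 hx
      exact ⟨e.symm x, mem_nonminima.2 ⟨e.symm y, e.symm.strictMono hy, hyx⟩, by simp⟩

theorem noncrossingSum_eq_of_card (β : ℝ) {α : Type*} [LinearOrder α] [Fintype α] {k : ℕ}
    (h : Fintype.card α = k) : noncrossingSum β α = noncrossingSum β (Fin k) :=
  (noncrossingSum_congr β (Fintype.orderIsoFinOfCardEq α h)).symm

/-! ### Recursion for noncrossing partitions by the last element -/

section LastElement

variable {p : ℕ}

/-- The last element forms a class of `s`. -/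
def LastIsSingleton (s : Setoid (Fin (p + 1))) : Prop := ∀ x, s x (Fin.last p) → x = Fin.last p

/-- The predecessor of the last element in its class is `j`. -/
def LastFollows (j : Fin p) (s : Setoid (Fin (p + 1))) : Prop :=
  s j.castSucc (Fin.last p) ∧ ∀ x, j.castSucc < x → x < Fin.last p → ¬ s x (Fin.last p)

theorem lastIsSingleton_or_exists_lastFollows (s : Setoid (Fin (p + 1))) :
    LastIsSingleton s ∨ ∃ j, LastFollows j s := by
  classical
  by_cases h : LastIsSingleton s
  · exact Or.inl h
  · refine Or.inr ?_
    simp only [LastIsSingleton, not_forall] at h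
    obtain ⟨x, hx, hne⟩ := h
    have hne' : (Finset.univ.filter fun j : Fin p => s j.castSucc (Fin.last p)).Nonempty := by
      refine ⟨x.castPred hne, ?_⟩
      simpa using hx
    refine ⟨_, (Finset.mem_filter.1 (Finset.max'_mem _ hne')).2, fun y hy hy' hs => ?_⟩
    have hmem : y.castPred hy'.ne ∈ Finset.univ.filter fun j : Fin p => s j.castSucc (Fin.last p) := by
      simpa using hs
    have := Finset.le_max' _ _ hmem
    rw [← Fin.castSucc_le_castSucc_iff, Fin.castSucc_castPred] at this
    exact absurd hy (not_lt.2 this)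

theorem not_lastFollows_of_lastIsSingleton {s : Setoid (Fin (p + 1))} (h : LastIsSingleton s)
    (j : Fin p) : ¬ LastFollows j s := fun hj => Fin.castSucc_ne_last j (h _ hj.1)

theorem lastFollows_unique {s : Setoid (Fin (p + 1))} {j j' : Fin p} (h : LastFollows j s)
    (h' : LastFollows j' s) : j = j' := by
  rcases lt_trichotomy j j' with hlt | rfl | hlt
  · exact absurd h'.1 (h.2 _ (Fin.castSucc_lt_castSucc_iff.2 hlt) (Fin.castSucc_lt_last _))
  · rfl
  · exact absurd h.1 (h'.2 _ (Fin.castSucc_lt_castSucc_iff.2 hlt) (Fin.castSucc_lt_last _))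

open Classical in
theorem sum_noncrossing_lastIsSingleton (β : ℝ) :
    ∑ s : Setoid (Fin (p + 1)) with IsNoncrossing s ∧ LastIsSingleton s, β ^ (nonminima s).card
      = noncrossingSum β (Fin p) := by
  let f : Fin (p + 1) → Fin p ⊕ Unit := Fin.lastCases (.inr ()) fun i => .inl i
  let g₂ : Unit → Fin (p + 1) := fun _ => Fin.last p
  have h₁ : ∀ c : Fin p, f c.castSucc = .inl c := fun c => by simp [f]
  have h₂ : ∀ c, f (g₂ c) = .inr c := fun c => by simp [f, g₂]
  have hSA : (Fin.last p).succAbove = Fin.castSucc := Fin.succAbove_last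
  have hsing : ∀ {s : Setoid (Fin (p + 1))}, LastIsSingleton s →
      ∀ x, s (Fin.last p) x → x = Fin.last p := fun {s} h x hx => h x (s.symm hx)
  refine Finset.sum_nbij' (fun s => s.comap Fin.castSucc) (fun s => (sumSetoid s ⊥).comap f)
    ?_ ?_ ?_ ?_ ?_
  · intro s hs
    simp only [Finset.mem_filter, Finset.mem_univ, true_and] at hs ⊢
    exact hs.1.comap Fin.strictMono_castSucc
  · intro s hs
    simp only [Finset.mem_filter, Finset.mem_univ, true_and] at hs ⊢
    have hl : LastIsSingleton ((sumSetoid s ⊥).comap f) := by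
      intro x hx
      induction x using Fin.lastCases with
      | last => rfl
      | cast i =>
        have hx' : sumSetoid s ⊥ (f i.castSucc) (f (g₂ ())) := hx
        rw [h₁, h₂ ()] at hx'
        exact absurd hx' not_sumSetoid_inl_inr
    refine ⟨?_, hl⟩
    rw [isNoncrossing_iff_of_singleton (hsing hl), hSA, comap_comap_sumSetoid_left h₁]
    exact hs
  · intro s hs
    simp only [Finset.mem_filter, Finset.mem_univ, true_and] at hs
    have hbot : (⊥ : Setoid Unit) = s.comap g₂ := Setoid.ext fun x y => by simp
    rw [hbot]
    refine comap_sumSetoid_comap h₁ h₂ (fun x y h => ?_) fun c d h => ?_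
    · induction x using Fin.lastCases <;> induction y using Fin.lastCases <;> simp_all [f]
    · exact Fin.castSucc_ne_last c (hs.2 _ h)
  · intro s _
    exact comap_comap_sumSetoid_left h₁
  · intro s hs
    simp only [Finset.mem_filter, Finset.mem_univ, true_and] at hs
    rw [card_nonminima_of_singleton (hsing hs.2), hSA]

-- If `j` precedes the last element in its class, that arc separates the elements strictly between
-- them from those up to `j`. The two restrictions are arbitrary noncrossing partitions, and the
-- last element, which is not a minimum, contributes the factor `β`.
open Classical in
theorem sum_noncrossing_lastFollows (β : ℝ) (j : Fin p) :
    ∑ s : Setoid (Fin (p + 1)) with IsNoncrossing s ∧ LastFollows j s, β ^ (nonminima s).card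
      = β * (noncrossingSum β {x : Fin (p + 1) // x ≤ j.castSucc} *
          noncrossingSum β {x : Fin (p + 1) // j.castSucc < x ∧ x < Fin.last p}) := by
  let J := {x : Fin (p + 1) // x ≤ j.castSucc}
  let I := {x : Fin (p + 1) // j.castSucc < x ∧ x < Fin.last p}
  -- The last element is collapsed onto `j`, to which it is related.
  let f : Fin (p + 1) → J ⊕ I := fun x => if h : x ≤ j.castSucc then .inl ⟨x, h⟩ else
    if h' : x < Fin.last p then .inr ⟨x, not_le.1 h, h'⟩ else .inl ⟨j.castSucc, le_rfl⟩
  have hjl : j.castSucc < Fin.last p := Fin.castSucc_lt_last j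
  have h₁ : ∀ c : J, f c = .inl c := fun c => by simp [f, c.2]
  have h₂ : ∀ c : I, f c = .inr c := fun c => by simp [f, not_le.2 c.2.1, c.2.2]
  have hlast : f (Fin.last p) = .inl ⟨j.castSucc, le_rfl⟩ := by simp [f, not_le.2 hjl]
  have hcases : ∀ x, (∃ c : J, (c : Fin (p + 1)) = x) ∨ (∃ c : I, (c : Fin (p + 1)) = x) ∨
      x = Fin.last p := by
    intro x
    by_cases h : x ≤ j.castSucc
    · exact Or.inl ⟨⟨x, h⟩, rfl⟩
    · by_cases h' : x < Fin.last p
      · exact Or.inr (Or.inl ⟨⟨x, not_le.1 h, h'⟩, rfl⟩)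
      · exact Or.inr (Or.inr (le_antisymm (Fin.le_last x) (not_lt.1 h')))
  -- A relation across would cross the arc from `j` to the last element, or put an element after `j`
  -- into the class of the last one.
  have hcross : ∀ {s : Setoid (Fin (p + 1))}, IsNoncrossing s → LastFollows j s →
      ∀ (c : J) (d : I), ¬ s c d := by
    intro s hs hj c d h
    rcases c.2.lt_or_eq with hlt | heq
    · have := hs hlt d.2.1 d.2.2 h hj.1
      exact hj.2 _ d.2.1 d.2.2 (s.trans (s.symm h) (s.trans this hj.1))
    · exact hj.2 _ d.2.1 d.2.2 (s.trans (s.symm h) (by rw [heq]; exact hj.1))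
  simp only [noncrossingSum]
  rw [Finset.sum_mul_sum, ← Finset.sum_product', Finset.mul_sum]
  refine Finset.sum_nbij' (fun s => (s.comap (fun c : J => (c : Fin (p + 1))),
      s.comap (fun c : I => (c : Fin (p + 1)))))
    (fun t => (sumSetoid t.1 t.2).comap f) ?_ ?_ ?_ ?_ ?_
  · intro s hs
    simp only [Finset.mem_filter, Finset.mem_univ, true_and, Finset.mem_product] at hs ⊢
    exact ⟨hs.1.comap (Subtype.strictMono_coe _), hs.1.comap (Subtype.strictMono_coe _)⟩
  · rintro ⟨s₁, s₂⟩ ht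
    simp only [Finset.mem_filter, Finset.mem_univ, true_and, Finset.mem_product] at ht ⊢
    obtain ⟨hs₁, hs₂⟩ := ht
    set s := (sumSetoid s₁ s₂).comap f with hs
    have hdef : ∀ x y, s x y ↔ sumSetoid s₁ s₂ (f x) (f y) := fun x y => Iff.rfl
    have hJJ : ∀ c c' : J, s c c' ↔ s₁ c c' := fun c c' => by
      rw [hdef, h₁, h₁, sumSetoid_inl_inl]
    have hII : ∀ c c' : I, s c c' ↔ s₂ c c' := fun c c' => by
      rw [hdef, h₂, h₂, sumSetoid_inr_inr]
    have hJI : ∀ (c : J) (c' : I), ¬ s c c' := fun c c' => by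
      rw [hdef, h₁, h₂]
      exact not_sumSetoid_inl_inr
    have hjL : s j.castSucc (Fin.last p) := by
      rw [hdef, hlast, h₁ ⟨j.castSucc, le_rfl⟩]
    have hIL : ∀ c : I, ¬ s c (Fin.last p) := fun c h =>
      hJI ⟨j.castSucc, le_rfl⟩ c (s.trans hjL (s.symm h))
    refine ⟨fun h j' i k h1 h2 h3 h4 h5 => ?_, hjL, fun x hx hx' => hIL ⟨x, hx, hx'⟩⟩
    have hi_lt : i < Fin.last p := h3.trans_le (Fin.le_last k)
    by_cases hiJ : i ≤ j.castSucc
    · have hj'J : j' ≤ j.castSucc := h2.le.trans hiJ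
      have hhJ : h ≤ j.castSucc := h1.le.trans hj'J
      rcases hcases k with ⟨c, rfl⟩ | ⟨c, rfl⟩ | rfl
      · rw [hJJ ⟨h, hhJ⟩ ⟨j', hj'J⟩]
        exact hs₁ (i := ⟨i, hiJ⟩) (k := c) h1 h2 h3 ((hJJ ⟨h, hhJ⟩ ⟨i, hiJ⟩).1 h4)
          ((hJJ ⟨j', hj'J⟩ c).1 h5)
      · exact absurd h5 (hJI ⟨j', hj'J⟩ c)
      · have h5' : s j' j.castSucc := s.trans h5 (s.symm hjL)
        rcases hiJ.lt_or_eq with hlt | rfl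
        · rw [hJJ ⟨h, hhJ⟩ ⟨j', hj'J⟩]
          exact hs₁ (i := ⟨i, hiJ⟩) (k := ⟨j.castSucc, le_rfl⟩) h1 h2 hlt
            ((hJJ ⟨h, hhJ⟩ ⟨i, hiJ⟩).1 h4) ((hJJ ⟨j', hj'J⟩ ⟨j.castSucc, le_rfl⟩).1 h5')
        · exact s.trans h4 (s.symm h5')
    · have hiI : j.castSucc < i ∧ i < Fin.last p := ⟨not_le.1 hiJ, hi_lt⟩
      have hhJ : ¬ h ≤ j.castSucc := fun hh => hJI ⟨h, hh⟩ ⟨i, hiI⟩ h4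
      have hhI : j.castSucc < h ∧ h < Fin.last p := ⟨not_le.1 hhJ, (h1.trans h2).trans hi_lt⟩
      have hj'I : j.castSucc < j' ∧ j' < Fin.last p := ⟨hhI.1.trans h1, h2.trans hi_lt⟩
      have hkL : k ≠ Fin.last p := by
        rintro rfl
        exact hIL ⟨j', hj'I⟩ h5
      have hkI : j.castSucc < k ∧ k < Fin.last p :=
        ⟨hiI.1.trans h3, lt_of_le_of_ne (Fin.le_last k) hkL⟩
      rw [hII ⟨h, hhI⟩ ⟨j', hj'I⟩]
      exact hs₂ (i := ⟨i, hiI⟩) (k := ⟨k, hkI⟩) h1 h2 h3 ((hII ⟨h, hhI⟩ ⟨i, hiI⟩).1 h4)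
        ((hII ⟨j', hj'I⟩ ⟨k, hkI⟩).1 h5)
  · intro s hs
    simp only [Finset.mem_filter, Finset.mem_univ, true_and] at hs
    refine comap_sumSetoid_comap h₁ h₂ (fun x y h => ?_) (hcross hs.1 hs.2)
    rcases hcases x with ⟨c, rfl⟩ | ⟨c, rfl⟩ | rfl <;>
      rcases hcases y with ⟨c', rfl⟩ | ⟨c', rfl⟩ | rfl
    all_goals simp only [h₁, h₂, hlast, Sum.inl.injEq, Sum.inr.injEq, reduceCtorEq] at h
    · rw [h]
    · rw [h]
      exact hs.2.1
    · rw [h]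
    · rw [← h]
      exact s.symm hs.2.1
    · exact s.refl _
  · rintro ⟨s₁, s₂⟩ _
    exact Prod.ext (comap_comap_sumSetoid_left h₁) (comap_comap_sumSetoid_right h₂)
  · intro s hs
    simp only [Finset.mem_filter, Finset.mem_univ, true_and] at hs
    rw [← pow_add, ← pow_succ']
    congr 1
    set s₁ := s.comap (fun c : J => (c : Fin (p + 1)))
    set s₂ := s.comap (fun c : I => (c : Fin (p + 1)))
    have hnm : nonminima s = insert (Fin.last p) (((nonminima s₁).map (Function.Embedding.subtype _)) ∪
        ((nonminima s₂).map (Function.Embedding.subtype _))) := by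
      ext x
      simp only [Finset.mem_insert, Finset.mem_union, Finset.mem_map, Function.Embedding.subtype_apply,
        mem_nonminima]
      constructor
      · rintro ⟨y, hy, hyx⟩
        rcases hcases x with ⟨c, rfl⟩ | ⟨c, rfl⟩ | rfl
        · exact Or.inr (Or.inl ⟨c, ⟨⟨y, hy.le.trans c.2⟩, hy, hyx⟩, rfl⟩)
        · refine Or.inr (Or.inr ⟨c, ⟨⟨y, ?_, hy.trans c.2.2⟩, hy, hyx⟩, rfl⟩)
          by_contra hyJ
          exact hcross hs.1 hs.2 ⟨y, not_lt.1 hyJ⟩ c hyx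
        · exact Or.inl rfl
      · rintro (rfl | ⟨c, ⟨y, hy, hyx⟩, rfl⟩ | ⟨c, ⟨y, hy, hyx⟩, rfl⟩)
        · exact ⟨_, hjl, hs.2.1⟩
        · exact ⟨y, hy, hyx⟩
        · exact ⟨y, hy, hyx⟩
    rw [hnm, Finset.card_insert_of_notMem, Finset.card_union_of_disjoint, Finset.card_map,
      Finset.card_map]
    · rw [Finset.disjoint_left]
      intro x hx hx'
      obtain ⟨c, -, rfl⟩ := Finset.mem_map.1 hx
      obtain ⟨c', -, h⟩ := Finset.mem_map.1 hx'
      have h' : (c' : Fin (p + 1)) = c := h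
      exact absurd c.2 (not_le.2 (h' ▸ c'.2.1))
    · intro hx
      rcases Finset.mem_union.1 hx with hx | hx <;> obtain ⟨c, -, h⟩ := Finset.mem_map.1 hx
      · have h' : (c : Fin (p + 1)) = Fin.last p := h
        exact absurd (h' ▸ c.2) (not_le.2 hjl)
      · have h' : (c : Fin (p + 1)) = Fin.last p := h
        exact absurd h' c.2.2.ne

theorem noncrossingSum_succ (β : ℝ) (p : ℕ) :
    noncrossingSum β (Fin (p + 1)) = noncrossingSum β (Fin p) + β * ∑ j ∈ Finset.range p,
      noncrossingSum β (Fin (j + 1)) * noncrossingSum β (Fin (p - 1 - j)) := by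
  classical
  have hsplit : (Finset.univ.filter fun s : Setoid (Fin (p + 1)) => IsNoncrossing s)
      = (Finset.univ.filter fun s => IsNoncrossing s ∧ LastIsSingleton s) ∪
        Finset.univ.biUnion fun j => Finset.univ.filter fun s => IsNoncrossing s ∧ LastFollows j s := by
    ext s
    simp only [Finset.mem_filter, Finset.mem_univ, true_and, Finset.mem_union, Finset.mem_biUnion]
    constructor
    · intro h
      rcases lastIsSingleton_or_exists_lastFollows s with h' | ⟨j, hj⟩
      · exact Or.inl ⟨h, h'⟩
      · exact Or.inr ⟨j, h, hj⟩
    · rintro (h | ⟨j, h⟩) <;> exact h.1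
  rw [noncrossingSum, hsplit, Finset.sum_union, Finset.sum_biUnion, sum_noncrossing_lastIsSingleton]
  · congr 1
    rw [Finset.mul_sum, ← Fin.sum_univ_eq_sum_range (fun j =>
      β * (noncrossingSum β (Fin (j + 1)) * noncrossingSum β (Fin (p - 1 - j))))]
    refine Finset.sum_congr rfl fun j _ => ?_
    rw [sum_noncrossing_lastFollows]
    congr 2
    · refine noncrossingSum_eq_of_card β ?_
      rw [Fintype.card_subtype]
      have : (Finset.univ.filter fun x : Fin (p + 1) => x ≤ j.castSucc) = Finset.Iic j.castSucc := by
        ext x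
        simp
      rw [this, Fin.card_Iic, Fin.val_castSucc]
    · refine noncrossingSum_eq_of_card β ?_
      rw [Fintype.card_subtype]
      have : (Finset.univ.filter fun x : Fin (p + 1) => j.castSucc < x ∧ x < Fin.last p)
          = Finset.Ioo j.castSucc (Fin.last p) := by
        ext x
        simp
      rw [this, Fin.card_Ioo, Fin.val_castSucc, Fin.val_last]
      omega
  · intro j _ j' _ hne
    rw [Function.onFun, Finset.disjoint_left]
    intro s hs hs'
    exact hne (lastFollows_unique (Finset.mem_filter.1 hs).2.2 (Finset.mem_filter.1 hs').2.2)
  · rw [Finset.disjoint_left]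
    intro s hs hs'
    obtain ⟨j, -, hj⟩ := Finset.mem_biUnion.1 hs'
    exact not_lastFollows_of_lastIsSingleton (Finset.mem_filter.1 hs).2.2 j
      (Finset.mem_filter.1 hj).2.2

theorem noncrossingSum_zero (β : ℝ) : noncrossingSum β (Fin 0) = 1 := by
  classical
  have h : (Finset.univ.filter fun s : Setoid (Fin 0) => IsNoncrossing s) = {⊥} := by
    ext s
    simp only [Finset.mem_filter, Finset.mem_univ, true_and, Finset.mem_singleton]
    exact ⟨fun _ => Setoid.ext fun x => x.elim0, fun _ x => x.elim0⟩
  have h2 : nonminima (⊥ : Setoid (Fin 0)) = ∅ := Finset.eq_empty_of_isEmpty _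
  rw [noncrossingSum, h, Finset.sum_singleton, h2]
  simp

end LastElement

/-! ### Path counts and the generating series of noncrossing partitions -/

theorem noncrossingSum_le_factorial {β : ℝ} (h0 : 0 ≤ β) (h1 : β ≤ 1) (p : ℕ) :
    noncrossingSum β (Fin p) ≤ (p.factorial : ℝ) := by
  classical
  calc noncrossingSum β (Fin p) ≤ ∑ s : Setoid (Fin p) with IsNoncrossing s, (1 : ℝ) :=
        Finset.sum_le_sum fun s _ => pow_le_one₀ h0 h1
    _ ≤ (Fintype.card (Setoid (Fin p)) : ℝ) := by
        rw [Finset.sum_const, nsmul_one]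
        exact_mod_cast Finset.card_le_univ _
    _ ≤ _ := by exact_mod_cast card_setoid_fin_le_factorial p

/-- The recursion for the weighted numbers of lattice paths of `p` steps that start at height `h`
and first reach height `0` at the end; the weights of the steps are `1`, `1 + β` and `β`. -/
structure IsPathCount (β : ℝ) (G : ℕ → ℕ → ℝ) : Prop where
  init : ∀ h, G 0 h = if h = 1 then 1 else 0
  boundary : ∀ n, G n 0 = 0
  step : ∀ n h, G (n + 1) (h + 1) = G n h + (1 + β) * G n (h + 1) + β * G n (h + 2)

theorem IsPathCount.eq {β : ℝ} {G G' : ℕ → ℕ → ℝ} (hG : IsPathCount β G)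
    (hG' : IsPathCount β G') : G = G' := by
  funext n
  induction n with
  | zero =>
    funext h
    rw [hG.init, hG'.init]
  | succ n ih =>
    funext h
    cases h with
    | zero => rw [hG.boundary, hG'.boundary]
    | succ h => rw [hG.step, hG'.step, ih]

section Noncrossing

open PowerSeries

/-- The generating series of the nonempty noncrossing partitions. -/
noncomputable def noncrossingSeries (β : ℝ) : PowerSeries ℝ :=
  PowerSeries.mk fun p => if p = 0 then 0 else noncrossingSum β (Fin p)

/-- The recursion by the last element reads `F = X * (1 + F) * (1 + β * F)`. -/
theorem noncrossingSeries_eq (β : ℝ) : noncrossingSeries β =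
    X * (1 + C (1 + β) * noncrossingSeries β + C β * noncrossingSeries β ^ 2) := by
  have hM : (1 + noncrossingSeries β) = PowerSeries.mk fun p => noncrossingSum β (Fin p) := by
    ext p
    rw [map_add, coeff_one, noncrossingSeries, coeff_mk, coeff_mk]
    by_cases h : p = 0
    · subst h
      simp [noncrossingSum_zero]
    · simp [h]
  have hfac : X * (1 + C (1 + β) * noncrossingSeries β + C β * noncrossingSeries β ^ 2)
      = X * ((1 + noncrossingSeries β) + C β * (noncrossingSeries β * (1 + noncrossingSeries β))) := by
    rw [map_add, map_one]
    ring
  rw [hfac, hM]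
  ext p
  cases p with
  | zero => simp [noncrossingSeries]
  | succ p =>
    rw [coeff_succ_X_mul, map_add, coeff_C_mul, coeff_mul, coeff_mk, noncrossingSeries, coeff_mk,
      if_neg (Nat.succ_ne_zero p), noncrossingSum_succ]
    congr 2
    rw [Finset.Nat.sum_antidiagonal_eq_sum_range_succ_mk, Finset.sum_range_succ']
    simp only [coeff_mk, if_true, zero_mul, add_zero, Nat.succ_ne_zero, if_false]
    refine Finset.sum_congr rfl fun j _ => ?_
    rw [Nat.sub_sub, add_comm 1 j]

/-- Multiplying the quadratic equation for the series by its `h`-th power gives the three-term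
recursion between successive powers. -/
theorem isPathCount_noncrossing (β : ℝ) :
    IsPathCount β fun n h => coeff (n + 1) (noncrossingSeries β ^ h) := by
  have hstep : ∀ h, noncrossingSeries β ^ (h + 1) = X * (noncrossingSeries β ^ h
      + C (1 + β) * noncrossingSeries β ^ (h + 1) + C β * noncrossingSeries β ^ (h + 2)) := by
    intro h
    calc noncrossingSeries β ^ (h + 1) = noncrossingSeries β ^ h * noncrossingSeries β := pow_succ _ _
      _ = noncrossingSeries β ^ h * (X * (1 + C (1 + β) * noncrossingSeries β
            + C β * noncrossingSeries β ^ 2)) := by rw [← noncrossingSeries_eq]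
      _ = _ := by ring
  have h0 : constantCoeff (noncrossingSeries β) = 0 := by simp [noncrossingSeries]
  refine ⟨fun h => ?_, fun n => ?_, fun n h => ?_⟩
  · cases h with
    | zero => simp [coeff_one]
    | succ h =>
      rw [hstep, coeff_succ_X_mul, coeff_zero_eq_constantCoeff]
      simp only [map_add, map_mul, map_pow, h0]
      cases h <;> simp
  · simp [coeff_one]
  · have := congrArg (coeff (n + 1 + 1)) (hstep h)
    rwa [coeff_succ_X_mul, map_add (coeff (n + 1)), map_add (coeff (n + 1)), coeff_C_mul,
      coeff_C_mul] at this

end Noncrossing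

/-! ### Narayana polynomials as path counts -/

section Narayana

open Polynomial

/-- The generating polynomial of the path counts, shifted. -/
noncomputable def pathPolynomial (β : ℝ) (n : ℕ) : ℝ[X] :=
  (1 + X) ^ n * (X + C β) ^ n * (X ^ 2 - C β)

theorem coeff_one_add_X_pow_mul_sum (β : ℝ) (n k : ℕ) :
    ((1 + X) ^ n * (X + C β) ^ n : ℝ[X]).coeff k = ∑ j ∈ Finset.range (n + 1),
      if n - j ≤ k then (n.choose j : ℝ) * (n.choose (k - (n - j)) : ℝ) * β ^ j else 0 := by
  have h : ((1 + X) ^ n * (X + C β) ^ n : ℝ[X]) = ∑ j ∈ Finset.range (n + 1),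
      C ((n.choose j : ℝ) * β ^ j) * ((1 + X) ^ n * X ^ (n - j)) := by
    rw [add_comm X (C β), add_pow (C β) X n, Finset.mul_sum]
    refine Finset.sum_congr rfl fun j _ => ?_
    simp only [map_mul, map_pow, map_natCast]
    ring
  rw [h, finsetSum_coeff]
  refine Finset.sum_congr rfl fun j _ => ?_
  rw [coeff_C_mul, coeff_mul_X_pow', coeff_one_add_X_pow]
  split_ifs
  · ring
  · simp

theorem coeff_add_one_add_X_pow_mul (β : ℝ) (n d : ℕ) :
    ((1 + X) ^ n * (X + C β) ^ n : ℝ[X]).coeff (n + d) = ∑ j ∈ Finset.range (n + 1),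
      (n.choose j : ℝ) * (n.choose (j + d) : ℝ) * β ^ j := by
  rw [coeff_one_add_X_pow_mul_sum]
  refine Finset.sum_congr rfl fun j hj => ?_
  have hj' := Finset.mem_range.1 hj
  rw [if_pos (by omega), show n + d - (n - j) = j + d by omega]

/-- Reflection principle: multiplication by `(1 + X) * (X + C β)` performs one step with weights
`1`, `1 + β`, `β`, and the factor `X ^ 2 - C β` makes the polynomial antisymmetric, up to powers of
`β` and `X`, under the exchange of `X` with `β / X`. The middle coefficient, which stands for height
`0`, therefore vanishes. -/
theorem isPathCount_pathPolynomial (β : ℝ) :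
    IsPathCount β fun n h => (pathPolynomial β n).coeff (n + 1 + h) := by
  refine ⟨fun h => ?_, fun n => ?_, fun n h => ?_⟩
  · simp only [pathPolynomial, pow_zero, one_mul, coeff_sub, coeff_X_pow, coeff_C]
    have h2 : 0 + 1 + h = 2 ↔ h = 1 := by omega
    rw [if_neg (by omega : ¬ 0 + 1 + h = 0), sub_zero]
    simp only [h2]
  · simp only [add_zero]
    rw [pathPolynomial, mul_sub, coeff_sub, coeff_mul_C, coeff_add_one_add_X_pow_mul]
    cases n with
    | zero => simp [coeff_X_pow]
    | succ n =>
      -- The term `j = 0` of the first sum fails its range condition and the last term of the second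
      -- contains a vanishing binomial; the remaining terms cancel after a shift by one.
      rw [show n + 1 + 1 = n + 2 by ring, coeff_mul_X_pow, coeff_one_add_X_pow_mul_sum,
        Finset.sum_range_succ', Finset.sum_range_succ _ (n + 1)]
      rw [if_neg (by omega), Nat.choose_succ_self]
      simp only [Nat.cast_zero, mul_zero, zero_mul, add_zero]
      rw [Finset.sum_mul, sub_eq_zero]
      refine Finset.sum_congr rfl fun j hj => ?_
      have hj' := Finset.mem_range.1 hj
      rw [if_pos (by omega), show n - (n + 1 - (j + 1)) = j by omega]
      ring
  · have hrec : pathPolynomial β (n + 1) = pathPolynomial β n * X ^ 2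
        + pathPolynomial β n * X ^ 1 * C (1 + β) + pathPolynomial β n * C β := by
      simp only [pathPolynomial, map_add, map_one]
      ring
    rw [hrec, coeff_add, coeff_add, coeff_mul_C, coeff_mul_C,
      show n + 1 + 1 + (h + 1) = (n + 1 + h) + 2 by ring, coeff_mul_X_pow,
      show n + 1 + h + 2 = (n + 1 + (h + 1)) + 1 by ring, coeff_mul_X_pow]
    rw [show n + 1 + (h + 2) = n + 1 + (h + 1) + 1 by ring]
    ring

/-- The determinant form of the Narayana numbers, with `a = p - k`. The case distinction is needed
because `a - 1` truncates to `0` at `a = 0`, where the binomial must count as `0`. -/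
theorem narayanaNumber_eq (n a : ℕ) (ha : a ≤ n) : narayanaNumber (n + 1) (n + 1 - a)
    = (n.choose a : ℝ) ^ 2 - (if a = 0 then 0 else (n.choose (a - 1) : ℝ)) * (n.choose (a + 1) : ℝ) := by
  have hs : n + 1 - a - 1 = n - a := by omega
  have h1 : (n + 1).choose (n - a) = (n + 1).choose (a + 1) := by
    rw [← Nat.choose_symm (by omega : a + 1 ≤ n + 1)]
    congr 1
    omega
  rw [narayanaNumber, hs, Nat.add_sub_cancel, Nat.choose_symm ha, h1,
    Nat.cast_sub (by omega : a ≤ n + 1)]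
  have hpos : (0 : ℝ) < ((n + 1 : ℕ) : ℝ) - a := by
    have : (a : ℝ) ≤ n := by exact_mod_cast ha
    push_cast
    linarith
  have e1 : ((n + 1).choose (a + 1) : ℝ) * (a + 1) = (n + 1) * n.choose a := by
    exact_mod_cast (Nat.add_one_mul_choose_eq n a).symm
  have e2 : (n.choose (a + 1) : ℝ) * (a + 1) = n.choose a * (n - a) := by
    rw [← Nat.cast_sub ha]
    exact_mod_cast Nat.choose_succ_right_eq n a
  have e3 : (if a = 0 then 0 else (n.choose (a - 1) : ℝ)) * (((n + 1 : ℕ) : ℝ) - a)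
      = n.choose a * a := by
    rcases a with _ | a
    · simp
    · have h := Nat.choose_succ_right_eq n a
      have h' : (n.choose (a + 1) : ℝ) * (a + 1) = n.choose a * (n - a) := by
        rw [← Nat.cast_sub (by omega : a ≤ n)]
        exact_mod_cast h
      simp only [Nat.succ_ne_zero, if_false, Nat.add_sub_cancel]
      push_cast
      linarith
  have ha1 : (0 : ℝ) < (a : ℝ) + 1 := by positivity
  generalize (if a = 0 then (0 : ℝ) else (n.choose (a - 1) : ℝ)) = u at *
  have e1' := eq_div_of_mul_eq ha1.ne' e1
  have e2' := eq_div_of_mul_eq ha1.ne' e2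
  have e3' := eq_div_of_mul_eq hpos.ne' e3
  rw [e1', e2', e3']
  push_cast at hpos ⊢
  field_simp
  ring

theorem narayanaPolynomial_succ_eq (β : ℝ) (n : ℕ) :
    narayanaPolynomial (n + 1) β = (pathPolynomial β n).coeff (n + 1 + 1) := by
  have hl : narayanaPolynomial (n + 1) β
      = ∑ a ∈ Finset.range (n + 1), narayanaNumber (n + 1) (n + 1 - a) * β ^ a := by
    rw [narayanaPolynomial]
    refine Finset.sum_nbij' (fun k => n + 1 - k) (fun a => n + 1 - a) ?_ ?_ ?_ ?_ ?_
    all_goals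
      intro k hk
      simp only [Finset.mem_Icc, Finset.mem_range] at hk ⊢
    · omega
    · omega
    · omega
    · omega
    · rw [show n + 1 - (n + 1 - k) = k by omega]
  have hr : (pathPolynomial β n).coeff (n + 1 + 1) = ∑ a ∈ Finset.range (n + 1),
      (n.choose a : ℝ) ^ 2 * β ^ a - ∑ a ∈ Finset.range (n + 1),
        (n.choose a : ℝ) * (n.choose (a + 2) : ℝ) * β ^ (a + 1) := by
    rw [pathPolynomial, mul_sub, coeff_sub, coeff_mul_C, add_assoc n 1 1, coeff_mul_X_pow,
      coeff_add_one_add_X_pow_mul]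
    have := coeff_add_one_add_X_pow_mul β n 0
    simp only [add_zero] at this
    rw [this, Finset.sum_mul]
    congr 1
    · exact Finset.sum_congr rfl fun j _ => by ring
    · exact Finset.sum_congr rfl fun j _ => by ring
  have hshift : ∑ a ∈ Finset.range (n + 1),
        (n.choose a : ℝ) * (n.choose (a + 2) : ℝ) * β ^ (a + 1)
      = ∑ a ∈ Finset.range (n + 1),
        (if a = 0 then 0 else (n.choose (a - 1) : ℝ)) * (n.choose (a + 1) : ℝ) * β ^ a := by
    rw [Finset.sum_range_succ, Nat.choose_eq_zero_of_lt (by omega : n < n + 2)]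
    rw [Finset.sum_range_succ' _ n]
    simp [add_assoc]
  rw [hl, hr, hshift, ← Finset.sum_sub_distrib]
  refine Finset.sum_congr rfl fun a ha => ?_
  rw [narayanaNumber_eq n a (by simpa [Nat.lt_succ_iff] using ha)]
  ring

theorem noncrossingSum_eq_narayanaPolynomial (β : ℝ) {p : ℕ} (hp : 1 ≤ p) :
    noncrossingSum β (Fin p) = narayanaPolynomial p β := by
  obtain ⟨n, rfl⟩ := Nat.exists_eq_add_of_le' hp
  have h := congrFun (congrFun ((isPathCount_noncrossing β).eq (isPathCount_pathPolynomial β)) n) 1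
  simp only [pow_one, noncrossingSeries, PowerSeries.coeff_mk, Nat.succ_ne_zero, if_false] at h
  rw [h, narayanaPolynomial_succ_eq]

end Narayana

/-! ### Trigonometric integrals as path counts -/

section Integral

open Real

theorem integral_cos_nat_mul (k : ℕ) (hk : k ≠ 0) : ∫ θ in (0 : ℝ)..π, cos (k * θ) = 0 := by
  have hk' : (k : ℝ) ≠ 0 := Nat.cast_ne_zero.2 hk
  rw [intervalIntegral.integral_comp_mul_left (fun x => cos x) hk', integral_cos]
  simp [sin_nat_mul_pi]

theorem integral_sin_mul_sin_nat_mul (h : ℕ) :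
    ∫ θ in (0 : ℝ)..π, sin θ * sin (h * θ) = if h = 1 then π / 2 else 0 := by
  rcases h with _ | _ | h
  · simp
  · simp only [zero_add, Nat.cast_one, one_mul, ← pow_two, if_true]
    rw [integral_sin_sq]
    simp
  · rw [if_neg (by omega)]
    have hf : ∀ θ : ℝ, sin θ * sin (((h + 1 + 1 : ℕ) : ℝ) * θ)
        = (1 / 2) * cos (((h + 1 : ℕ) : ℝ) * θ) - (1 / 2) * cos (((h + 3 : ℕ) : ℝ) * θ) := by
      intro θ
      have e1 : ((h + 1 : ℕ) : ℝ) * θ = ((h + 1 + 1 : ℕ) : ℝ) * θ - θ := by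
        push_cast
        ring
      have e2 : ((h + 3 : ℕ) : ℝ) * θ = ((h + 1 + 1 : ℕ) : ℝ) * θ + θ := by
        push_cast
        ring
      rw [e1, e2, cos_sub, cos_add]
      ring
    simp only [hf]
    rw [intervalIntegral.integral_sub, intervalIntegral.integral_const_mul,
      intervalIntegral.integral_const_mul, integral_cos_nat_mul _ (by omega),
      integral_cos_nat_mul _ (by omega)]
    · simp
    · exact (by fun_prop : Continuous _).intervalIntegrable _ _
    · exact (by fun_prop : Continuous _).intervalIntegrable _ _

/-- The recursion is the identity `2 * cos θ * sin ((h + 1) * θ) = sin (h * θ) + sin ((h + 2) * θ)`.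
The factor `s⁻¹ ^ h` turns the symmetric weights `s`, `s` into `1` and `s ^ 2`, and orthogonality of
the sines gives the initial values. -/
theorem isPathCount_integral {s : ℝ} (hs : 0 < s) :
    IsPathCount (s ^ 2) fun n h => s * (s⁻¹) ^ h * (2 / π) *
      ∫ θ in (0 : ℝ)..π, sin θ * sin (h * θ) * (1 + s ^ 2 + 2 * s * cos θ) ^ n := by
  refine ⟨fun h => ?_, fun n => by simp, fun n h => ?_⟩
  · simp only [pow_zero, mul_one, integral_sin_mul_sin_nat_mul]
    split_ifs with hh
    · subst hh
      have := pi_ne_zero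
      field_simp
    · simp
  · have hint : ∀ k : ℕ, IntervalIntegrable (fun θ : ℝ => sin θ * sin (k * θ) *
        (1 + s ^ 2 + 2 * s * cos θ) ^ n) volume 0 π := fun k =>
      (by fun_prop : Continuous _).intervalIntegrable _ _
    have hf : ∀ θ : ℝ, sin θ * sin (((h + 1 : ℕ) : ℝ) * θ) * (1 + s ^ 2 + 2 * s * cos θ) ^ (n + 1)
        = s * (sin θ * sin (((h : ℕ) : ℝ) * θ) * (1 + s ^ 2 + 2 * s * cos θ) ^ n)
          + (1 + s ^ 2) * (sin θ * sin (((h + 1 : ℕ) : ℝ) * θ) * (1 + s ^ 2 + 2 * s * cos θ) ^ n)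
          + s * (sin θ * sin (((h + 2 : ℕ) : ℝ) * θ) * (1 + s ^ 2 + 2 * s * cos θ) ^ n) := by
      intro θ
      have e1 : ((h : ℕ) : ℝ) * θ = ((h + 1 : ℕ) : ℝ) * θ - θ := by
        push_cast
        ring
      have e2 : ((h + 2 : ℕ) : ℝ) * θ = ((h + 1 : ℕ) : ℝ) * θ + θ := by
        push_cast
        ring
      rw [e1, e2, sin_sub, sin_add]
      ring
    simp only [hf]
    rw [intervalIntegral.integral_add, intervalIntegral.integral_add,
      intervalIntegral.integral_const_mul, intervalIntegral.integral_const_mul,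
      intervalIntegral.integral_const_mul]
    · have hss : s * s⁻¹ = 1 := mul_inv_cancel₀ hs.ne'
      generalize (∫ θ in (0 : ℝ)..π, sin θ * sin (((h : ℕ) : ℝ) * θ) *
        (1 + s ^ 2 + 2 * s * cos θ) ^ n) = a
      generalize (∫ θ in (0 : ℝ)..π, sin θ * sin (((h + 1 : ℕ) : ℝ) * θ) *
        (1 + s ^ 2 + 2 * s * cos θ) ^ n) = b
      generalize (∫ θ in (0 : ℝ)..π, sin θ * sin (((h + 2 : ℕ) : ℝ) * θ) *
        (1 + s ^ 2 + 2 * s * cos θ) ^ n) = c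
      rw [pow_add, pow_add, pow_one]
      linear_combination (s * s⁻¹ ^ h * (2 / π) * a) * hss
        - (s ^ 2 * s⁻¹ ^ h * s⁻¹ * (2 / π) * c) * hss
    · exact (hint _).const_mul _
    · exact (hint _).const_mul _
    · exact ((hint _).const_mul _).add ((hint _).const_mul _)
    · exact (hint _).const_mul _

theorem integral_sin_sq_mul_pow {β : ℝ} (hβ : 0 < β) {p : ℕ} (hp : 1 ≤ p) :
    2 / π * ∫ θ in (0 : ℝ)..π, sin θ ^ 2 * (1 + β + 2 * √β * cos θ) ^ (p - 1)
      = narayanaPolynomial p β := by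
  obtain ⟨n, rfl⟩ := Nat.exists_eq_add_of_le' hp
  have hs := Real.sqrt_pos.2 hβ
  have hI := isPathCount_integral hs
  rw [Real.sq_sqrt hβ.le] at hI
  have h := congrFun (congrFun (hI.eq (isPathCount_pathPolynomial β)) n) 1
  simp only [pow_one, Nat.cast_one, one_mul, mul_inv_cancel₀ hs.ne', ← pow_two] at h
  rw [narayanaPolynomial_succ_eq, ← h, Nat.add_sub_cancel]

end Integral

/-! ### The Marchenko–Pastur law -/

section MarchenkoPastur

open Real

theorem one_add_sq_add_cos_pos {s θ : ℝ} (hs : 0 < s) (h0 : 0 < θ) (hπ : θ < π) :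
    0 < 1 + s ^ 2 + 2 * s * cos θ := by
  have h : -1 < cos θ := by
    rw [← cos_pi]
    exact cos_lt_cos_of_nonneg_of_le_pi h0.le le_rfl hπ
  nlinarith [sq_nonneg (1 - s)]

/-- A Poisson kernel. The arctangent in the primitive is the argument of `1 + s * exp (iθ)`, a point
that stays in the right half-plane because `s < 1`. -/
theorem integral_inv_one_add_sq_add_cos {s : ℝ} (hs : 0 < s) (hs1 : s < 1) :
    ∫ θ in (0 : ℝ)..π, (1 + s ^ 2 + 2 * s * cos θ)⁻¹ = π / (1 - s ^ 2) := by
  have hD : ∀ θ : ℝ, 0 < 1 + s ^ 2 + 2 * s * cos θ := fun θ => by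
    nlinarith [neg_one_le_cos θ, sq_pos_of_pos (sub_pos.2 hs1)]
  have hE : ∀ θ : ℝ, 0 < 1 + s * cos θ := fun θ => by nlinarith [neg_one_le_cos θ]
  have hs2 : 1 - s ^ 2 ≠ 0 := by nlinarith
  have hderiv : ∀ θ : ℝ, HasDerivAt
      (fun θ => (θ - 2 * arctan (s * sin θ / (1 + s * cos θ))) / (1 - s ^ 2))
      (1 + s ^ 2 + 2 * s * cos θ)⁻¹ θ := by
    intro θ
    have h1 : HasDerivAt (fun θ => s * sin θ / (1 + s * cos θ))
        ((s * cos θ * (1 + s * cos θ) - s * sin θ * (s * -sin θ)) / (1 + s * cos θ) ^ 2) θ :=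
      ((hasDerivAt_sin θ).const_mul s).div (((hasDerivAt_cos θ).const_mul s).const_add 1) (hE θ).ne'
    have h2 := (((hasDerivAt_id θ).sub ((h1.arctan).const_mul 2)).div_const (1 - s ^ 2))
    convert! h2 using 1
    have hsq : (1 + s * cos θ) ^ 2 + (s * sin θ) ^ 2 = 1 + s ^ 2 + 2 * s * cos θ := by
      linear_combination s ^ 2 * sin_sq_add_cos_sq θ
    have e1 : 1 + (s * sin θ / (1 + s * cos θ)) ^ 2
        = (1 + s ^ 2 + 2 * s * cos θ) / (1 + s * cos θ) ^ 2 := by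
      rw [← hsq]
      have := (hE θ).ne'
      field_simp
    have e2 : s * cos θ * (1 + s * cos θ) - s * sin θ * (s * -sin θ) = s * cos θ + s ^ 2 := by
      linear_combination s ^ 2 * sin_sq_add_cos_sq θ
    rw [e1, e2]
    have := (hE θ).ne'
    have := (hD θ).ne'
    generalize hK : 1 + s ^ 2 + 2 * s * cos θ = K at this ⊢
    field_simp
    linear_combination hK
  rw [intervalIntegral.integral_eq_sub_of_hasDerivAt (fun θ _ => hderiv θ)]
  · simp
  · refine (Continuous.inv₀ (by fun_prop) fun θ => (hD θ).ne').intervalIntegrable _ _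

/-- For `s < 1`, division of `sin² θ` by the denominator, as polynomials in `cos θ`, leaves a
multiple of the Poisson kernel. For `s = 1` the denominator vanishes at `π`, but on the open
interval the quotient is `(1 - cos θ) / 2`. -/
theorem integral_sin_sq_div {s : ℝ} (hs : 0 < s) (hs1 : s ≤ 1) :
    ∫ θ in (0 : ℝ)..π, sin θ ^ 2 / (1 + s ^ 2 + 2 * s * cos θ) = π / 2 := by
  rcases hs1.lt_or_eq with hlt | rfl
  · have hD : ∀ θ : ℝ, 0 < 1 + s ^ 2 + 2 * s * cos θ := fun θ => by
      nlinarith [neg_one_le_cos θ, sq_pos_of_pos (sub_pos.2 hlt)]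
    have hf : ∀ θ : ℝ, sin θ ^ 2 / (1 + s ^ 2 + 2 * s * cos θ) = (1 + s ^ 2) / (4 * s ^ 2)
        - 1 / (2 * s) * cos θ
        - (1 - s ^ 2) ^ 2 / (4 * s ^ 2) * (1 + s ^ 2 + 2 * s * cos θ)⁻¹ := by
      intro θ
      have := (hD θ).ne'
      rw [sin_sq]
      generalize hK : 1 + s ^ 2 + 2 * s * cos θ = K at this ⊢
      field_simp
      linear_combination 2 * (1 + s ^ 2 - 2 * s * cos θ) * hK
    have hcont : Continuous fun θ : ℝ => (1 + s ^ 2 + 2 * s * cos θ)⁻¹ :=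
      Continuous.inv₀ (by fun_prop) fun θ => (hD θ).ne'
    simp only [hf]
    rw [intervalIntegral.integral_sub, intervalIntegral.integral_sub,
      intervalIntegral.integral_const_mul, intervalIntegral.integral_const_mul,
      integral_inv_one_add_sq_add_cos hs hlt, integral_cos, intervalIntegral.integral_const]
    · have hs2 : 1 - s ^ 2 ≠ 0 := by nlinarith
      simp only [sin_pi, sin_zero, sub_zero, mul_zero, smul_eq_mul]
      field_simp
      ring
    · exact (by fun_prop : Continuous _).intervalIntegrable _ _
    · exact (by fun_prop : Continuous _).intervalIntegrable _ _
    · exact (by fun_prop : Continuous _).intervalIntegrable _ _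
    · exact (hcont.const_mul _).intervalIntegrable _ _
  · have hf : ∫ θ in (0 : ℝ)..π, sin θ ^ 2 / (1 + 1 ^ 2 + 2 * 1 * cos θ)
        = ∫ θ in (0 : ℝ)..π, (1 / 2 - 1 / 2 * cos θ) := by
      rw [intervalIntegral.integral_of_le pi_pos.le, intervalIntegral.integral_of_le pi_pos.le,
        integral_Ioc_eq_integral_Ioo, integral_Ioc_eq_integral_Ioo]
      refine setIntegral_congr_fun measurableSet_Ioo fun θ hθ => ?_
      have hpos := one_add_sq_add_cos_pos one_pos hθ.1 hθ.2
      rw [sin_sq, div_eq_iff hpos.ne']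
      ring
    rw [hf, intervalIntegral.integral_sub, intervalIntegral.integral_const_mul, integral_cos]
    · simp
      ring
    · exact (by fun_prop : Continuous _).intervalIntegrable _ _
    · exact (by fun_prop : Continuous _).intervalIntegrable _ _

variable {β : ℝ}

theorem marchenkoPasturDensity_nonneg (hβ : 0 ≤ β) (x : ℝ) : 0 ≤ marchenkoPasturDensity β x := by
  refine Set.indicator_nonneg (fun y hy => ?_) x
  have : 0 ≤ y := (sq_nonneg _).trans hy.1
  positivity

theorem measurable_marchenkoPasturDensity (β : ℝ) : Measurable (marchenkoPasturDensity β) := by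
  refine Measurable.indicator ?_ measurableSet_Icc
  fun_prop

theorem image_one_add_add_cos (hβ : 0 < β) :
    (fun θ => 1 + β + 2 * √β * cos θ) '' Set.Ioo 0 π
      = Set.Ioo ((1 - √β) ^ 2) ((1 + √β) ^ 2) := by
  have hs := sqrt_pos.2 hβ
  have hsq := sq_sqrt hβ.le
  ext x
  simp only [Set.mem_image, Set.mem_Ioo]
  constructor
  · rintro ⟨θ, ⟨h0, hπ⟩, rfl⟩
    have h1 : -1 < cos θ := by
      rw [← cos_pi]
      exact cos_lt_cos_of_nonneg_of_le_pi h0.le le_rfl hπ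
    have h2 : cos θ < 1 := by
      rw [← cos_zero]
      exact cos_lt_cos_of_nonneg_of_le_pi le_rfl hπ.le h0
    constructor <;> nlinarith
  · rintro ⟨h1, h2⟩
    have e1 : -1 < (x - 1 - β) / (2 * √β) := by
      rw [lt_div_iff₀ (by positivity)]
      nlinarith
    have e2 : (x - 1 - β) / (2 * √β) < 1 := by
      rw [div_lt_iff₀ (by positivity)]
      nlinarith
    refine ⟨arccos ((x - 1 - β) / (2 * √β)), ⟨arccos_pos.2 e2, ?_⟩, ?_⟩
    · refine lt_of_le_of_ne (arccos_le_pi _) fun h => ?_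
      have := cos_arccos e1.le e2.le
      rw [h, cos_pi] at this
      linarith
    · rw [cos_arccos e1.le e2.le]
      field_simp
      ring

/-- With `x = 1 + β + 2√β cos θ` the radicand of the density becomes a perfect square, so the
density times the Jacobian is rational in `cos θ`. -/
theorem abs_deriv_mul_marchenkoPasturDensity (hβ : 0 < β) {θ : ℝ}
    (hθ : θ ∈ Set.Ioo 0 π) :
    |2 * √β * -sin θ| * marchenkoPasturDensity β (1 + β + 2 * √β * cos θ)
      = 2 / π * (sin θ ^ 2 / (1 + β + 2 * √β * cos θ)) := by
  have hs := sqrt_pos.2 hβ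
  have hsq := sq_sqrt hβ.le
  have hsin := sin_pos_of_pos_of_lt_pi hθ.1 hθ.2
  have hmem : (1 + β + 2 * √β * cos θ) ∈ Set.Icc ((1 - √β) ^ 2) ((1 + √β) ^ 2) :=
    Set.Ioo_subset_Icc_self ((image_one_add_add_cos hβ) ▸ Set.mem_image_of_mem _ hθ)
  have hrad : ((1 + √β) ^ 2 - (1 + β + 2 * √β * cos θ)) * ((1 + β + 2 * √β * cos θ) - (1 - √β) ^ 2)
      = (2 * √β * sin θ) ^ 2 := by
    have h1 : (1 + √β) ^ 2 - (1 + β + 2 * √β * cos θ) = 2 * √β * (1 - cos θ) := by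
      linear_combination hsq
    have h2 : (1 + β + 2 * √β * cos θ) - (1 - √β) ^ 2 = 2 * √β * (1 + cos θ) := by
      linear_combination -hsq
    rw [h1, h2]
    linear_combination -(4 * √β ^ 2) * sin_sq_add_cos_sq θ
  rw [marchenkoPasturDensity, Set.indicator_of_mem hmem, hrad, sqrt_sq (by positivity), mul_neg,
    abs_neg, abs_of_pos (by positivity)]
  have hnum : 2 * √β * sin θ * (2 * √β * sin θ) = 4 * β * sin θ ^ 2 := by
    linear_combination 4 * sin θ ^ 2 * hsq
  rw [mul_div_assoc', hnum]
  have hx0 : 0 < 1 + β + 2 * √β * cos θ :=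
    (sq_nonneg (1 - √β)).trans_lt
      ((image_one_add_add_cos hβ) ▸ Set.mem_image_of_mem (fun θ => 1 + β + 2 * √β * cos θ) hθ).1
  have := pi_ne_zero
  field_simp
  ring

theorem hasDerivWithinAt_one_add_add_cos (β : ℝ) (S : Set ℝ) :
    ∀ θ ∈ S, HasDerivWithinAt (fun θ => 1 + β + 2 * √β * cos θ) (2 * √β * -sin θ) S θ :=
  fun θ _ => (((hasDerivAt_cos θ).const_mul (2 * √β)).const_add (1 + β)).hasDerivWithinAt

theorem injOn_one_add_add_cos (hβ : 0 < β) :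
    Set.InjOn (fun θ => 1 + β + 2 * √β * cos θ) (Set.Ioo 0 π) := by
  intro x hx y hy h
  have hs := sqrt_pos.2 hβ
  have h' : cos x = cos y := by
    have : 2 * √β * cos x = 2 * √β * cos y := by simpa using h
    exact mul_left_cancel₀ (by positivity) this
  exact injOn_cos (Set.Ioo_subset_Icc_self hx) (Set.Ioo_subset_Icc_self hy) h'

/-- The endpoints are dropped because for `β = 1` the substitution reaches the pole `x = 0` at `θ =
π`. -/
theorem marchenkoPasturDensity_eq_indicator_Ioo_ae (β : ℝ) (g : ℝ → ℝ) :
    (fun x => marchenkoPasturDensity β x * g x) =ᵐ[volume]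
      Set.indicator (Set.Ioo ((1 - √β) ^ 2) ((1 + √β) ^ 2))
        (fun x => marchenkoPasturDensity β x * g x) := by
  have h : Set.indicator (Set.Icc ((1 - √β) ^ 2) ((1 + √β) ^ 2))
      (fun x => marchenkoPasturDensity β x * g x) = fun x => marchenkoPasturDensity β x * g x := by
    refine Set.indicator_eq_self.2 fun x hx => ?_
    by_contra hmem
    exact hx (by simp [marchenkoPasturDensity, Set.indicator_of_notMem hmem])
  conv_lhs => rw [← h]
  exact (indicator_ae_eq_of_ae_eq_set Ioo_ae_eq_Icc).symm

theorem integral_marchenkoPasturDensity_mul (hβ : 0 < β) (g : ℝ → ℝ) :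
    ∫ x, marchenkoPasturDensity β x * g x = 2 / π * ∫ θ in (0 : ℝ)..π,
      sin θ ^ 2 / (1 + β + 2 * √β * cos θ) * g (1 + β + 2 * √β * cos θ) := by
  rw [integral_congr_ae (marchenkoPasturDensity_eq_indicator_Ioo_ae β g),
    integral_indicator measurableSet_Ioo, ← image_one_add_add_cos hβ,
    integral_image_eq_integral_abs_deriv_smul measurableSet_Ioo
      (hasDerivWithinAt_one_add_add_cos β _) (injOn_one_add_add_cos hβ),
    intervalIntegral.integral_of_le pi_pos.le, integral_Ioc_eq_integral_Ioo, ← integral_const_mul]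
  refine setIntegral_congr_fun measurableSet_Ioo fun θ hθ => ?_
  simp only [smul_eq_mul]
  rw [← mul_assoc, abs_deriv_mul_marchenkoPasturDensity hβ hθ, mul_assoc]

theorem integrable_marchenkoPasturDensity_mul (hβ : 0 < β) {g : ℝ → ℝ} (hg : Continuous g) :
    Integrable fun x => marchenkoPasturDensity β x * g x := by
  rw [integrable_congr (marchenkoPasturDensity_eq_indicator_Ioo_ae β g),
    integrable_indicator_iff measurableSet_Ioo, ← image_one_add_add_cos hβ,
    integrableOn_image_iff_integrableOn_abs_deriv_smul measurableSet_Ioo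
      (hasDerivWithinAt_one_add_add_cos β _) (injOn_one_add_add_cos hβ)]
  have hcongr : Set.EqOn (fun θ => |2 * √β * -sin θ| • (marchenkoPasturDensity β
      (1 + β + 2 * √β * cos θ) * g (1 + β + 2 * √β * cos θ)))
      (fun θ => 2 / π * (sin θ ^ 2 / (1 + β + 2 * √β * cos θ)) * g (1 + β + 2 * √β * cos θ))
      (Set.Ioo 0 π) := fun θ hθ => by
    simp only [smul_eq_mul]
    rw [← mul_assoc, abs_deriv_mul_marchenkoPasturDensity hβ hθ]
  rw [integrableOn_congr_fun hcongr measurableSet_Ioo]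
  obtain ⟨C, hC⟩ := (isCompact_Icc (a := (0 : ℝ)) (b := π)).exists_bound_of_continuousOn
    (f := fun θ => g (1 + β + 2 * √β * cos θ)) (by fun_prop)
  refine Measure.integrableOn_of_bounded (M := 2 / π * C) (by simp)
    (Measurable.aestronglyMeasurable ?_) ?_
  · have := hg.measurable
    fun_prop
  filter_upwards [ae_restrict_mem measurableSet_Ioo] with θ hθ
  rw [norm_mul]
  refine mul_le_mul ?_ (hC θ (Set.Ioo_subset_Icc_self hθ)) (norm_nonneg _) (by positivity)
  have hsq := sq_sqrt hβ.le
  -- The difference of the two sides is `(√β + cos θ) ^ 2`, so the quotient stays bounded up to the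
  -- possible pole.
  have hle : sin θ ^ 2 ≤ 1 + β + 2 * √β * cos θ := by
    nlinarith [sq_nonneg (√β + cos θ), sin_sq_add_cos_sq θ]
  have h0 : 0 ≤ 1 + β + 2 * √β * cos θ := (sq_nonneg _).trans hle
  rw [norm_of_nonneg (by positivity)]
  exact mul_le_of_le_one_right (by positivity) (div_le_one_of_le₀ hle h0)

theorem isProbabilityMeasure_marchenkoPastur (hβ : 0 < β) (hβ1 : β ≤ 1) :
    IsProbabilityMeasure (marchenkoPastur β) := by
  constructor
  have hi := integrable_marchenkoPasturDensity_mul hβ (g := fun _ => 1) continuous_const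
  simp only [mul_one] at hi
  rw [marchenkoPastur, withDensity_apply _ MeasurableSet.univ, Measure.restrict_univ,
    ← ofReal_integral_eq_lintegral_ofReal hi (ae_of_all _ (marchenkoPasturDensity_nonneg hβ.le))]
  have h := integral_marchenkoPasturDensity_mul hβ fun _ => 1
  have h2 := integral_sin_sq_div (sqrt_pos.2 hβ) (sqrt_le_one.2 hβ1)
  rw [sq_sqrt hβ.le] at h2
  simp only [mul_one] at h
  rw [h, h2]
  have := pi_ne_zero
  field_simp
  simp

theorem integrable_marchenkoPastur (hβ : 0 < β) {g : ℝ → ℝ} (hg : Continuous g) :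
    Integrable g (marchenkoPastur β) := by
  rw [marchenkoPastur, integrable_withDensity_iff
    (measurable_marchenkoPasturDensity β).ennreal_ofReal (ae_of_all _ fun _ => ENNReal.ofReal_lt_top)]
  simp only [ENNReal.toReal_ofReal (marchenkoPasturDensity_nonneg hβ.le _)]
  simpa only [mul_comm] using integrable_marchenkoPasturDensity_mul hβ hg

theorem integral_pow_marchenkoPastur (hβ : 0 < β) {p : ℕ} (hp : 1 ≤ p) :
    ∫ y, y ^ p ∂(marchenkoPastur β) = narayanaPolynomial p β := by
  rw [marchenkoPastur, integral_withDensity_eq_integral_toReal_smul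
    (measurable_marchenkoPasturDensity β).ennreal_ofReal (ae_of_all _ fun _ => ENNReal.ofReal_lt_top)]
  simp only [ENNReal.toReal_ofReal (marchenkoPasturDensity_nonneg hβ.le _), smul_eq_mul]
  rw [integral_marchenkoPasturDensity_mul hβ, ← integral_sin_sq_mul_pow hβ hp]
  congr 1
  rw [intervalIntegral.integral_of_le pi_pos.le, intervalIntegral.integral_of_le pi_pos.le,
    integral_Ioc_eq_integral_Ioo, integral_Ioc_eq_integral_Ioo]
  refine setIntegral_congr_fun measurableSet_Ioo fun θ hθ => ?_
  have hpos := one_add_sq_add_cos_pos (sqrt_pos.2 hβ) hθ.1 hθ.2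
  rw [sq_sqrt hβ.le] at hpos
  obtain ⟨n, rfl⟩ := Nat.exists_eq_add_of_le' hp
  simp only [Nat.add_sub_cancel, pow_succ]
  field_simp

end MarchenkoPastur

/-- The asymptotic fraction of the integer points of the box that are circulations of `s`. -/
noncomputable def circulationVolume {p : ℕ} (s : Setoid (Fin p)) : ℝ :=
  (tendsto_card_circulations s).choose

/-! ### Limits of the moments and the conclusion -/

theorem tendsto_circulationVolume {p : ℕ} (s : Setoid (Fin p)) :
    Tendsto (fun M : ℕ => ((circulations s M).card : ℝ) /
      (2 * (M : ℝ) + 1) ^ ((nonminima s).card + 1)) atTop (𝓝 (circulationVolume s)) :=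
  (tendsto_card_circulations s).choose_spec

theorem circulationVolume_nonneg {p : ℕ} (s : Setoid (Fin p)) : 0 ≤ circulationVolume s :=
  ge_of_tendsto' (tendsto_circulationVolume s) fun _ => by positivity

theorem circulationVolume_le_one {p : ℕ} (s : Setoid (Fin p)) : circulationVolume s ≤ 1 :=
  le_of_tendsto' (tendsto_circulationVolume s) fun M =>
    div_le_one_of_le₀ (card_circulations_le s M) (by positivity)

theorem circulationVolume_eq_one {p : ℕ} {s : Setoid (Fin p)} (hs : IsNoncrossing s) :
    circulationVolume s = 1 := by
  rcases card_circulations_dichotomy s with ⟨-, h⟩ | ⟨h, -⟩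
  · refine tendsto_nhds_unique (tendsto_circulationVolume s) (tendsto_const_nhds.congr fun M => ?_)
    rw [h M]
    push_cast
    rw [div_self (by positivity)]
  · exact absurd hs h

theorem circulationVolume_lt_one {p : ℕ} {s : Setoid (Fin p)} (hs : ¬ IsNoncrossing s) :
    circulationVolume s < 1 := by
  rcases card_circulations_dichotomy s with ⟨h, -⟩ | ⟨-, ε, hε, h⟩
  · exact absurd h hs
  · refine (le_of_tendsto (b := 1 - ε) (tendsto_circulationVolume s) ?_).trans_lt (by linarith)
    filter_upwards [eventually_ge_atTop 1] with M hM
    exact (div_le_iff₀ (by positivity)).2 (h M hM)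

/-- The limit of the normalized mean trace moments along the asymptotic regime. -/
noncomputable def limitMoment (β : ℝ) (d p : ℕ) : ℝ :=
  ∑ s : Setoid (Fin p), β ^ (nonminima s).card * circulationVolume s ^ d

theorem limitMoment_le_factorial {β : ℝ} (h0 : 0 ≤ β) (h1 : β ≤ 1) (d p : ℕ) :
    limitMoment β d p ≤ (p.factorial : ℝ) :=
  calc limitMoment β d p ≤ ∑ _s : Setoid (Fin p), (1 : ℝ) :=
        Finset.sum_le_sum fun s _ => mul_le_one₀ (pow_le_one₀ h0 h1)
          (pow_nonneg (circulationVolume_nonneg s) d)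
          (pow_le_one₀ (circulationVolume_nonneg s) (circulationVolume_le_one s))
    _ ≤ (p.factorial : ℝ) := by
        simpa using (Nat.cast_le (α := ℝ)).2 (card_setoid_fin_le_factorial p)

/-- The volume is `1` for noncrossing partitions and below `1` for the others, whose `d`-th powers
die out. -/
theorem tendsto_limitMoment (β : ℝ) (p : ℕ) :
    Tendsto (fun d => limitMoment β d p) atTop (𝓝 (noncrossingSum β (Fin p))) := by
  classical
  rw [noncrossingSum, Finset.sum_filter]
  refine tendsto_finsetSum _ fun s _ => ?_
  split_ifs with hs
  · simp [circulationVolume_eq_one hs]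
  · simpa using (tendsto_pow_atTop_nhds_zero_of_lt_one (circulationVolume_nonneg s)
      (circulationVolume_lt_one hs)).const_mul (β ^ (nonminima s).card)

theorem tendsto_fst_asymptoticRegime (d : ℕ) (β : ℝ) :
    Tendsto Prod.fst (asymptoticRegime d β) atTop :=
  tendsto_fst.mono_left inf_le_left

theorem tendsto_snd_asymptoticRegime (d : ℕ) (β : ℝ) :
    Tendsto Prod.snd (asymptoticRegime d β) atTop :=
  tendsto_snd.mono_left inf_le_left

theorem tendsto_harmonicsRatio (d : ℕ) (β : ℝ) :
    Tendsto (fun n : ℕ × ℕ => harmonicsRatio d n.1 n.2) (asymptoticRegime d β) (𝓝 β) :=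
  tendsto_comap.mono_left inf_le_right

theorem tendsto_descFactorial_div_pow (k : ℕ) :
    Tendsto (fun r : ℕ => (r.descFactorial k : ℝ) / (r : ℝ) ^ k) atTop (𝓝 1) := by
  refine (Asymptotics.isEquivalent_iff_tendsto_one ?_).1 (isEquivalent_descFactorial k)
  filter_upwards [eventually_gt_atTop 0] with r hr
  positivity

theorem tendsto_integral_pow_meanEigenvalueLaw (d : ℕ) (β : ℝ) (p : ℕ) :
    Tendsto (fun n : ℕ × ℕ => ∫ y, y ^ p ∂(meanEigenvalueLaw d n.1 n.2)) (asymptoticRegime d β)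
      (𝓝 (limitMoment β d p)) := by
  have hsnd := tendsto_snd_asymptoticRegime d β
  have hsum : Tendsto (fun n : ℕ × ℕ => ∑ s : Setoid (Fin p),
      (n.2.descFactorial (Nat.card (Quotient s)) : ℝ) / (n.2 : ℝ) ^ Nat.card (Quotient s)
        * harmonicsRatio d n.1 n.2 ^ (nonminima s).card
        * (((circulations s n.1).card : ℝ) / (2 * (n.1 : ℝ) + 1) ^ ((nonminima s).card + 1)) ^ d)
      (asymptoticRegime d β) (𝓝 (limitMoment β d p)) := by
    refine tendsto_finsetSum _ fun s _ => ?_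
    simpa using (((tendsto_descFactorial_div_pow _).comp hsnd).mul
      ((tendsto_harmonicsRatio d β).pow _)).mul
      (((tendsto_circulationVolume s).comp (tendsto_fst_asymptoticRegime d β)).pow d)
  refine hsum.congr' ?_
  filter_upwards [hsnd.eventually (eventually_gt_atTop 0)] with n hn
  have h := (meanTraceMoment_eq_sum_setoid d n.1 n.2 p hn).symm.trans
    (meanTraceMoment_eq_integral d n.1 n.2 p)
  exact_mod_cast h

theorem exists_asymptoticEigenvalueLaw {β : ℝ} (hβ0 : 0 < β) (hβ1 : β ≤ 1) {d : ℕ} (hd : 1 ≤ d) :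
    ∃ ν : ProbabilityMeasure ℝ, IsAsymptoticEigenvalueLaw d β ν ∧ ∀ p : ℕ,
      Integrable (fun y : ℝ => y ^ p) (ν : Measure ℝ) ∧
        ∫ y, y ^ p ∂(ν : Measure ℝ) = limitMoment β d p := by
  have := asymptoticRegime_neBot hd hβ0
  obtain ⟨ν, hν, hmom⟩ := exists_limit_of_moments (F := asymptoticRegime d β)
    (ρ := fun n => ⟨meanEigenvalueLaw d n.1 n.2, inferInstance⟩) (m := limitMoment β d)
    (fun p => Eventually.of_forall fun n =>
      integrable_meanEigenvalueLaw d n.1 n.2 (continuous_pow p))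
    (tendsto_integral_pow_meanEigenvalueLaw d β)
    (fun k => limitMoment_le_factorial hβ0.le hβ1 d _)
  refine ⟨ν, fun f => ?_, hmom⟩
  have h := ProbabilityMeasure.tendsto_iff_forall_integral_tendsto.1 hν f
  exact h.congr fun n => integral_meanEigenvalueLaw d n.1 n.2 f.continuous

theorem integral_pow_marchenkoPastur_eq_noncrossingSum {β : ℝ} (hβ0 : 0 < β) (hβ1 : β ≤ 1)
    (p : ℕ) : ∫ y, y ^ p ∂(marchenkoPastur β) = noncrossingSum β (Fin p) := by
  have := isProbabilityMeasure_marchenkoPastur hβ0 hβ1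
  rcases Nat.eq_zero_or_pos p with rfl | hp
  · simp [noncrossingSum_zero]
  · rw [integral_pow_marchenkoPastur hβ0 hp, noncrossingSum_eq_narayanaPolynomial β hp]

theorem eq_marchenkoPastur_of_moments {β : ℝ} (hβ0 : 0 < β) (hβ1 : β ≤ 1) {μ : Measure ℝ}
    [IsProbabilityMeasure μ] (hint : ∀ p : ℕ, Integrable (fun y : ℝ => y ^ p) μ)
    (heq : ∀ p : ℕ, ∫ y, y ^ p ∂μ = noncrossingSum β (Fin p)) : μ = marchenkoPastur β := by
  have := isProbabilityMeasure_marchenkoPastur hβ0 hβ1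
  exact measure_ext_of_moments hint
    (fun p => integrable_marchenkoPastur hβ0 (continuous_pow p))
    (fun p => by rw [heq, integral_pow_marchenkoPastur_eq_noncrossingSum hβ0 hβ1])
    (fun k => by rw [heq]; exact noncrossingSum_le_factorial hβ0.le hβ1 _)

theorem lemma3 (β : ℝ) (hβ0 : 0 < β) (hβ1 : β ≤ 1) :
    ∃ (ν : ℕ → ProbabilityMeasure ℝ) (μ : ProbabilityMeasure ℝ),
      -- `ν d` is the law of `λ_{d,β}`, and its moments are the limits of the mean traces
      (∀ d : ℕ, 1 ≤ d → IsAsymptoticEigenvalueLaw d β (ν d)) ∧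
      (∀ d : ℕ, 1 ≤ d → ∀ p : ℕ, 1 ≤ p →
        Integrable (fun y : ℝ => y ^ p) (ν d : Measure ℝ) ∧
        Tendsto (fun n : ℕ × ℕ => meanTraceMoment d n.1 n.2 p) (asymptoticRegime d β)
          (𝓝 ((∫ y : ℝ, y ^ p ∂(ν d : Measure ℝ) : ℝ) : ℂ))) ∧
      -- the limits of the moments as `d → ∞` are the Narayana polynomials
      (∀ p : ℕ, 1 ≤ p →
        Tendsto (fun d : ℕ => ∫ y : ℝ, y ^ p ∂(ν d : Measure ℝ)) atTop
          (𝓝 (narayanaPolynomial p β))) ∧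
      -- `μ` is the Marchenko–Pastur law; it is the limit in law of `λ_{d,β}` as `d → ∞`
      (μ : Measure ℝ) = marchenkoPastur β ∧
      Tendsto ν atTop (𝓝 μ) ∧
      -- `μ` is the only probability law whose moments are these limits
      (∀ μ' : ProbabilityMeasure ℝ,
        (∀ p : ℕ, 1 ≤ p → Integrable (fun y : ℝ => y ^ p) (μ' : Measure ℝ) ∧
          ∫ y : ℝ, y ^ p ∂(μ' : Measure ℝ) = narayanaPolynomial p β) ↔ μ' = μ) := by
  classical
  have hMP := isProbabilityMeasure_marchenkoPastur hβ0 hβ1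
  set μ : ProbabilityMeasure ℝ := ⟨marchenkoPastur β, hMP⟩ with hμ
  -- The law `ν 0` is unconstrained; the limits as `d → ∞` only see `d ≥ 1`.
  choose! ν hν hmom using fun d (hd : 1 ≤ d) => exists_asymptoticEigenvalueLaw hβ0 hβ1 hd
  have hlim : ∀ p : ℕ, Tendsto (fun d => ∫ y : ℝ, y ^ p ∂(ν d : Measure ℝ)) atTop
      (𝓝 (noncrossingSum β (Fin p))) := fun p => (tendsto_limitMoment β p).congr' <| by
    filter_upwards [eventually_ge_atTop 1] with d hd
    exact (hmom d hd p).2.symm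
  refine ⟨ν, μ, hν, fun d hd p _ => ⟨(hmom d hd p).1, ?_⟩, fun p hp => ?_, rfl, ?_,
    fun μ' => ⟨fun h => ?_, ?_⟩⟩
  · rw [(hmom d hd p).2]
    refine ((Complex.continuous_ofReal.tendsto _).comp
      (tendsto_integral_pow_meanEigenvalueLaw d β p)).congr fun n => ?_
    exact (meanTraceMoment_eq_integral d n.1 n.2 p).symm
  · rw [← noncrossingSum_eq_narayanaPolynomial β hp]
    exact hlim p
  · obtain ⟨μ₁, h₁, hm₁⟩ := exists_limit_of_moments (F := atTop) (ρ := ν)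
      (fun p => (eventually_ge_atTop 1).mono fun d hd => (hmom d hd p).1) hlim
      (fun k => noncrossingSum_le_factorial hβ0.le hβ1 _)
    have hMP₁ : (μ₁ : Measure ℝ) = marchenkoPastur β :=
      eq_marchenkoPastur_of_moments hβ0 hβ1 (fun p => (hm₁ p).1) fun p => (hm₁ p).2
    have hμ₁ : μ₁ = μ := Subtype.ext hMP₁
    exact hμ₁ ▸ h₁
  · suffices hMP' : (μ' : Measure ℝ) = marchenkoPastur β from Subtype.ext hMP'
    refine eq_marchenkoPastur_of_moments hβ0 hβ1 (fun p => ?_) fun p => ?_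
    -- The moment of order `0` is outside the hypothesis and comes from the total mass.
    · rcases Nat.eq_zero_or_pos p with rfl | hp
      · simp
      · exact (h p hp).1
    · rcases Nat.eq_zero_or_pos p with rfl | hp
      · simp [noncrossingSum_zero]
      · rw [noncrossingSum_eq_narayanaPolynomial β hp]
        exact (h p hp).2
  · rintro rfl p hp
    exact ⟨integrable_marchenkoPastur hβ0 (continuous_pow p), integral_pow_marchenkoPastur hβ0 hp⟩
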